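/- Consider the extended shallow water system $$u_t+uu_x+vu_y+h_x=b_x,\qquad v_t+uv_x+vv_y+h_y=b_y,\qquad h_t+(uh)_x+(vh)_y=0,\qquad b_t=0$$ for real functions $(u,v,h,b)$ of $(t,x,y)$. A (local) point symmetry of this system is a $C^\infty$ diffeomorphism $\Phi$ between two open subsets of $\mathbb R^7$ (coordinates $(t,x,y,u,v,h,b)$) such that * whenever $\Phi$ maps the graph of a smooth function $w=(u,v,h,b)$ on an open subset of $\mathbb R^3$ onto the graph of a smooth function $w'$ on an open subset of $\mathbb R^3$, $w$ is a solution of the system if and only if $w'$ is; and * every nonempty open subset of the domain of $\Phi$ contains the graph of a solution, defined on a nonempty open set, that $\Phi$ maps onto the graph of a smooth function on an open set (so that the first condition is not void). The point symmetries that are diffeomorphisms of the whole $\mathbb R^7$ form a group $G$ under composition, and every local point symmetry with connected nonempty domain is the restriction of exactly one element of $G$; thus $G$ is the complete point symmetry group of the system. Let $G$ carry the topology of locally uniform convergence of transformations together with their inverses, and let $G_0$ be its identity component. Then $$G/G_0\;\cong\;\mathbb Z_2\times\mathbb Z_2 .$$ -/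

import Mathlib

open scoped ContDiff

namespace ShallowWater

/-- The space of the independent variables `(t, x, y)`, indexed by `0, 1, 2`. -/
abbrev Indep : Type := Fin 3 → ℝ

/-- The space of the dependent variables `(u, v, h, b)`, indexed by `0, 1, 2, 3`. -/
abbrev Dep : Type := Fin 4 → ℝ

/-- The space with the coordinates `(t, x, y, u, v, h, b)`, on which point transformations act. -/
abbrev Total : Type := Indep × Dep

/-- The partial derivative of `f` with respect to `t` (`i = 0`), `x` (`i = 1`) or `y` (`i = 2`). -/
noncomputable def pd (i : Fin 3) (f : Indep → ℝ) (z : Indep) : ℝ :=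
  fderiv ℝ f z (Pi.single i 1)

/-- The four equations of the extended shallow water system at the point `z`:
`u_t + u u_x + v u_y + h_x = b_x`, `v_t + u v_x + v v_y + h_y = b_y`,
`h_t + (u h)_x + (v h)_y = 0`, `b_t = 0`. -/
def SatisfiesAt (u v h b : Indep → ℝ) (z : Indep) : Prop :=
  pd 0 u z + u z * pd 1 u z + v z * pd 2 u z + pd 1 h z = pd 1 b z ∧
  pd 0 v z + u z * pd 1 v z + v z * pd 2 v z + pd 2 h z = pd 2 b z ∧
  pd 0 h z + pd 1 (fun s => u s * h s) z + pd 2 (fun s => v s * h s) z = 0 ∧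
  pd 0 b z = 0

/-- A smooth local section: a smooth function `(u, v, h, b)` of `(t, x, y)` on an open set `Ω`. -/
structure IsSmoothSection (w : Indep → Dep) (Ω : Set Indep) : Prop where
  isOpen : IsOpen Ω
  contDiffOn : ContDiffOn ℝ ∞ w Ω

/-- A smooth local solution of the extended shallow water system on an open set `Ω`. -/
structure IsSolution (w : Indep → Dep) (Ω : Set Indep) : Prop extends IsSmoothSection w Ω where
  eqs : ∀ z ∈ Ω,
    SatisfiesAt (fun s => w s 0) (fun s => w s 1) (fun s => w s 2) (fun s => w s 3) z

/-- `Φ` maps the graph of `w` over `Ω`, which lies in the domain of `Φ`, onto the graph of `w'`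
over `Ω'`; both `w` and `w'` are smooth on the respective open sets. -/
structure MapsGraph (Φ : OpenPartialHomeomorph Total Total)
    (w : Indep → Dep) (Ω : Set Indep) (w' : Indep → Dep) (Ω' : Set Indep) : Prop where
  left : IsSmoothSection w Ω
  right : IsSmoothSection w' Ω'
  subset_source : Ω.graphOn w ⊆ Φ.source
  image_eq : Φ '' Ω.graphOn w = Ω'.graphOn w'

/-- A (local) point symmetry of the extended shallow water system: a smooth diffeomorphism `Φ`
between open subsets of the space of `(t, x, y, u, v, h, b)` such that

* whenever `Φ` maps the graph of a smooth function `w` onto the graph of a smooth function `w'`,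
  `w` is a solution if and only if `w'` is a solution;
* `Φ` does act on solutions: inside every nonempty open part of its domain there is a solution
  whose graph is mapped by `Φ` onto the graph of a function.

The second condition only excludes transformations for which the first one is void. For example,
the permutation of the coordinates `t` and `b` never maps the graph of a solution onto the graph
of a function, since `b_t = 0`. -/
structure IsLocalPointSymmetry (Φ : OpenPartialHomeomorph Total Total) : Prop where
  smooth : ContDiffOn ℝ ∞ Φ Φ.source
  smooth_symm : ContDiffOn ℝ ∞ Φ.symm Φ.target
  solution_iff : ∀ (w : Indep → Dep) (Ω : Set Indep) (w' : Indep → Dep) (Ω' : Set Indep),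
    MapsGraph Φ w Ω w' Ω' → (IsSolution w Ω ↔ IsSolution w' Ω')
  acts : ∀ O : Set Total, IsOpen O → O.Nonempty → O ⊆ Φ.source →
    ∃ (w : Indep → Dep) (Ω : Set Indep) (w' : Indep → Dep) (Ω' : Set Indep),
      Ω.Nonempty ∧ Ω.graphOn w ⊆ O ∧ IsSolution w Ω ∧ MapsGraph Φ w Ω w' Ω'

/-- A (global) point symmetry: a point symmetry that is a transformation of the whole space. -/
def IsPointSymmetry (g : Total ≃ₜ Total) : Prop :=
  IsLocalPointSymmetry g.toOpenPartialHomeomorph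

/-- The continuous map underlying a homeomorphism of the total space. -/
def toMap (g : Total ≃ₜ Total) : C(Total, Total) := ⟨g, g.continuous⟩

/-- The topology of locally uniform convergence (the compact-open topology) of transformations
together with their inverses. -/
instance instTopologicalSpaceHomeomorph : TopologicalSpace (Total ≃ₜ Total) :=
  TopologicalSpace.induced (fun g => (toMap g, toMap g⁻¹)) inferInstance

theorem continuous_toMap_pair :
    Continuous (fun g : Total ≃ₜ Total => (toMap g, toMap g⁻¹)) :=
  continuous_induced_dom

instance instIsTopologicalGroupHomeomorph : IsTopologicalGroup (Total ≃ₜ Total) where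
  continuous_mul := by
    have h1 := continuous_fst.comp continuous_toMap_pair
    have h2 := continuous_snd.comp continuous_toMap_pair
    refine continuous_induced_rng.2 (Continuous.prodMk ?_ ?_)
    · exact (h1.comp continuous_fst).compCM (h1.comp continuous_snd)
    · exact (h2.comp continuous_snd).compCM (h2.comp continuous_fst)
  continuous_inv := by
    have h1 := continuous_fst.comp continuous_toMap_pair
    have h2 := continuous_snd.comp continuous_toMap_pair
    exact continuous_induced_rng.2 (Continuous.prodMk h2 h1)

/-- The identity component of a topological group is a normal subgroup. -/
instance instNormalConnectedComponentOfOne (G : Type*) [TopologicalSpace G] [Group G]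
    [IsTopologicalGroup G] : (Subgroup.connectedComponentOfOne G).Normal where
  conj_mem n hn g := by
    have hc : Continuous (fun a : G => g * a * g⁻¹) := by fun_prop
    have h := hc.image_connectedComponent_subset (1 : G) (Set.mem_image_of_mem _ hn)
    rw [mul_one, mul_inv_cancel] at h
    exact h

end ShallowWater

/-! A point symmetry is pinned down by its action on first derivatives. Every matrix of first
derivatives that the equations allow at a point belongs to some solution (`exists_isSolution_jet`),
and a graph that stays transversal under the symmetry is locally sent to a graph
(`exists_mapsGraph`). So the differential of a symmetry carries allowed transversal derivatives to
allowed ones (`IsLocalPointSymmetry.exists_jetEqs`), and from here on the problem is algebra at a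
point followed by differentiation of the resulting identities.

Allowed matrices that differ by a rank one matrix detect characteristic covectors, which are
therefore preserved (`PreservesJets.exists_inSymbolKernel`). The characteristic polynomial is ξ₀ τ
(τ² − h(ξ₁² + ξ₂²)) with τ = ξ₀ + uξ₁ + vξ₂. For h ≠ 0 the only planes in its zero set are those of
the two linear factors, and these planes annihilate the time direction ∂_t and the transport
direction ∂_t + u∂_x + v∂_y. Hence a symmetry keeps or interchanges the two directions. An
interchange would make the differential of the new x vanish, so both are kept (`sum_sq_eq_zero`). It
follows that the new t, x, y depend on the old t, x, y only, that the new x, y do not depend on t,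
and that the new velocity is given by the chain rule.

Comparing coefficients of the derivatives that remain free in the transformed equations then makes
the new time a function of t alone, the map of the plane conformal with factor tied to the scalings
of time and of h, and the new h equal to κh (`momentum_first`, `momentum_second`). One more
differentiation kills all second derivatives: for time because b_t = 0, for space because a momentum
relation is a quadratic polynomial in (u, v). This leaves a scaling of time by α ≠ 0, a similarity
of the plane of either orientation, the induced maps of u, v, h, b, and translations of t, x, y, b
(`exists_eq_model`, `exists_symmParam`). Conversely all of these are symmetries, since the residuals
of the equations transform linearly and invertibly (`SymmParam.jetEqs_iff`).

The components are read off from two multiplicative, continuous, nowhere vanishing functions on the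
group: α and the determinant of the planar part. Their signs give a surjection onto Z₂ × Z₂. Its
kernel is a continuous image of the vector space ℝ × ℂ × ℝ⁴ under exponentials, hence connected, and
the identity component cannot leave it (`ker_signs`). -/

namespace ShallowWater

open scoped Matrix

/-! ### First derivatives of sections and their transformation -/

/-- The equations of the system for a matrix `W` of first derivatives at a point with values `y`. -/
def JetEqs (y : Dep) (W : Matrix (Fin 4) (Fin 3) ℝ) : Prop :=
  W 0 0 + y 0 * W 0 1 + y 1 * W 0 2 + W 2 1 = W 3 1 ∧
  W 1 0 + y 0 * W 1 1 + y 1 * W 1 2 + W 2 2 = W 3 2 ∧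
  W 2 0 + y 0 * W 2 1 + y 1 * W 2 2 + y 2 * (W 0 1 + W 1 2) = 0 ∧
  W 3 0 = 0

/-- The matrix of first derivatives of `w` at `z`. -/
noncomputable def jet (w : Indep → Dep) (z : Indep) : Matrix (Fin 4) (Fin 3) ℝ :=
  fun i j => fderiv ℝ w z (Pi.single j 1) i

/-- The tangent vectors of a graph with the matrix of first derivatives `W`. -/
def tangent (W : Matrix (Fin 4) (Fin 3) ℝ) (j : Fin 3) : Total :=
  (Pi.single j 1, fun i => W i j)

theorem pd_apply {w : Indep → Dep} {z : Indep} (hw : DifferentiableAt ℝ w z) (i : Fin 4)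
    (j : Fin 3) : pd j (fun s => w s i) z = jet w z i j := by
  unfold pd jet
  rw [fderiv_apply hw]
  rfl

theorem satisfiesAt_iff {w : Indep → Dep} {z : Indep} (hw : DifferentiableAt ℝ w z) :
    SatisfiesAt (fun s => w s 0) (fun s => w s 1) (fun s => w s 2) (fun s => w s 3) z ↔
      JetEqs (w z) (jet w z) := by
  have hd : ∀ i, DifferentiableAt ℝ (fun s => w s i) z := differentiableAt_pi.1 hw
  have hm : ∀ i k j, pd j (fun s => w s i * w s k) z =
      w z i * jet w z k j + w z k * jet w z i j := by
    intro i k j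
    rw [← pd_apply hw, ← pd_apply hw]
    unfold pd
    rw [fderiv_fun_mul (hd i) (hd k)]
    simp
  unfold SatisfiesAt JetEqs
  simp only [pd_apply hw, hm]
  refine and_congr Iff.rfl (and_congr Iff.rfl (and_congr ?_ Iff.rfl))
  constructor <;> intro h <;> linarith

theorem IsSmoothSection.contDiffAt {w : Indep → Dep} {Ω : Set Indep} (h : IsSmoothSection w Ω)
    {z : Indep} (hz : z ∈ Ω) : ContDiffAt ℝ ∞ w z :=
  h.contDiffOn.contDiffAt (h.isOpen.mem_nhds hz)

theorem IsSmoothSection.differentiableAt {w : Indep → Dep} {Ω : Set Indep}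
    (h : IsSmoothSection w Ω) {z : Indep} (hz : z ∈ Ω) : DifferentiableAt ℝ w z :=
  (h.contDiffAt hz).differentiableAt (by simp)

theorem isSolution_iff {w : Indep → Dep} {Ω : Set Indep} :
    IsSolution w Ω ↔ IsSmoothSection w Ω ∧ ∀ z ∈ Ω, JetEqs (w z) (jet w z) := by
  constructor
  · intro h
    exact ⟨h.1, fun z hz => (satisfiesAt_iff (h.1.differentiableAt hz)).1 (h.eqs z hz)⟩
  · intro h
    exact ⟨h.1, fun z hz => (satisfiesAt_iff (h.1.differentiableAt hz)).2 (h.2 z hz)⟩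

theorem hasFDerivAt_graph {w : Indep → Dep} {z : Indep} (hw : DifferentiableAt ℝ w z) :
    HasFDerivAt (fun s => (s, w s))
      ((ContinuousLinearMap.id ℝ Indep).prod (fderiv ℝ w z)) z :=
  (hasFDerivAt_id z).prodMk hw.hasFDerivAt

/-- The matrix of derivatives of the transformed independent variables along a graph. -/
noncomputable def baseMatrix (L : Total →L[ℝ] Total) (W : Matrix (Fin 4) (Fin 3) ℝ) :
    Matrix (Fin 3) (Fin 3) ℝ :=
  fun i j => (L (tangent W j)).1 i

theorem MapsGraph.apply {Φ : OpenPartialHomeomorph Total Total} {w w' : Indep → Dep}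
    {Ω Ω' : Set Indep} (h : MapsGraph Φ w Ω w' Ω') {z : Indep} (hz : z ∈ Ω) :
    (Φ (z, w z)).1 ∈ Ω' ∧ w' (Φ (z, w z)).1 = (Φ (z, w z)).2 := by
  have h1 : Φ (z, w z) ∈ Ω'.graphOn w' := by
    rw [← h.image_eq]
    exact ⟨_, ⟨z, hz, rfl⟩, rfl⟩
  obtain ⟨s, hs, hs'⟩ := h1
  rw [← hs']
  exact ⟨hs, rfl⟩

theorem MapsGraph.mem_source {Φ : OpenPartialHomeomorph Total Total} {w w' : Indep → Dep}
    {Ω Ω' : Set Indep} (h : MapsGraph Φ w Ω w' Ω') {z : Indep} (hz : z ∈ Ω) :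
    (z, w z) ∈ Φ.source := h.subset_source ⟨z, hz, rfl⟩

theorem clm_eq_sum (W : Indep →L[ℝ] Dep) (s : Indep) (i : Fin 4) :
    W s i = ∑ k, W (Pi.single k 1) i * s k := by
  conv_lhs => rw [pi_eq_sum_univ' s]
  simp [map_sum, Finset.sum_apply, mul_comm]

theorem tangent_jet (w : Indep → Dep) (z : Indep) (j : Fin 3) :
    tangent (jet w z) j = (Pi.single j 1, fderiv ℝ w z (Pi.single j 1)) := rfl

theorem fderiv_comp_graph {Φ : OpenPartialHomeomorph Total Total}
    (hΦ : ContDiffOn ℝ ∞ Φ Φ.source) {w : Indep → Dep} {z : Indep}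
    (hw : DifferentiableAt ℝ w z) (hs : (z, w z) ∈ Φ.source) :
    HasFDerivAt (fun s => Φ (s, w s)) ((fderiv ℝ Φ (z, w z)).comp
      ((ContinuousLinearMap.id ℝ Indep).prod (fderiv ℝ w z))) z := by
  have h1 : DifferentiableAt ℝ Φ (z, w z) :=
    (hΦ.contDiffAt (Φ.open_source.mem_nhds hs)).differentiableAt (by simp)
  exact HasFDerivAt.comp (f := fun s => (s, w s)) z h1.hasFDerivAt (hasFDerivAt_graph hw)

/-- The chain rule applied to w' ∘ (new independent variables) = (new dependent variables) along the
graph. It is kept in product form, so that the base matrix need not be inverted. -/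
theorem MapsGraph.jet_eq {Φ : OpenPartialHomeomorph Total Total}
    (hΦ : ContDiffOn ℝ ∞ Φ Φ.source) {w w' : Indep → Dep}
    {Ω Ω' : Set Indep} (h : MapsGraph Φ w Ω w' Ω') {z : Indep} (hz : z ∈ Ω) (i : Fin 4)
    (j : Fin 3) :
    ∑ k, jet w' (Φ (z, w z)).1 i k * (fderiv ℝ Φ (z, w z) (tangent (jet w z) j)).1 k =
      (fderiv ℝ Φ (z, w z) (tangent (jet w z) j)).2 i := by
  have hw := h.left.differentiableAt hz
  have h1 := fderiv_comp_graph hΦ hw (h.mem_source hz)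
  have h2 := (h.right.differentiableAt (h.apply hz).1).hasFDerivAt
  have h3 : HasFDerivAt (fun s => w' (Φ (s, w s)).1) _ z := h2.comp z h1.fst
  have h4 : HasFDerivAt (fun s => (Φ (s, w s)).2) _ z := h1.snd
  have h5 : (fun s => w' (Φ (s, w s)).1) =ᶠ[nhds z] fun s => (Φ (s, w s)).2 := by
    filter_upwards [h.left.isOpen.mem_nhds hz] with s hs using (h.apply hs).2
  have h6 := (h5.hasFDerivAt_iff.1 h3).unique h4
  have h7 := congrFun (DFunLike.congr_fun h6 (Pi.single j 1)) i
  rw [tangent_jet]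
  unfold jet
  rw [← clm_eq_sum]
  simpa using h7

/-- The inverse of Φ restricted to the image graph gives a differentiable left inverse of the map of
the base, so the derivative of that map has no kernel. -/
theorem MapsGraph.det_ne_zero {Φ : OpenPartialHomeomorph Total Total}
    (hΦ : ContDiffOn ℝ ∞ Φ Φ.source) (hΨ : ContDiffOn ℝ ∞ Φ.symm Φ.target) {w w' : Indep → Dep}
    {Ω Ω' : Set Indep} (h : MapsGraph Φ w Ω w' Ω') {z : Indep} (hz : z ∈ Ω) :
    (baseMatrix (fderiv ℝ Φ (z, w z)) (jet w z)).det ≠ 0 := by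
  have hw := h.left.differentiableAt hz
  have hs := h.mem_source hz
  have h1 := (fderiv_comp_graph hΦ hw hs).fst
  have hw' := h.right.differentiableAt (h.apply hz).1
  have e : ∀ s ∈ Ω, ((Φ (s, w s)).1, w' (Φ (s, w s)).1) = Φ (s, w s) := fun s hs' => by
    rw [(h.apply hs').2]
  have h2 := (fderiv_comp_graph (Φ := Φ.symm) hΨ hw'
    (by rw [e z hz]; exact Φ.map_source hs)).fst
  have h3 := h2.comp z h1
  have h4 : (fun s => (Φ.symm ((Φ (s, w s)).1, w' (Φ (s, w s)).1)).1) =ᶠ[nhds z] id := by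
    filter_upwards [h.left.isOpen.mem_nhds hz] with s hs'
    rw [e s hs', Φ.left_inv (h.mem_source hs')]
    rfl
  have h5 := (h4.hasFDerivAt_iff.1 h3).unique (hasFDerivAt_id z)
  intro hdet
  obtain ⟨v, hv, hv'⟩ := Matrix.exists_mulVec_eq_zero_iff.2 hdet
  apply hv
  have h6 := DFunLike.congr_fun h5 v
  have h7 : (fderiv ℝ Φ (z, w z) (v, fderiv ℝ w z v)).1 = 0 := by
    rw [← hv']
    have : (v, fderiv ℝ w z v) = ∑ j, v j • tangent (jet w z) j := by
      have : ((ContinuousLinearMap.id ℝ Indep).prod (fderiv ℝ w z)) v = 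
        ((ContinuousLinearMap.id ℝ Indep).prod (fderiv ℝ w z)) 
          (∑ j, v j • (Pi.single j 1 : Indep)) := by rw [← pi_eq_sum_univ' v]
      rw [map_sum] at this
      simpa [tangent_jet] using this
    rw [this, map_sum]
    ext i
    simp [Prod.fst_sum, Finset.sum_apply, Matrix.mulVec, dotProduct, baseMatrix, mul_comm]
  simp only [ContinuousLinearMap.coe_comp, Function.comp_apply, ContinuousLinearMap.coe_fst',
    ContinuousLinearMap.prod_apply, ContinuousLinearMap.coe_id', id_eq] at h6
  rw [h7, map_zero, Prod.mk_zero_zero, map_zero] at h6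
  exact h6.symm

/-! ### Solutions with prescribed first derivatives -/

/-- A `C^∞` vector field has a `C^∞` local integral curve through every point. -/
theorem exists_contDiffOn_integralCurve {E : Type*} [NormedAddCommGroup E] [NormedSpace ℝ E]
    [CompleteSpace E] {F : E → E} (hF : ContDiff ℝ ∞ F) (x₀ : E) (t₀ : ℝ) :
    ∃ γ : ℝ → E, γ t₀ = x₀ ∧ ∃ ε > (0 : ℝ),
      (∀ t ∈ Set.Ioo (t₀ - ε) (t₀ + ε), HasDerivAt γ (F (γ t)) t) ∧
      ContDiffOn ℝ ∞ γ (Set.Ioo (t₀ - ε) (t₀ + ε)) := by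
  obtain ⟨γ, h0, ε, hε, hγ⟩ := ContDiffAt.exists_forall_mem_closedBall_exists_eq_forall_mem_Ioo_hasDerivAt₀
    ((hF.of_le (by simp)).contDiffAt (x := x₀)) t₀
  refine ⟨γ, h0, ε, hε, hγ, ?_⟩
  have hd : DifferentiableOn ℝ γ (Set.Ioo (t₀ - ε) (t₀ + ε)) := fun t ht =>
    (hγ t ht).differentiableAt.differentiableWithinAt
  rw [contDiffOn_infty]
  intro n
  induction n with
  | zero => exact contDiffOn_zero.2 hd.continuousOn
  | succ n ih =>
    have : ContDiffOn ℝ ((n : ℕ∞) + 1 : WithTop ℕ∞) γ (Set.Ioo (t₀ - ε) (t₀ + ε)) := by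
      rw [contDiffOn_succ_iff_deriv_of_isOpen isOpen_Ioo]
      refine ⟨hd, by simp, ?_⟩
      -- Bootstrapping: γ' = F ∘ γ is as smooth as γ, so γ gains one derivative.
      have h1 : ContDiffOn ℝ n (F ∘ γ) (Set.Ioo (t₀ - ε) (t₀ + ε)) :=
        (hF.of_le (by exact_mod_cast le_top)).comp_contDiffOn ih
      exact h1.congr fun t ht => (hγ t ht).deriv
    exact_mod_cast this

theorem pd_affine {p q r : ℝ → ℝ} {p' q' r' x y : ℝ} {z : Indep} (hp : HasDerivAt p p' (z 0))
    (hq : HasDerivAt q q' (z 0)) (hr : HasDerivAt r r' (z 0)) :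
    let f : Indep → ℝ := fun s => p (s 0) * (s 1 - x) + q (s 0) * (s 2 - y) + r (s 0)
    pd 0 f z = p' * (z 1 - x) + q' * (z 2 - y) + r' ∧ pd 1 f z = p (z 0) ∧ pd 2 f z = q (z 0) := by
  intro f
  have h0 : ∀ i : Fin 3, HasFDerivAt (fun s : Indep => s i) (ContinuousLinearMap.proj i) z :=
    fun i => (ContinuousLinearMap.proj (R := ℝ) (φ := fun _ : Fin 3 => ℝ) i).hasFDerivAt
  have hp' := HasDerivAt.comp_hasFDerivAt (f := fun s : Indep => s 0) z hp (h0 0)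
  have hq' := HasDerivAt.comp_hasFDerivAt (f := fun s : Indep => s 0) z hq (h0 0)
  have hr' := HasDerivAt.comp_hasFDerivAt (f := fun s : Indep => s 0) z hr (h0 0)
  have hf : HasFDerivAt f _ z :=
    ((hp'.mul ((h0 1).sub_const x)).add (hq'.mul ((h0 2).sub_const y))).add hr'
  unfold pd
  rw [hf.fderiv]
  refine ⟨?_, ?_, ?_⟩ <;> simp
  ring

/-- The vector field governing the coefficients of the solutions that are affine in `x, y`. -/
def coeffField (s₁ s₂ : ℝ) (g : Fin 9 → ℝ) : Fin 9 → ℝ :=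
  ![-(g 0 * g 0 + g 1 * g 2), -(g 0 * g 1 + g 1 * g 3),
    -(g 2 * g 0 + g 3 * g 2), -(g 2 * g 1 + g 3 * g 3),
    s₁ - g 6 - (g 0 * g 4 + g 1 * g 5), s₂ - g 7 - (g 2 * g 4 + g 3 * g 5),
    -(g 0 * g 6 + g 2 * g 7 + (g 0 + g 3) * g 6),
    -(g 1 * g 6 + g 3 * g 7 + (g 0 + g 3) * g 7),
    -(g 4 * g 6 + g 5 * g 7 + (g 0 + g 3) * g 8)]

theorem contDiff_coeffField (s₁ s₂ : ℝ) : ContDiff ℝ ∞ (coeffField s₁ s₂) := by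
  rw [contDiff_pi]
  intro i
  fin_cases i <;> simp [coeffField] <;> fun_prop

/-- The local function affine in `x, y` with the coefficients `γ`. -/
def affineSection (γ : ℝ → Fin 9 → ℝ) (x y s₁ s₂ b : ℝ) (z : Indep) : Dep :=
  ![γ (z 0) 0 * (z 1 - x) + γ (z 0) 1 * (z 2 - y) + γ (z 0) 4,
    γ (z 0) 2 * (z 1 - x) + γ (z 0) 3 * (z 2 - y) + γ (z 0) 5,
    γ (z 0) 6 * (z 1 - x) + γ (z 0) 7 * (z 2 - y) + γ (z 0) 8,
    s₁ * (z 1 - x) + s₂ * (z 2 - y) + b]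

/-- Every matrix of first derivatives satisfying the equations comes from a solution. -/
theorem exists_isSolution_jet (z₀ : Indep) (y₀ : Dep) (W : Matrix (Fin 4) (Fin 3) ℝ)
    (hW : JetEqs y₀ W) :
    ∃ (w : Indep → Dep) (Ω : Set Indep), z₀ ∈ Ω ∧ IsSolution w Ω ∧ w z₀ = y₀ ∧ jet w z₀ = W := by
  -- Sections affine in x, y with coefficients depending on t are closed under the nonlinearities,
  -- since every product is a value times a spatial derivative. The system becomes an ODE for nine
  -- coefficients: the velocity gradient (0–3), the velocity at the base point (4, 5), the height
  -- gradient (6, 7) and the height there (8). The function b is affine with constant coefficients.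
  obtain ⟨γ, h0, ε, hε, hγ, hs⟩ := exists_contDiffOn_integralCurve
    (contDiff_coeffField (W 3 1) (W 3 2))
    ![W 0 1, W 0 2, W 1 1, W 1 2, y₀ 0, y₀ 1, W 2 1, W 2 2, y₀ 2] (z₀ 0)
  set I := Set.Ioo (z₀ 0 - ε) (z₀ 0 + ε) with hI
  set w := affineSection γ (z₀ 1) (z₀ 2) (W 3 1) (W 3 2) (y₀ 3) with hw
  have hΩ : IsOpen {z : Indep | z 0 ∈ I} := isOpen_Ioo.preimage (continuous_apply 0)
  have hmem : z₀ 0 ∈ I := ⟨by linarith, by linarith⟩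
  have hsm : IsSmoothSection w {z : Indep | z 0 ∈ I} := by
    refine ⟨hΩ, ?_⟩
    have hc : ∀ i, ContDiffOn ℝ ∞ (fun z : Indep => γ (z 0) i) {z : Indep | z 0 ∈ I} := by
      intro i
      exact (contDiffOn_pi.1 hs i).comp (t := I) (f := fun z : Indep => z 0)
        (contDiff_apply ℝ ℝ (0 : Fin 3)).contDiffOn (fun z hz => hz)
    rw [contDiffOn_pi]
    intro i
    have hl : ∀ i j k, ContDiffOn ℝ ∞ (fun z : Indep => γ (z 0) i * (z 1 - z₀ 1) +
        γ (z 0) j * (z 2 - z₀ 2) + γ (z 0) k) {z : Indep | z 0 ∈ I} := fun i j k =>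
      (((hc i).mul (by fun_prop)).add ((hc j).mul (by fun_prop))).add (hc k)
    fin_cases i
    · exact hl 0 1 4
    · exact hl 2 3 5
    · exact hl 6 7 8
    · simp only [hw, affineSection, Fin.reduceFinMk, Matrix.cons_val]
      fun_prop
  have hder : ∀ z : Indep, z 0 ∈ I → ∀ i, HasDerivAt (fun t => γ t i)
      (coeffField (W 3 1) (W 3 2) (γ (z 0)) i) (z 0) :=
    fun z hz => hasDerivAt_pi.1 (hγ (z 0) hz)
  have hj : ∀ z : Indep, z 0 ∈ I → ∀ i j, jet w z i j = pd j (fun s => w s i) z :=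
    fun z hz i j => (pd_apply (hsm.differentiableAt hz) i j).symm
  have hj0 : ∀ z : Indep, z 0 ∈ I → _ := fun z hz =>
    pd_affine (x := z₀ 1) (y := z₀ 2) (hder z hz 0) (hder z hz 1) (hder z hz 4)
  have hj1 : ∀ z : Indep, z 0 ∈ I → _ := fun z hz =>
    pd_affine (x := z₀ 1) (y := z₀ 2) (hder z hz 2) (hder z hz 3) (hder z hz 5)
  have hj2 : ∀ z : Indep, z 0 ∈ I → _ := fun z hz =>
    pd_affine (x := z₀ 1) (y := z₀ 2) (hder z hz 6) (hder z hz 7) (hder z hz 8)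
  have hj3 : ∀ z : Indep, z 0 ∈ I → _ := fun z _ =>
    pd_affine (x := z₀ 1) (y := z₀ 2) (hasDerivAt_const (z 0) (W 3 1))
      (hasDerivAt_const (z 0) (W 3 2)) (hasDerivAt_const (z 0) (y₀ 3))
  have hsol : ∀ z : Indep, z 0 ∈ I → JetEqs (w z) (jet w z) := by
    intro z hz
    obtain ⟨a1, a2, a3⟩ := hj0 z hz
    obtain ⟨b1, b2, b3⟩ := hj1 z hz
    obtain ⟨c1, c2, c3⟩ := hj2 z hz
    obtain ⟨d1, d2, d3⟩ := hj3 z hz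
    simp only [JetEqs, hj z hz]
    refine ⟨?_, ?_, ?_, ?_⟩ 
    · simp only [hw, affineSection, Matrix.cons_val]
      rw [a1, a2, a3, c2, d2]
      simp [coeffField]; ring
    · simp only [hw, affineSection, Matrix.cons_val]
      rw [b1, b2, b3, c3, d3]
      simp [coeffField]; ring
    · simp only [hw, affineSection, Matrix.cons_val]
      rw [c1, c2, c3, a2, b3]
      simp [coeffField]; ring
    · simp only [hw, affineSection, Matrix.cons_val]
      rw [d1]
      ring
  have hw0 : w z₀ = y₀ := by
    ext i
    fin_cases i <;> simp [hw, affineSection, h0]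
  refine ⟨w, {z | z 0 ∈ I}, hmem, isSolution_iff.2 ⟨hsm, hsol⟩, hw0, ?_⟩
  have hs0 := hsol z₀ hmem
  obtain ⟨a1, a2, a3⟩ := hj0 z₀ hmem
  obtain ⟨b1, b2, b3⟩ := hj1 z₀ hmem
  obtain ⟨c1, c2, c3⟩ := hj2 z₀ hmem
  obtain ⟨d1, d2, d3⟩ := hj3 z₀ hmem
  have e01 : jet w z₀ 0 1 = W 0 1 := by rw [hj z₀ hmem]; exact a2.trans (by simp [h0])
  have e02 : jet w z₀ 0 2 = W 0 2 := by rw [hj z₀ hmem]; exact a3.trans (by simp [h0])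
  have e11 : jet w z₀ 1 1 = W 1 1 := by rw [hj z₀ hmem]; exact b2.trans (by simp [h0])
  have e12 : jet w z₀ 1 2 = W 1 2 := by rw [hj z₀ hmem]; exact b3.trans (by simp [h0])
  have e21 : jet w z₀ 2 1 = W 2 1 := by rw [hj z₀ hmem]; exact c2.trans (by simp [h0])
  have e22 : jet w z₀ 2 2 = W 2 2 := by rw [hj z₀ hmem]; exact c3.trans (by simp [h0])
  have e31 : jet w z₀ 3 1 = W 3 1 := by rw [hj z₀ hmem]; exact d2
  have e32 : jet w z₀ 3 2 = W 3 2 := by rw [hj z₀ hmem]; exact d3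
  -- The spatial derivatives agree by the choice of initial data; the time derivatives agree because
  -- the equations determine them from the rest.
  rw [hw0] at hs0
  obtain ⟨f0, f1, f2, f3⟩ := hs0
  obtain ⟨g0, g1, g2, g3⟩ := hW
  rw [e01, e02, e21, e31] at f0
  rw [e11, e12, e22, e32] at f1
  rw [e21, e22, e01, e12] at f2
  ext i j
  fin_cases i <;> fin_cases j <;> simp only [Fin.zero_eta, Fin.mk_one, Fin.reduceFinMk] <;>
    first | assumption | linarith

/-! ### Images of transversal graphs and the pointwise symmetry condition -/

theorem contDiffOn_component {Φ : OpenPartialHomeomorph Total Total} {w : Indep → Dep}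
    (hΦ : ContDiffOn ℝ ∞ Φ Φ.source) {Ω : Set Indep} (hw : ContDiffOn ℝ ∞ w Ω)
    (hs : ∀ z ∈ Ω, (z, w z) ∈ Φ.source) : ContDiffOn ℝ ∞ (fun z => Φ (z, w z)) Ω :=
  hΦ.comp (f := fun z => (z, w z)) (contDiffOn_id.prodMk hw) hs

/-- A graph that is transversal after transformation is locally mapped onto a graph. -/
theorem exists_mapsGraph {Φ : OpenPartialHomeomorph Total Total}
    (hΦ : ContDiffOn ℝ ∞ Φ Φ.source) {w : Indep → Dep} {Ω : Set Indep}
    (hw : IsSmoothSection w Ω) {z₀ : Indep} (hz : z₀ ∈ Ω) (hs : (z₀, w z₀) ∈ Φ.source)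
    (hdet : (baseMatrix (fderiv ℝ Φ (z₀, w z₀)) (jet w z₀)).det ≠ 0) :
    ∃ (Ω₁ : Set Indep) (w' : Indep → Dep) (Ω' : Set Indep),
      z₀ ∈ Ω₁ ∧ Ω₁ ⊆ Ω ∧ MapsGraph Φ w Ω₁ w' Ω' := by
  -- the open set on which the graph lies in the source
  have hcont : ContinuousOn (fun z => (z, w z)) Ω := continuousOn_id.prodMk hw.contDiffOn.continuousOn
  have hΩ₂ : IsOpen (Ω ∩ (fun z => (z, w z)) ⁻¹' Φ.source) :=
    hcont.isOpen_inter_preimage hw.isOpen Φ.open_source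
  set Ω₂ := Ω ∩ (fun z => (z, w z)) ⁻¹' Φ.source with hΩ₂'
  have hsm : ContDiffOn ℝ ∞ (fun z => Φ (z, w z)) Ω₂ :=
    contDiffOn_component hΦ (hw.contDiffOn.mono Set.inter_subset_left) fun z hz => hz.2
  set f : Indep → Indep := fun z => (Φ (z, w z)).1 with hf
  have hfs : ContDiffOn ℝ ∞ f Ω₂ := contDiff_fst.comp_contDiffOn hsm
  have hdf : ContinuousOn (fun z => (fderiv ℝ f z).det) Ω₂ :=
    ContinuousLinearMap.continuous_det.comp_continuousOn
      (hfs.continuousOn_fderiv_of_isOpen hΩ₂ (by simp))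
  have hΩ₃ : IsOpen (Ω₂ ∩ (fun z => (fderiv ℝ f z).det) ⁻¹' {0}ᶜ) :=
    hdf.isOpen_inter_preimage hΩ₂ isOpen_compl_singleton
  set Ω₃ := Ω₂ ∩ (fun z => (fderiv ℝ f z).det) ⁻¹' {0}ᶜ with hΩ₃'
  have hmat : (fderiv ℝ f z₀).det = (baseMatrix (fderiv ℝ Φ (z₀, w z₀)) (jet w z₀)).det := by
    have h1 := (fderiv_comp_graph hΦ (hw.differentiableAt hz) hs).fst
    have h2 : HasFDerivAt f _ z₀ := h1
    rw [h2.fderiv]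
    rw [ContinuousLinearMap.det, ← LinearMap.det_toMatrix']
    congr 1
  have hz₃ : z₀ ∈ Ω₃ := ⟨⟨hz, hs⟩, by
    show (fderiv ℝ f z₀).det ≠ 0
    rw [hmat]; exact hdet⟩
  have hat : ∀ z ∈ Ω₃, ContDiffAt ℝ ∞ f z := fun z hz =>
    hfs.contDiffAt (hΩ₂.mem_nhds hz.1)
  have hne : ∀ z, z ∈ Ω₃ → (fderiv ℝ f z).det ≠ 0 := fun z hz => hz.2
  have hequiv : ∀ z (hz : z ∈ Ω₃), HasFDerivAt f
      ((fderiv ℝ f z).toContinuousLinearEquivOfDetNeZero (hne z hz) : Indep →L[ℝ] Indep) z := by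
    intro z hz
    rw [ContinuousLinearMap.coe_toContinuousLinearEquivOfDetNeZero]
    exact ((hat z hz).differentiableAt (by simp)).hasFDerivAt
  -- The inverse function theorem for the map of the base. Restricting to `Ω₃`, where the
  -- determinant does not vanish, makes the inverse smooth on its whole domain and not only near one
  -- point.
  set e := ((hat z₀ hz₃).toOpenPartialHomeomorph f (hequiv z₀ hz₃) (by simp)).restrOpen Ω₃ hΩ₃
    with he
  have hes : e.source ⊆ Ω₃ := by
    rw [he, OpenPartialHomeomorph.restrOpen_source]
    exact Set.inter_subset_right
  have hef : ∀ z, e z = f z := fun z => rfl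
  have hz₁ : z₀ ∈ e.source := by
    rw [he, OpenPartialHomeomorph.restrOpen_source]
    exact ⟨(hat z₀ hz₃).mem_toOpenPartialHomeomorph_source _ _, hz₃⟩
  have hsymm : ContDiffOn ℝ ∞ e.symm e.target := by
    intro x hx
    have hx' := e.map_target hx
    refine (e.contDiffAt_symm (f₀' := (fderiv ℝ f (e.symm x)).toContinuousLinearEquivOfDetNeZero
      (hne _ (hes hx'))) hx ?_ ?_).contDiffWithinAt
    · exact hequiv _ (hes hx')
    · exact hat _ (hes hx')
  refine ⟨e.source, fun x => (Φ (e.symm x, w (e.symm x))).2, e.target, hz₁,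
    fun z hz => (hes hz).1.1, ?_, ?_, ?_, ?_⟩
  · exact ⟨e.open_source, hw.contDiffOn.mono fun z hz => (hes hz).1.1⟩
  · refine ⟨e.open_target, ?_⟩
    exact contDiff_snd.comp_contDiffOn
      ((hsm.mono fun z hz => (hes hz).1).comp hsymm fun x hx => e.map_target hx)
  · rintro _ ⟨z, hz, rfl⟩
    exact (hes hz).1.2
  · ext q
    constructor
    · rintro ⟨_, ⟨z, hz, rfl⟩, rfl⟩
      refine ⟨e z, e.map_source hz, ?_⟩
      simp only [e.left_inv hz]
      rfl
    · rintro ⟨x, hx, rfl⟩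
      refine ⟨_, ⟨e.symm x, e.map_target hx, rfl⟩, ?_⟩
      refine Prod.ext ?_ rfl
      exact e.right_inv hx

/-- A point symmetry maps first derivatives satisfying the equations to such first derivatives. -/
theorem IsLocalPointSymmetry.exists_jetEqs {Φ : OpenPartialHomeomorph Total Total}
    (hΦ : IsLocalPointSymmetry Φ) {p : Total} (hp : p ∈ Φ.source)
    {W : Matrix (Fin 4) (Fin 3) ℝ} (hW : JetEqs p.2 W)
    (hdet : (baseMatrix (fderiv ℝ Φ p) W).det ≠ 0) :
    ∃ W' : Matrix (Fin 4) (Fin 3) ℝ, JetEqs (Φ p).2 W' ∧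
      ∀ i j, ∑ k, W' i k * (fderiv ℝ Φ p (tangent W j)).1 k =
        (fderiv ℝ Φ p (tangent W j)).2 i := by
  obtain ⟨w, Ω, hz, hw, hwz, hj⟩ := exists_isSolution_jet p.1 p.2 W hW
  have hpe : p = (p.1, w p.1) := by rw [hwz]
  have hs : (p.1, w p.1) ∈ Φ.source := hpe ▸ hp
  obtain ⟨Ω₁, w', Ω', hz₁, hsub, hmap⟩ := exists_mapsGraph hΦ.smooth hw.1 hz hs
    (by rw [hj, ← hpe]; exact hdet)
  have hsol : IsSolution w Ω₁ := isSolution_iff.2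
    ⟨hmap.left, fun z hz => (isSolution_iff.1 hw).2 z (hsub hz)⟩
  have hsol' := (isSolution_iff.1 ((hΦ.solution_iff _ _ _ _ hmap).1 hsol)).2
  obtain ⟨m1, m2⟩ := hmap.apply hz₁
  have h1 := hsol' _ m1
  rw [m2] at h1
  have h2 := hmap.jet_eq hΦ.smooth hz₁
  rw [hj, ← hpe] at h2
  rw [← hpe] at h1
  exact ⟨_, h1, h2⟩

/-- Transversal first derivatives that satisfy the equations exist over a dense set. -/
theorem IsLocalPointSymmetry.exists_det_ne_zero {Φ : OpenPartialHomeomorph Total Total}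
    (hΦ : IsLocalPointSymmetry Φ) {O : Set Total} (hO : IsOpen O) (hne : O.Nonempty)
    (hsub : O ⊆ Φ.source) : ∃ p ∈ O, ∃ W : Matrix (Fin 4) (Fin 3) ℝ, JetEqs p.2 W ∧
      (baseMatrix (fderiv ℝ Φ p) W).det ≠ 0 := by
  obtain ⟨w, Ω, w', Ω', ⟨z, hz⟩, hgr, hw, hmap⟩ := hΦ.acts O hO hne hsub
  exact ⟨(z, w z), hgr ⟨z, hz, rfl⟩, jet w z, (isSolution_iff.1 hw).2 z hz,
    hmap.det_ne_zero hΦ.smooth hΦ.smooth_symm hz⟩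

/-! ### Preservation of characteristic covectors -/

/-- The linear map `L` between the tangent spaces at points with the values `y` and `y'` of the
dependent variables is injective and maps graphs of solutions, as long as they are transversal,
to graphs of solutions. -/
structure PreservesJets (L : Total →L[ℝ] Total) (y y' : Dep) : Prop where
  injective : Function.Injective L
  exists_jetEqs : ∀ W : Matrix (Fin 4) (Fin 3) ℝ, JetEqs y W → (baseMatrix L W).det ≠ 0 →
    ∃ W' : Matrix (Fin 4) (Fin 3) ℝ, JetEqs y' W' ∧
      ∀ i j, ∑ k, W' i k * (L (tangent W j)).1 k = (L (tangent W j)).2 i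

/-- The amplitude `a` is in the kernel of the principal symbol at the covector `ξ`. -/
def InSymbolKernel (y : Dep) (ξ : Fin 3 → ℝ) (a : Dep) : Prop :=
  (ξ 0 + y 0 * ξ 1 + y 1 * ξ 2) * a 0 + ξ 1 * (a 2 - a 3) = 0 ∧
  (ξ 0 + y 0 * ξ 1 + y 1 * ξ 2) * a 1 + ξ 2 * (a 2 - a 3) = 0 ∧
  (ξ 0 + y 0 * ξ 1 + y 1 * ξ 2) * a 2 + y 2 * (ξ 1 * a 0 + ξ 2 * a 1) = 0 ∧
  ξ 0 * a 3 = 0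

/-- The determinant of the principal symbol. -/
def charPoly (y : Dep) (ξ : Fin 3 → ℝ) : ℝ :=
  ξ 0 * ((ξ 0 + y 0 * ξ 1 + y 1 * ξ 2) *
    ((ξ 0 + y 0 * ξ 1 + y 1 * ξ 2) ^ 2 - y 2 * (ξ 1 ^ 2 + ξ 2 ^ 2)))

/-- If no factor vanishes, the amplitude can be eliminated entry by entry: b first, then h through
the wave factor, then the velocity. -/
theorem InSymbolKernel.charPoly_eq_zero {y : Dep} {ξ : Fin 3 → ℝ} {a : Dep}
    (h : InSymbolKernel y ξ a) (ha : a ≠ 0) : charPoly y ξ = 0 := by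
  obtain ⟨h0, h1, h2, h3⟩ := h
  by_contra hne
  unfold charPoly at hne
  set τ := ξ 0 + y 0 * ξ 1 + y 1 * ξ 2
  have e0 : ξ 0 ≠ 0 := left_ne_zero_of_mul hne
  have e1 := right_ne_zero_of_mul hne
  have e2 : τ ≠ 0 := left_ne_zero_of_mul e1
  have e3 := right_ne_zero_of_mul e1
  have a3 : a 3 = 0 := (mul_eq_zero.1 h3).resolve_left e0
  rw [a3] at h0 h1
  have a2 : a 2 = 0 := by
    have : (τ ^ 2 - y 2 * (ξ 1 ^ 2 + ξ 2 ^ 2)) * a 2 = 0 := by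
      linear_combination τ * h2 - y 2 * ξ 1 * h0 - y 2 * ξ 2 * h1
    exact (mul_eq_zero.1 this).resolve_left e3
  rw [a2] at h0 h1
  have a0 : a 0 = 0 := (mul_eq_zero.1 (by linear_combination h0 : τ * a 0 = 0)).resolve_left e2
  have a1 : a 1 = 0 := (mul_eq_zero.1 (by linear_combination h1 : τ * a 1 = 0)).resolve_left e2
  apply ha
  ext i
  fin_cases i <;> assumption

/-- Only the two linear factors are needed, because only they contribute planes of characteristic
covectors. -/
theorem exists_inSymbolKernel {y : Dep} {ξ : Fin 3 → ℝ} (hξ : ξ ≠ 0)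
    (h : ξ 0 = 0 ∨ ξ 0 + y 0 * ξ 1 + y 1 * ξ 2 = 0) : ∃ a ≠ 0, InSymbolKernel y ξ a := by
  by_cases hτ : ξ 0 + y 0 * ξ 1 + y 1 * ξ 2 = 0
  -- The vortical mode: velocity orthogonal to the wave vector, height and bottom unperturbed.
  · refine ⟨![-ξ 2, ξ 1, 0, 0], ?_, ?_⟩
    · intro h0
      have e2 := congrFun h0 0
      have e1 := congrFun h0 1
      simp at e1 e2
      apply hξ
      ext i
      fin_cases i
      · simpa [e1, e2] using hτ
      · exact e1
      · exact e2
    · simp only [InSymbolKernel, hτ, Matrix.cons_val]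
      refine ⟨?_, ?_, ?_, ?_⟩ <;> ring
  · have h0 := h.resolve_right hτ
    set τ := ξ 0 + y 0 * ξ 1 + y 1 * ξ 2 with hτ'
    -- The stationary mode: a perturbation of b balances the pressure and advection terms, which is
    -- possible because ξ₀ = 0 leaves the b entry free.
    refine ⟨![ξ 1 * τ, ξ 2 * τ, -(y 2 * (ξ 1 ^ 2 + ξ 2 ^ 2)),
      -(y 2 * (ξ 1 ^ 2 + ξ 2 ^ 2)) + τ ^ 2], ?_, ?_⟩
    · intro hz
      have e1 := congrFun hz 0
      have e2 := congrFun hz 1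
      simp [hτ] at e1 e2
      apply hτ
      rw [hτ', h0, e1, e2]
      ring
    · have hτ₀ : y 0 * ξ 1 + y 1 * ξ 2 = τ := by rw [hτ', h0]; ring
      simp only [InSymbolKernel, Matrix.cons_val, h0]
      refine ⟨?_, ?_, ?_, ?_⟩
      · linear_combination (ξ 1 * τ) * hτ₀
      · linear_combination (ξ 2 * τ) * hτ₀
      · linear_combination -(y 2 * (ξ 1 ^ 2 + ξ 2 ^ 2)) * hτ₀
      · ring

theorem tangent_add_vecMulVec (W : Matrix (Fin 4) (Fin 3) ℝ) (r : ℝ) (a : Dep) (η : Fin 3 → ℝ)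
    (j : Fin 3) : tangent (W + r • Matrix.vecMulVec a η) j =
      tangent W j + (r * η j) • ((0, a) : Total) := by
  refine Prod.ext ?_ ?_
  · simp [tangent]
  · ext i
    simp [tangent, Matrix.vecMulVec_apply]
    ring

theorem JetEqs.add_vecMulVec {y : Dep} {W : Matrix (Fin 4) (Fin 3) ℝ} (hW : JetEqs y W) (r : ℝ)
    {a : Dep} {η : Fin 3 → ℝ} (h : InSymbolKernel y η a) :
    JetEqs y (W + r • Matrix.vecMulVec a η) := by
  obtain ⟨h0, h1, h2, h3⟩ := h
  obtain ⟨g0, g1, g2, g3⟩ := hW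
  simp only [JetEqs, Matrix.add_apply, Matrix.smul_apply, Matrix.vecMulVec_apply, smul_eq_mul]
  refine ⟨?_, ?_, ?_, ?_⟩
  · linear_combination g0 + r * h0
  · linear_combination g1 + r * h1
  · linear_combination g2 + r * h2
  · linear_combination g3 + r * h3

/-- At a fixed point the equations are affine in the derivatives, so a difference of two allowed
matrices satisfies the homogeneous equations; on a rank one matrix these are the symbol equations.
-/
theorem JetEqs.inSymbolKernel {y : Dep} {W W₁ : Matrix (Fin 4) (Fin 3) ℝ} (hW : JetEqs y W)
    (hW₁ : JetEqs y W₁) {r : ℝ} (hr : r ≠ 0) {a : Dep} {ξ : Fin 3 → ℝ}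
    (h : ∀ i j, W₁ i j - W i j = r * (a i * ξ j)) : InSymbolKernel y ξ a := by
  obtain ⟨f0, f1, f2, f3⟩ := hW₁
  obtain ⟨g0, g1, g2, g3⟩ := hW
  refine ⟨?_, ?_, ?_, ?_⟩ <;> apply mul_left_cancel₀ hr
  · linear_combination f0 - g0 - h 0 0 - y 0 * h 0 1 - y 1 * h 0 2 - h 2 1 + h 3 1
  · linear_combination f1 - g1 - h 1 0 - y 0 * h 1 1 - y 1 * h 1 2 - h 2 2 + h 3 2
  · linear_combination f2 - g2 - h 2 0 - y 0 * h 2 1 - y 1 * h 2 2 - y 2 * (h 0 1 + h 1 2)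
  · linear_combination f3 - g3 - h 3 0

/-- The characteristic covectors are preserved. -/
theorem PreservesJets.exists_inSymbolKernel {L : Total →L[ℝ] Total} {y y' : Dep}
    (hL : PreservesJets L y y') {W : Matrix (Fin 4) (Fin 3) ℝ} (hW : JetEqs y W)
    (hdet : (baseMatrix L W).det ≠ 0) {ξ : Fin 3 → ℝ} {a : Dep} (ha : a ≠ 0)
    (h : InSymbolKernel y (ξ ᵥ* (baseMatrix L W)) a) :
    ∃ a' ≠ 0, InSymbolKernel y' ξ a' := by
  set N := baseMatrix L W with hN
  set η := ξ ᵥ* N with hη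
  set q := (L ((0, a) : Total)).1 with hq
  -- The base matrix of the perturbed derivatives has determinant (1 + r ξ·q) det N, so
  -- transversality survives for r = 1 or r = 2.
  obtain ⟨r, hr0, hr⟩ : ∃ r : ℝ, r ≠ 0 ∧ 1 + r * (ξ ⬝ᵥ q) ≠ 0 := by
    by_cases hc : 1 + 1 * (ξ ⬝ᵥ q) = 0
    · exact ⟨2, two_ne_zero, fun h2 => by linarith⟩
    · exact ⟨1, one_ne_zero, hc⟩
  set W₁ := W + r • Matrix.vecMulVec a η with hW₁
  have hj₁ : JetEqs y W₁ := hW.add_vecMulVec r h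
  have ht : ∀ j, L (tangent W₁ j) = L (tangent W j) + (r * η j) • L ((0, a) : Total) := by
    intro j
    rw [hW₁, tangent_add_vecMulVec, map_add, map_smul]
  have hN₁ : baseMatrix L W₁ = (1 + Matrix.vecMulVec (r • q) ξ) * N := by
    rw [add_mul, one_mul, Matrix.vecMulVec_mul]
    ext i j
    simp only [baseMatrix, ht, Matrix.add_apply, Matrix.vecMulVec_apply, hN]
    simp [hq]
    ring
  have hdet₁ : (baseMatrix L W₁).det ≠ 0 := by
    rw [hN₁, Matrix.det_mul]
    refine mul_ne_zero ?_ hdet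
    convert hr using 1
    simp [Matrix.det_fin_three, Matrix.vecMulVec_apply, dotProduct,
      Fin.sum_univ_three]
    ring
  obtain ⟨V, hV, hVN⟩ := hL.exists_jetEqs W hW hdet
  obtain ⟨V₁, hV₁, hVN₁⟩ := hL.exists_jetEqs W₁ hj₁ hdet₁
  set S := (L ((0, a) : Total)).2 with hS
  -- Subtracting the chain rules for W and W₁ gives (V₁ − V)N = r(S − V₁q) ⊗ η, and η = ξN.
  -- Cancelling N shows that the images also differ by a rank one matrix, now with covector ξ.
  have hz : (V₁ - V - Matrix.vecMulVec (r • (S - V₁ *ᵥ q)) ξ) * N = 0 := by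
    ext i j
    have e0 := hVN i j
    have e1 := hVN₁ i j
    simp only [ht] at e1
    have hηj : η j = ξ 0 * (L (tangent W j)).1 0 + ξ 1 * (L (tangent W j)).1 1 +
        ξ 2 * (L (tangent W j)).1 2 := by
      simp [hη, Matrix.vecMul, dotProduct, Fin.sum_univ_three, hN, baseMatrix]
    simp only [Matrix.sub_apply, Matrix.vecMulVec_apply, Matrix.mul_apply, Matrix.zero_apply, hN,
      baseMatrix]
    simp only [Prod.fst_add, Prod.snd_add, Prod.smul_fst, Prod.smul_snd, Pi.add_apply,
      Pi.smul_apply, smul_eq_mul, ← hq, ← hS, mul_add, Finset.sum_add_distrib] at e1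
    have e2 : ∑ k, V₁ i k * (r * η j * q k) = r * η j * (V₁ *ᵥ q) i := by
      simp only [Matrix.mulVec, dotProduct, Finset.mul_sum]
      exact Finset.sum_congr rfl fun k _ => by ring
    rw [e2] at e1
    simp only [Fin.sum_univ_three, Pi.smul_apply, Pi.sub_apply, smul_eq_mul] at e0 e1 ⊢
    linear_combination e1 - e0 + r * (S i - (V₁ *ᵥ q) i) * hηj
  have hz' : V₁ - V - Matrix.vecMulVec (r • (S - V₁ *ᵥ q)) ξ = 0 := by
    have hu : IsUnit N.det := isUnit_iff_ne_zero.2 hdet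
    calc _ = (V₁ - V - Matrix.vecMulVec (r • (S - V₁ *ᵥ q)) ξ) * N * N⁻¹ := by
          rw [Matrix.mul_nonsing_inv_cancel_right _ _ hu]
      _ = 0 := by rw [hz, Matrix.zero_mul]
  refine ⟨S - V₁ *ᵥ q, ?_, hV.inSymbolKernel hV₁ hr0 ?_⟩
  -- If S = V₁q, then L(0, a) is tangent to the image of the perturbed graph. By injectivity the
  -- vertical vector (0, a) is tangent to the perturbed graph itself, which forces a = 0.
  · intro h0
    set s := (baseMatrix L W₁)⁻¹ *ᵥ q with hs
    have hsq : (baseMatrix L W₁) *ᵥ s = q := by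
      rw [hs, Matrix.mulVec_mulVec, Matrix.mul_nonsing_inv _ (isUnit_iff_ne_zero.2 hdet₁),
        Matrix.one_mulVec]
    have e1 : L (∑ j, s j • tangent W₁ j) = L ((0, a) : Total) := by
      rw [map_sum]
      refine Prod.ext ?_ ?_
      · rw [← hq, ← hsq]
        ext i
        simp [Prod.fst_sum, Matrix.mulVec, dotProduct, baseMatrix, mul_comm]
      · rw [← hS, sub_eq_zero.1 h0, ← hsq]
        ext i
        simp only [Prod.snd_sum, map_smul, Prod.smul_snd, Finset.sum_apply, Pi.smul_apply,
          smul_eq_mul, ← hVN₁, Matrix.mulVec_mulVec]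
        simp only [Matrix.mulVec, dotProduct, Matrix.mul_apply, baseMatrix, mul_comm]
    have e2 := hL.injective e1
    have es : s = 0 := by
      have := congrArg Prod.fst e2
      ext j
      have := congrFun this j
      simpa [Prod.fst_sum, tangent, Pi.single_apply] using this
    apply ha
    have := congrArg Prod.snd e2
    rw [es] at this
    simpa using this.symm
  · intro i j
    have := congrFun (congrFun hz' i) j
    simp only [Matrix.sub_apply, Matrix.vecMulVec_apply, Pi.smul_apply, smul_eq_mul,
      Matrix.zero_apply] at this
    linear_combination this

/-- The only planes consisting of characteristic covectors are those given by the factors of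
degree one. -/
theorem direction_of_charPoly_eq_zero {y : Dep} (hy : y 2 ≠ 0) {n : Fin 3 → ℝ} 
    (h : ∀ ξ : Fin 3 → ℝ, ξ ⬝ᵥ n = 0 → charPoly y ξ = 0) :
    (n 1 = 0 ∧ n 2 = 0) ∨ (n 1 = y 0 * n 0 ∧ n 2 = y 1 * n 0) := by
  by_contra hne
  rw [not_or] at hne
  obtain ⟨hne1, hne2⟩ := hne
  set D : Fin 3 → ℝ := ![1, y 0, y 1] with hD
  -- The plane orthogonal to n is swept out by the cross products n × m. On it `f` is the factor ξ₀
  -- and `g` is the factor τ, that is, the scalar product of `D` with n × m.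
  set f : (Fin 3 → ℝ) → ℝ := fun m => n 1 * m 2 - n 2 * m 1 with hf
  set g : (Fin 3 → ℝ) → ℝ := fun m => (n 1 * m 2 - n 2 * m 1) + y 0 * (n 2 * m 0 - n 0 * m 2) +
    y 1 * (n 0 * m 1 - n 1 * m 0) with hg
  have hprod : ∀ m : Fin 3 → ℝ, f m * (g m * (g m ^ 2 - y 2 *
      ((n 2 * m 0 - n 0 * m 2) ^ 2 + (n 0 * m 1 - n 1 * m 0) ^ 2))) = 0 := by
    intro m
    have := h ![n 1 * m 2 - n 2 * m 1, n 2 * m 0 - n 0 * m 2, n 0 * m 1 - n 1 * m 0] (by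
      simp [dotProduct, Fin.sum_univ_three]; ring)
    simpa [charPoly] using this
  obtain ⟨v, hv1, hv2⟩ : ∃ v, f v ≠ 0 ∧ g v ≠ 0 := by
    obtain ⟨a, ha⟩ : ∃ a, f a ≠ 0 := by
      by_contra! hc
      have c1 := hc ![0, 0, 1]
      have c2 := hc ![0, 1, 0]
      simp [hf] at c1 c2
      exact hne1 ⟨c1, c2⟩
    obtain ⟨b, hb⟩ : ∃ b, g b ≠ 0 := by
      by_contra! hc
      have c1 := hc ![0, 0, 1]
      have c2 := hc ![0, 1, 0]
      simp [hg] at c1 c2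
      exact hne2 ⟨by linarith, by linarith⟩
    by_cases h1 : g a = 0
    · by_cases h2 : f b = 0
      · refine ⟨a + b, ?_, ?_⟩
        · have : f (a + b) = f a + f b := by simp [hf]; ring
          rwa [this, h2, add_zero]
        · have : g (a + b) = g a + g b := by simp [hg]; ring
          rwa [this, h1, zero_add]
      · exact ⟨b, h2, hb⟩
    · exact ⟨a, ha, h1⟩
  -- Along the line m = D + s v one has g = s g(v), since D·(n × D) = 0. There the wave factor is A
  -- + sB + s²C, and A ≠ 0 because n is not parallel to `D`.
  set A := -y 2 * ((n 2 - n 0 * y 1) ^ 2 + (n 0 * y 0 - n 1) ^ 2) with hA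
  have hA0 : A ≠ 0 := by
    refine mul_ne_zero (neg_ne_zero.2 hy) ?_
    intro h0
    have e1 : n 2 - n 0 * y 1 = 0 := by nlinarith
    have e2 : n 0 * y 0 - n 1 = 0 := by nlinarith
    exact hne2 ⟨by linarith, by linarith⟩
  set B := -y 2 * (2 * (n 2 - n 0 * y 1) * (n 2 * v 0 - n 0 * v 2) +
    2 * (n 0 * y 0 - n 1) * (n 0 * v 1 - n 1 * v 0)) with hB
  set C := g v ^ 2 - y 2 * ((n 2 * v 0 - n 0 * v 2) ^ 2 + (n 0 * v 1 - n 1 * v 0) ^ 2) with hC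
  have hpoly : ∀ s : ℝ, s ≠ 0 → (f D + s * f v) * (A + s * B + s ^ 2 * C) = 0 := by
    intro s hs
    have := hprod (D + s • v)
    have e1 : f (D + s • v) = f D + s * f v := by simp [hf]; ring
    have e2 : g (D + s • v) = s * g v := by
      simp only [hg, Pi.add_apply, Pi.smul_apply, smul_eq_mul]
      simp [hD]
      ring
    rw [e1, e2] at this
    have h3 : s * g v * ((f D + s * f v) * (A + s * B + s ^ 2 * C)) = 0 := by
      rw [← this, hA, hB, hC]
      simp only [Pi.add_apply, Pi.smul_apply, smul_eq_mul]
      simp [hD]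
      ring
    exact (mul_eq_zero.1 h3).resolve_left (mul_ne_zero hs hv2)
  -- A cubic in s is determined by four values. Its constant and linear coefficients then give f(D)A
  -- = 0 and f(v)A = 0, contradicting f(v) ≠ 0.
  have p1 := hpoly 1 (by norm_num)
  have p2 := hpoly (-1) (by norm_num)
  have p3 := hpoly 2 (by norm_num)
  have p4 := hpoly (-2) (by norm_num)
  have r0 : f D * A = 0 := by linear_combination (4 * (p1 + p2) - (p3 + p4)) / 6
  have r1 : f v * A + f D * B = 0 := by linear_combination (8 * (p1 - p2) - (p3 - p4)) / 12
  have r2 := (mul_eq_zero.1 r0).resolve_right hA0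
  rw [r2, zero_mul, add_zero] at r1
  exact (mul_ne_zero hv1 hA0) r1

/-- Covectors annihilating d are characteristic, and if ξ annihilates Nd then ξN annihilates d. So
the whole plane annihilating Nd consists of characteristic covectors, and Nd is one of the two
distinguished directions. -/
theorem PreservesJets.direction {L : Total →L[ℝ] Total} {y y' : Dep}
    (hL : PreservesJets L y y') (hy' : y' 2 ≠ 0)
    {W : Matrix (Fin 4) (Fin 3) ℝ} (hW : JetEqs y W)
    (hdet : (baseMatrix L W).det ≠ 0) {d : Fin 3 → ℝ}
    (hd : d = ![1, 0, 0] ∨ d = ![1, y 0, y 1]) :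
    let n := baseMatrix L W *ᵥ d
    (n 1 = 0 ∧ n 2 = 0) ∨ (n 1 = y' 0 * n 0 ∧ n 2 = y' 1 * n 0) := by
  intro n
  refine direction_of_charPoly_eq_zero hy' fun ξ hξ => ?_
  by_cases h0 : ξ ᵥ* (baseMatrix L W) = 0
  · have : ξ = 0 := Matrix.eq_zero_of_vecMul_eq_zero hdet h0
    simp [this, charPoly]
  · have h1 : (ξ ᵥ* (baseMatrix L W)) ⬝ᵥ d = 0 := by
      rw [← Matrix.dotProduct_mulVec]; exact hξ
    obtain ⟨a, ha, hk⟩ := ShallowWater.exists_inSymbolKernel h0 (by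
      rcases hd with rfl | rfl
      · left
        simpa [dotProduct, Fin.sum_univ_three] using h1
      · right
        simp only [dotProduct, Fin.sum_univ_three, Matrix.cons_val] at h1
        linarith)
    obtain ⟨a', ha', hk'⟩ := hL.exists_inSymbolKernel hW hdet ha hk
    exact hk'.charPoly_eq_zero ha'

/-! ### Keeping or interchanging the time and transport directions -/

/-- Used to turn an alternative holding for each choice of derivatives separately into one valid for
all of them at once. -/
theorem eq_zero_or_eq_zero_of_analyticOnNhd_mul {E : Type*} [NormedAddCommGroup E]
    [NormedSpace ℝ E] {f g : E → ℝ} (hf : ContDiff ℝ ω f) (hg : Continuous g)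
    (h : ∀ x, f x * g x = 0) : (∀ x, f x = 0) ∨ ∀ x, g x = 0 := by
  by_contra! hc
  obtain ⟨⟨a, ha⟩, b, hb⟩ := hc
  apply ha
  have h1 : f =ᶠ[nhds b] 0 := by
    filter_upwards [hg.continuousAt.eventually_ne hb] with x hx
    exact (mul_eq_zero.1 (h x)).resolve_right hx
  exact (contDiff_omega_iff_analyticOnNhd.1 hf).eqOn_zero_of_preconnected_of_eventuallyEq_zero
    isPreconnected_univ (Set.mem_univ b) h1 (Set.mem_univ a)

/-- The coordinate vectors of the independent variables. -/
def indepVec (j : Fin 3) : Total := (Pi.single j 1, 0)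

/-- The coordinate vectors of the dependent variables. -/
def depVec (k : Fin 4) : Total := (0, Pi.single k 1)

theorem tangent_eq_sum (W : Matrix (Fin 4) (Fin 3) ℝ) (j : Fin 3) :
    tangent W j = indepVec j + ∑ k, W k j • depVec k := by
  refine Prod.ext ?_ ?_
  · simp [tangent, indepVec, depVec, Prod.fst_sum]
  · ext i
    simp [tangent, indepVec, depVec, Prod.snd_sum, Pi.single_apply]

theorem map_tangent (L : Total →L[ℝ] Total) (W : Matrix (Fin 4) (Fin 3) ℝ) (j : Fin 3) :
    L (tangent W j) = L (indepVec j) + (W 0 j • L (depVec 0) + W 1 j • L (depVec 1) +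
      W 2 j • L (depVec 2) + W 3 j • L (depVec 3)) := by
  rw [tangent_eq_sum, map_add, map_sum, Fin.sum_univ_four]
  simp only [map_smul]

theorem baseMatrix_apply (L : Total →L[ℝ] Total) (W : Matrix (Fin 4) (Fin 3) ℝ) (i j : Fin 3) :
    baseMatrix L W i j = (L (indepVec j)).1 i + (W 0 j * (L (depVec 0)).1 i +
      W 1 j * (L (depVec 1)).1 i + W 2 j * (L (depVec 2)).1 i + W 3 j * (L (depVec 3)).1 i) := by
  simp [baseMatrix, map_tangent]

/-- The matrices of first derivatives satisfying the equations, in terms of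
`u_x, u_y, v_x, v_y, h_x, h_y, b_x, b_y`. -/
def jetParam (y : Dep) (θ : Fin 8 → ℝ) : Matrix (Fin 4) (Fin 3) ℝ :=
  Matrix.of ![![θ 6 - θ 4 - y 0 * θ 0 - y 1 * θ 1, θ 0, θ 1],
    ![θ 7 - θ 5 - y 0 * θ 2 - y 1 * θ 3, θ 2, θ 3],
    ![-(y 0 * θ 4 + y 1 * θ 5 + y 2 * (θ 0 + θ 3)), θ 4, θ 5],
    ![0, θ 6, θ 7]]

theorem jetEqs_jetParam (y : Dep) (θ : Fin 8 → ℝ) : JetEqs y (jetParam y θ) := by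
  simp [JetEqs, jetParam]
  refine ⟨?_, ?_, ?_⟩ <;> ring

theorem JetEqs.exists_eq_jetParam {y : Dep} {W : Matrix (Fin 4) (Fin 3) ℝ} (h : JetEqs y W) :
    ∃ θ, W = jetParam y θ := by
  obtain ⟨h0, h1, h2, h3⟩ := h
  refine ⟨![W 0 1, W 0 2, W 1 1, W 1 2, W 2 1, W 2 2, W 3 1, W 3 2], ?_⟩
  ext i j
  fin_cases i <;> fin_cases j <;> simp [jetParam] <;> linarith

theorem contDiff_jetParam (y : Dep) (i : Fin 4) (j : Fin 3) :
    ContDiff ℝ ω (fun θ => jetParam y θ i j) := by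
  fin_cases i <;> fin_cases j <;> simp [jetParam] <;> fun_prop

theorem contDiff_baseMatrix (L : Total →L[ℝ] Total) (y : Dep) (i j : Fin 3) :
    ContDiff ℝ ω (fun θ => baseMatrix L (jetParam y θ) i j) := by
  simp only [baseMatrix_apply]
  have := contDiff_jetParam y
  fun_prop

/-- One of the two alternatives for a direction holds for all first derivatives at once. -/
theorem PreservesJets.direction_forall {L : Total →L[ℝ] Total} {y y' : Dep}
    (hL : PreservesJets L y y') (hy' : y' 2 ≠ 0)
    (hne : ∃ θ, (baseMatrix L (jetParam y θ)).det ≠ 0) {d : Fin 3 → ℝ}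
    (hd : d = ![1, 0, 0] ∨ d = ![1, y 0, y 1]) :
    (∀ θ, (baseMatrix L (jetParam y θ) *ᵥ d) 1 = 0 ∧ (baseMatrix L (jetParam y θ) *ᵥ d) 2 = 0) ∨
    (∀ θ, (baseMatrix L (jetParam y θ) *ᵥ d) 1 = y' 0 * (baseMatrix L (jetParam y θ) *ᵥ d) 0 ∧
      (baseMatrix L (jetParam y θ) *ᵥ d) 2 = y' 1 * (baseMatrix L (jetParam y θ) *ᵥ d) 0) := by
  set n : (Fin 8 → ℝ) → Fin 3 → ℝ := fun θ => baseMatrix L (jetParam y θ) *ᵥ d with hn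
  have hM := contDiff_baseMatrix L y
  have hnc : ∀ i, ContDiff ℝ ω (fun θ => n θ i) := by
    intro i
    simp only [hn, Matrix.mulVec, dotProduct]
    fun_prop
  have hdc : ContDiff ℝ ω (fun θ => (baseMatrix L (jetParam y θ)).det) := by
    simp only [Matrix.det_fin_three]
    fun_prop
  have h0 := hnc 0
  have h1 := hnc 1
  have h2 := hnc 2
  -- Sums of squares encode the two alternatives, and the determinant covers the derivatives that
  -- are not transversal. All factors are polynomials in θ, so one of them vanishes identically.
  have hprod : ∀ θ, ((baseMatrix L (jetParam y θ)).det * (n θ 1 ^ 2 + n θ 2 ^ 2)) *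
      ((n θ 1 - y' 0 * n θ 0) ^ 2 + (n θ 2 - y' 1 * n θ 0) ^ 2) = 0 := by
    intro θ
    by_cases hdet : (baseMatrix L (jetParam y θ)).det = 0
    · rw [hdet]; ring
    · rcases hL.direction hy' (jetEqs_jetParam y θ) hdet hd with ⟨e1, e2⟩ | ⟨e1, e2⟩
      · simp only [hn]; rw [e1, e2]; ring
      · simp only [hn]; rw [e1, e2]; ring
  rcases eq_zero_or_eq_zero_of_analyticOnNhd_mul (by fun_prop) 
    (by have := h0.continuous; have := h1.continuous; have := h2.continuous; fun_prop) hprod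
    with h | h
  · rcases eq_zero_or_eq_zero_of_analyticOnNhd_mul hdc
      (by have := h0.continuous; have := h1.continuous; have := h2.continuous; fun_prop) h
      with h | h
    · exact absurd (h _) hne.choose_spec
    · left
      intro θ
      have := h θ
      constructor
      · show n θ 1 = 0
        nlinarith
      · show n θ 2 = 0
        nlinarith
  · right
    intro θ
    have := h θ
    constructor
    · have : n θ 1 - y' 0 * n θ 0 = 0 := by nlinarith
      exact sub_eq_zero.1 this
    · have : n θ 2 - y' 1 * n θ 0 = 0 := by nlinarith
      exact sub_eq_zero.1 this

/-- A linear form that vanishes on the time direction of all transversal graphs. -/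
theorem forms_of_forall_time {y : Dep} (hy : y 2 ≠ 0) {a c₀ c₁ c₂ c₃ : ℝ}
    (h : ∀ θ, a + (jetParam y θ 0 0 * c₀ + jetParam y θ 1 0 * c₁ + jetParam y θ 2 0 * c₂ +
      jetParam y θ 3 0 * c₃) = 0) : a = 0 ∧ c₀ = 0 ∧ c₁ = 0 ∧ c₂ = 0 := by
  have h0 := h 0
  have h6 := h (Pi.single 6 1)
  have h7 := h (Pi.single 7 1)
  have h1 := h (Pi.single 0 1)
  simp [jetParam] at h0 h1 h6 h7
  have e0 : c₀ = 0 := by linarith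
  have e1 : c₁ = 0 := by linarith
  refine ⟨h0, e0, e1, ?_⟩
  rw [e0, h0] at h1
  have : y 2 * c₂ = 0 := by linarith
  exact (mul_eq_zero.1 this).resolve_left hy

/-- A linear form that vanishes on the transport direction of all transversal graphs. -/
theorem forms_of_forall_transport {y : Dep} (hy : y 2 ≠ 0) (hu : y 0 ≠ 0) 
    {a c₀ c₁ c₂ c₃ : ℝ}
    (h : ∀ θ, a + ((jetParam y θ 0 0 + y 0 * jetParam y θ 0 1 + y 1 * jetParam y θ 0 2) * c₀ +
      (jetParam y θ 1 0 + y 0 * jetParam y θ 1 1 + y 1 * jetParam y θ 1 2) * c₁ +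
      (jetParam y θ 2 0 + y 0 * jetParam y θ 2 1 + y 1 * jetParam y θ 2 2) * c₂ +
      (jetParam y θ 3 0 + y 0 * jetParam y θ 3 1 + y 1 * jetParam y θ 3 2) * c₃) = 0) :
    a = 0 ∧ c₀ = 0 ∧ c₁ = 0 ∧ c₂ = 0 ∧ c₃ = 0 := by
  have h0 := h 0
  have h4 := h (Pi.single 4 1)
  have h5 := h (Pi.single 5 1)
  have h6 := h (Pi.single 6 1)
  have h1 := h (Pi.single 0 1)
  simp [jetParam] at h0 h1 h4 h5 h6
  rw [h0] at h1 h4 h5 h6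
  have e0 : c₀ = 0 := by linarith
  have e1 : c₁ = 0 := by linarith
  rw [e0] at h6
  refine ⟨h0, e0, e1, ?_, ?_⟩
  · have : y 2 * c₂ = 0 := by linarith
    exact (mul_eq_zero.1 this).resolve_left hy
  · have : y 0 * c₃ = 0 := by linarith
    exact (mul_eq_zero.1 this).resolve_left hu

/-- The independent variables are transformed with the time direction or the transport direction
being mapped to the time direction. -/
theorem PreservesJets.dichotomy {L : Total →L[ℝ] Total} {y y' : Dep}
    (hL : PreservesJets L y y') (hy : y 2 ≠ 0) (hy' : y' 2 ≠ 0) (hu : y 0 ≠ 0) 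
    (hu' : y' 0 ≠ 0) (hne : ∃ θ, (baseMatrix L (jetParam y θ)).det ≠ 0) :
    (∀ i, (L (depVec 0)).1 i = 0 ∧ (L (depVec 1)).1 i = 0 ∧ (L (depVec 2)).1 i = 0) ∧
    (((L (indepVec 0)).1 1 = 0 ∧ (L (indepVec 0)).1 2 = 0 ∧
      (L (depVec 3)).1 1 = y' 0 * (L (depVec 3)).1 0 ∧
      (L (depVec 3)).1 2 = y' 1 * (L (depVec 3)).1 0 ∧
      (L (indepVec 0 + y 0 • indepVec 1 + y 1 • indepVec 2)).1 1 = 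
        y' 0 * (L (indepVec 0 + y 0 • indepVec 1 + y 1 • indepVec 2)).1 0 ∧
      (L (indepVec 0 + y 0 • indepVec 1 + y 1 • indepVec 2)).1 2 = 
        y' 1 * (L (indepVec 0 + y 0 • indepVec 1 + y 1 • indepVec 2)).1 0) ∨
    ((L (depVec 3)).1 1 = 0 ∧ 
      (L (indepVec 0 + y 0 • indepVec 1 + y 1 • indepVec 2)).1 1 = 0)) := by
  have hT : ∀ θ i, (baseMatrix L (jetParam y θ) *ᵥ ![1, 0, 0]) i =
      baseMatrix L (jetParam y θ) i 0 := by
    intro θ i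
    simp [Matrix.mulVec, dotProduct, Fin.sum_univ_three]
  have hD : ∀ θ i, (baseMatrix L (jetParam y θ) *ᵥ ![1, y 0, y 1]) i =
      baseMatrix L (jetParam y θ) i 0 + y 0 * baseMatrix L (jetParam y θ) i 1 + 
        y 1 * baseMatrix L (jetParam y θ) i 2 := by
    intro θ i
    simp [Matrix.mulVec, dotProduct, Fin.sum_univ_three]
    ring
  have h1 := hL.direction_forall hy' hne (Or.inl rfl)
  have h2 := hL.direction_forall hy' hne (Or.inr rfl)
  simp only [hT, hD] at h1 h2
  obtain ⟨θ₀, hθ₀⟩ := hne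
  have key : ∀ i, ((L (indepVec 0 + y 0 • indepVec 1 + y 1 • indepVec 2)).1 i) =
    (L (indepVec 0)).1 i + y 0 * (L (indepVec 1)).1 i + y 1 * (L (indepVec 2)).1 i := by
    intro i
    simp
  rw [key, key, key]
  rcases h1 with h1 | h1
  · -- the time direction is preserved
    rcases h2 with h2 | h2
    -- Two independent vectors, here `![1, 0, 0]` and `![1, y 0, y 1]` with u ≠ 0, cannot have
    -- images in the same line when the base matrix is invertible.
    · exfalso
      apply hθ₀
      obtain ⟨a1, a2⟩ := h1 θ₀
      obtain ⟨b1, b2⟩ := h2 θ₀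
      rw [a1] at b1
      rw [a2] at b2
      rw [Matrix.det_fin_three, a1, a2]
      have : y 0 * (baseMatrix L (jetParam y θ₀) 1 1 * baseMatrix L (jetParam y θ₀) 2 2 -
        baseMatrix L (jetParam y θ₀) 1 2 * baseMatrix L (jetParam y θ₀) 2 1) = 0 := by
        linear_combination b1 * baseMatrix L (jetParam y θ₀) 2 2 - 
          b2 * baseMatrix L (jetParam y θ₀) 1 2
      have := (mul_eq_zero.1 this).resolve_left hu
      linear_combination baseMatrix L (jetParam y θ₀) 0 0 * this
    · simp only [baseMatrix_apply] at h1 h2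
      obtain ⟨a, a0, a1, a2⟩ := forms_of_forall_time hy fun θ => (h1 θ).1
      obtain ⟨b, b0, b1, b2⟩ := forms_of_forall_time hy fun θ => (h1 θ).2
      obtain ⟨c, c0, c1, c2, c3⟩ := forms_of_forall_transport hy hu
        (a := (L (indepVec 0)).1 1 + y 0 * (L (indepVec 1)).1 1 + y 1 * (L (indepVec 2)).1 1 -
          y' 0 * ((L (indepVec 0)).1 0 + y 0 * (L (indepVec 1)).1 0 + y 1 * (L (indepVec 2)).1 0))
        (c₀ := (L (depVec 0)).1 1 - y' 0 * (L (depVec 0)).1 0)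
        (c₁ := (L (depVec 1)).1 1 - y' 0 * (L (depVec 1)).1 0)
        (c₂ := (L (depVec 2)).1 1 - y' 0 * (L (depVec 2)).1 0)
        (c₃ := (L (depVec 3)).1 1 - y' 0 * (L (depVec 3)).1 0)
        fun θ => by linear_combination (h2 θ).1
      obtain ⟨d, d0, d1, d2, d3⟩ := forms_of_forall_transport hy hu
        (a := (L (indepVec 0)).1 2 + y 0 * (L (indepVec 1)).1 2 + y 1 * (L (indepVec 2)).1 2 -
          y' 1 * ((L (indepVec 0)).1 0 + y 0 * (L (indepVec 1)).1 0 + y 1 * (L (indepVec 2)).1 0))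
        (c₀ := (L (depVec 0)).1 2 - y' 1 * (L (depVec 0)).1 0)
        (c₁ := (L (depVec 1)).1 2 - y' 1 * (L (depVec 1)).1 0)
        (c₂ := (L (depVec 2)).1 2 - y' 1 * (L (depVec 2)).1 0)
        (c₃ := (L (depVec 3)).1 2 - y' 1 * (L (depVec 3)).1 0)
        fun θ => by linear_combination (h2 θ).2
      rw [a0, zero_sub, neg_eq_zero] at c0
      rw [a1, zero_sub, neg_eq_zero] at c1
      rw [a2, zero_sub, neg_eq_zero] at c2
      have t0 := (mul_eq_zero.1 c0).resolve_left hu'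
      have t1 := (mul_eq_zero.1 c1).resolve_left hu'
      have t2 := (mul_eq_zero.1 c2).resolve_left hu'
      refine ⟨?_, Or.inl ⟨a, b, sub_eq_zero.1 c3, sub_eq_zero.1 d3, sub_eq_zero.1 c,
        sub_eq_zero.1 d⟩⟩
      intro i
      fin_cases i
      · exact ⟨t0, t1, t2⟩
      · exact ⟨a0, a1, a2⟩
      · exact ⟨b0, b1, b2⟩
  · rcases h2 with h2 | h2
    · simp only [baseMatrix_apply] at h1 h2
      obtain ⟨c, c0, c1, c2, c3⟩ := forms_of_forall_transport hy hu
        (a := (L (indepVec 0)).1 1 + y 0 * (L (indepVec 1)).1 1 + y 1 * (L (indepVec 2)).1 1)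
        (c₀ := (L (depVec 0)).1 1) (c₁ := (L (depVec 1)).1 1)
        (c₂ := (L (depVec 2)).1 1) (c₃ := (L (depVec 3)).1 1)
        fun θ => by linear_combination (h2 θ).1
      obtain ⟨d, d0, d1, d2, d3⟩ := forms_of_forall_transport hy hu
        (a := (L (indepVec 0)).1 2 + y 0 * (L (indepVec 1)).1 2 + y 1 * (L (indepVec 2)).1 2)
        (c₀ := (L (depVec 0)).1 2) (c₁ := (L (depVec 1)).1 2)
        (c₂ := (L (depVec 2)).1 2) (c₃ := (L (depVec 3)).1 2)
        fun θ => by linear_combination (h2 θ).2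
      obtain ⟨a, a0, a1, a2⟩ := forms_of_forall_time hy 
        (a := (L (indepVec 0)).1 1 - y' 0 * (L (indepVec 0)).1 0)
        (c₀ := (L (depVec 0)).1 1 - y' 0 * (L (depVec 0)).1 0)
        (c₁ := (L (depVec 1)).1 1 - y' 0 * (L (depVec 1)).1 0)
        (c₂ := (L (depVec 2)).1 1 - y' 0 * (L (depVec 2)).1 0)
        (c₃ := (L (depVec 3)).1 1 - y' 0 * (L (depVec 3)).1 0)
        fun θ => by linear_combination (h1 θ).1
      rw [c0, zero_sub, neg_eq_zero] at a0
      rw [c1, zero_sub, neg_eq_zero] at a1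
      rw [c2, zero_sub, neg_eq_zero] at a2
      have t0 := (mul_eq_zero.1 a0).resolve_left hu'
      have t1 := (mul_eq_zero.1 a1).resolve_left hu'
      have t2 := (mul_eq_zero.1 a2).resolve_left hu'
      refine ⟨?_, Or.inr ⟨c3, c⟩⟩
      intro i
      fin_cases i
      · exact ⟨t0, t1, t2⟩
      · exact ⟨c0, c1, c2⟩
      · exact ⟨d0, d1, d2⟩
    · exfalso
      apply hθ₀
      obtain ⟨a1, a2⟩ := h1 θ₀
      obtain ⟨b1, b2⟩ := h2 θ₀
      rw [Matrix.det_fin_three]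
      set N := baseMatrix L (jetParam y θ₀)
      have e1 : y 0 * N 1 1 + y 1 * N 1 2 = y' 0 * (y 0 * N 0 1 + y 1 * N 0 2) := by
        linear_combination b1 - a1
      have e2 : y 0 * N 2 1 + y 1 * N 2 2 = y' 1 * (y 0 * N 0 1 + y 1 * N 0 2) := by
        linear_combination b2 - a2
      rw [a1, a2]
      apply mul_left_cancel₀ hu
      linear_combination (N 0 0 * N 2 2 - N 0 2 * y' 1 * N 0 0) * e1 + 
        (y' 0 * N 0 0 * N 0 2 - N 0 0 * N 1 2) * e2

/-! ### Directional derivatives on the total space -/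

/-- The directional derivative. -/
noncomputable def dd (e : Total) (f : Total → ℝ) (p : Total) : ℝ := fderiv ℝ f p e

theorem contDiffOn_dd {U : Set Total} (hU : IsOpen U) {f : Total → ℝ} (hf : ContDiffOn ℝ ∞ f U)
    (e : Total) : ContDiffOn ℝ ∞ (dd e f) U :=
  (hf.fderiv_of_isOpen hU (by simp)).clm_apply contDiffOn_const

theorem hasFDerivAt_of_contDiffOn {U : Set Total} (hU : IsOpen U) {f : Total → ℝ}
    (hf : ContDiffOn ℝ ∞ f U) {p : Total} (hp : p ∈ U) : HasFDerivAt f (fderiv ℝ f p) p :=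
  ((hf.contDiffAt (hU.mem_nhds hp)).differentiableAt (by simp)).hasFDerivAt

theorem dd_comm {U : Set Total} (hU : IsOpen U) {f : Total → ℝ} (hf : ContDiffOn ℝ ∞ f U)
    {p : Total} (hp : p ∈ U) (e e' : Total) : dd e (dd e' f) p = dd e' (dd e f) p := by
  have hs : IsSymmSndFDerivAt ℝ f p :=
    (hf.contDiffAt (hU.mem_nhds hp)).isSymmSndFDerivAt (by simpa using ENat.LEInfty.out)
  have hd : DifferentiableAt ℝ (fderiv ℝ f) p :=
    ((hf.fderiv_of_isOpen hU (m := ∞) (by simp)).contDiffAt (hU.mem_nhds hp)).differentiableAt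
      (by simp)
  have h : ∀ a b : Total, dd a (dd b f) p = fderiv ℝ (fderiv ℝ f) p a b := by
    intro a b
    unfold dd
    rw [fderiv_clm_apply hd (differentiableAt_const b)]
    simp
  rw [h, h]
  exact hs e e'

theorem fderiv_apply_eq_zero {U : Set Total} (hU : IsOpen U) {f : Total → ℝ}
    {f' : Total →L[ℝ] ℝ} {p : Total} (hf : HasFDerivAt f f' p) (hp : p ∈ U)
    (h : ∀ q ∈ U, f q = 0) (e : Total) : f' e = 0 := by
  have h1 : f =ᶠ[nhds p] fun _ => 0 := by
    filter_upwards [hU.mem_nhds hp] with q hq using h q hq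
  rw [(h1.hasFDerivAt_iff.1 hf).unique (hasFDerivAt_const 0 p)]
  rfl

theorem dd_eq_zero {U : Set Total} (hU : IsOpen U) {f : Total → ℝ} {p : Total} (hp : p ∈ U)
    (h : ∀ q ∈ U, f q = 0) (e : Total) : dd e f p = 0 := by
  have h1 : f =ᶠ[nhds p] fun _ => 0 := by
    filter_upwards [hU.mem_nhds hp] with q hq using h q hq
  unfold dd
  rw [h1.fderiv_eq]
  simp

/-- The derivative of a function that does not depend on the direction `e` has this property. -/
theorem dd_dd_eq_zero {U : Set Total} (hU : IsOpen U) {f : Total → ℝ} (hf : ContDiffOn ℝ ∞ f U)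
    {e : Total} (h : ∀ q ∈ U, dd e f q = 0) (e' : Total) : ∀ q ∈ U, dd e (dd e' f) q = 0 :=
  fun q hq => by rw [dd_comm hU hf hq]; exact dd_eq_zero hU hq h e'

/-- The fibre coordinates. -/
theorem hasFDerivAt_fibre (k : Fin 4) (p : Total) : HasFDerivAt (fun q : Total => q.2 k)
    ((ContinuousLinearMap.proj (R := ℝ) (φ := fun _ : Fin 4 => ℝ) k).comp
      (ContinuousLinearMap.snd ℝ Indep Dep)) p :=
  ((ContinuousLinearMap.proj (R := ℝ) (φ := fun _ : Fin 4 => ℝ) k).comp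
      (ContinuousLinearMap.snd ℝ Indep Dep)).hasFDerivAt

@[simp]
theorem indepVec_fst (j i : Fin 3) : (indepVec j).1 i = if i = j then 1 else 0 := by
  simp [indepVec, Pi.single_apply]

@[simp]
theorem indepVec_snd (j : Fin 3) : (indepVec j).2 = 0 := rfl

@[simp]
theorem depVec_fst (k : Fin 4) : (depVec k).1 = 0 := rfl

@[simp]
theorem depVec_snd (k i : Fin 4) : (depVec k).2 i = if i = k then 1 else 0 := by
  simp [depVec, Pi.single_apply]

theorem clm_eq_zero {ℓ : Total →L[ℝ] ℝ} (h1 : ∀ j, ℓ (indepVec j) = 0)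
    (h2 : ∀ k, ℓ (depVec k) = 0) : ℓ = 0 := by
  ext v
  · have : (v, (0 : Dep)) = ∑ j, v j • indepVec j := by
      refine Prod.ext ?_ ?_
      · ext i; simp [Prod.fst_sum, indepVec, Pi.single_apply]
      · simp [Prod.snd_sum, indepVec]
    simp [this, map_sum, h1]
  · have : ((0 : Indep), v) = ∑ j, v j • depVec j := by
      refine Prod.ext ?_ ?_
      · simp [Prod.fst_sum, depVec]
      · ext i; simp [Prod.snd_sum, depVec, Pi.single_apply]
    simp [this, map_sum, h2]

/-- A closed condition that holds on a dense subset. -/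
theorem eq_zero_of_dense {U : Set Total} {S : Set Total}
    (hS : ∀ O : Set Total, IsOpen O → O.Nonempty → O ⊆ U → (O ∩ S).Nonempty)
    (hU : IsOpen U) {f : Total → ℝ} (hf : ContinuousOn f U) (h : ∀ p ∈ U, p ∈ S → f p = 0) :
    ∀ p ∈ U, f p = 0 := by
  intro p hp
  by_contra hne
  obtain ⟨q, ⟨hq, hq'⟩, hqS⟩ := hS (U ∩ f ⁻¹' {0}ᶜ) (hf.isOpen_inter_preimage hU
    isOpen_compl_singleton) ⟨p, hp, hne⟩ Set.inter_subset_left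
  exact hq' (h q hq hqS)

/-! ### The new independent variables -/

section Symmetry

variable {Φ : OpenPartialHomeomorph Total Total}

/-- The transformed independent variables. -/
def indepPart (Φ : OpenPartialHomeomorph Total Total) (i : Fin 3) (p : Total) : ℝ := (Φ p).1 i

/-- The transformed dependent variables. -/
def depPart (Φ : OpenPartialHomeomorph Total Total) (k : Fin 4) (p : Total) : ℝ := (Φ p).2 k

theorem contDiffOn_indepPart (hΦ : IsLocalPointSymmetry Φ) (i : Fin 3) :
    ContDiffOn ℝ ∞ (indepPart Φ i) Φ.source :=
  contDiffOn_pi.1 (contDiff_fst.comp_contDiffOn hΦ.smooth) i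

theorem contDiffOn_depPart (hΦ : IsLocalPointSymmetry Φ) (k : Fin 4) :
    ContDiffOn ℝ ∞ (depPart Φ k) Φ.source :=
  contDiffOn_pi.1 (contDiff_snd.comp_contDiffOn hΦ.smooth) k

theorem differentiableAt_symmetry (hΦ : IsLocalPointSymmetry Φ) {p : Total} (hp : p ∈ Φ.source) :
    DifferentiableAt ℝ Φ p :=
  (hΦ.smooth.contDiffAt (Φ.open_source.mem_nhds hp)).differentiableAt (by simp)

theorem dd_indepPart (hΦ : IsLocalPointSymmetry Φ) {p : Total} (hp : p ∈ Φ.source) (i : Fin 3)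
    (e : Total) : dd e (indepPart Φ i) p = (fderiv ℝ Φ p e).1 i := by
  have h := hasFDerivAt_pi'.1 (differentiableAt_symmetry hΦ hp).hasFDerivAt.fst i
  have h' : HasFDerivAt (indepPart Φ i) _ p := h
  unfold dd
  rw [h'.fderiv]
  rfl

theorem dd_depPart (hΦ : IsLocalPointSymmetry Φ) {p : Total} (hp : p ∈ Φ.source) (k : Fin 4)
    (e : Total) : dd e (depPart Φ k) p = (fderiv ℝ Φ p e).2 k := by
  have h := hasFDerivAt_pi'.1 (differentiableAt_symmetry hΦ hp).hasFDerivAt.snd k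
  have h' : HasFDerivAt (depPart Φ k) _ p := h
  unfold dd
  rw [h'.fderiv]
  rfl

theorem fderiv_injective (hΦ : IsLocalPointSymmetry Φ) {p : Total} (hp : p ∈ Φ.source) :
    Function.Injective (fderiv ℝ Φ p) := by
  have h1 := (differentiableAt_symmetry hΦ hp).hasFDerivAt
  have h2 : HasFDerivAt Φ.symm (fderiv ℝ Φ.symm (Φ p)) (Φ p) :=
    ((hΦ.smooth_symm.contDiffAt (Φ.open_target.mem_nhds (Φ.map_source hp))).differentiableAt
      (by simp)).hasFDerivAt
  have h3 : (Φ.symm ∘ Φ) =ᶠ[nhds p] id := by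
    filter_upwards [Φ.open_source.mem_nhds hp] with q hq using Φ.left_inv hq
  have h4 := (h3.hasFDerivAt_iff.1 (h2.comp p h1)).unique (hasFDerivAt_id p)
  intro a b hab
  have e1 := DFunLike.congr_fun h4 a
  have e2 := DFunLike.congr_fun h4 b
  simp only [ContinuousLinearMap.comp_apply, hab, ContinuousLinearMap.id_apply] at e1 e2
  exact e1.symm.trans e2

theorem fderiv_surjective (hΦ : IsLocalPointSymmetry Φ) {p : Total} (hp : p ∈ Φ.source) :
    Function.Surjective (fderiv ℝ Φ p) :=
  (LinearMap.injective_iff_surjective (f := (fderiv ℝ Φ p).toLinearMap)).1 (fderiv_injective hΦ hp)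

theorem preservesJets_fderiv (hΦ : IsLocalPointSymmetry Φ) {p : Total} (hp : p ∈ Φ.source) :
    PreservesJets (fderiv ℝ Φ p) p.2 (Φ p).2 :=
  ⟨fderiv_injective hΦ hp, fun _ hW hdet => hΦ.exists_jetEqs hp hW hdet⟩

/-- The generic points. -/
def genericSet (Φ : OpenPartialHomeomorph Total Total) : Set Total :=
  {p | p.2 0 ≠ 0 ∧ p.2 1 ≠ 0 ∧ p.2 2 ≠ 0 ∧ (Φ p).2 0 ≠ 0 ∧ (Φ p).2 2 ≠ 0 ∧
    ∃ θ, (baseMatrix (fderiv ℝ Φ p) (jetParam p.2 θ)).det ≠ 0}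

theorem nonempty_inter_fibre_ne_zero {O : Set Total} (hO : IsOpen O) (hne : O.Nonempty)
    (k : Fin 4) : IsOpen (O ∩ {p | p.2 k ≠ 0}) ∧ (O ∩ {p | p.2 k ≠ 0}).Nonempty := by
  have hc : Continuous fun p : Total => p.2 k := by fun_prop
  refine ⟨hO.inter (isOpen_ne_fun hc continuous_const), ?_⟩
  by_contra hemp
  rw [Set.not_nonempty_iff_eq_empty] at hemp
  obtain ⟨p, hp⟩ := hne
  have hz : ∀ q ∈ O, q.2 k = 0 := by
    intro q hq
    by_contra h
    have : q ∈ O ∩ {p | p.2 k ≠ 0} := ⟨hq, h⟩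
    rw [hemp] at this
    exact this
  have := fderiv_apply_eq_zero hO (hasFDerivAt_fibre k p) hp hz (depVec k)
  simp [depVec] at this

/-- The pointwise arguments divide by u, v, h, by the new u and h, and by a base determinant.
Density lets the identities they produce extend to the whole domain by continuity; the determinant
is where `acts` enters. -/
theorem genericSet_dense (hΦ : IsLocalPointSymmetry Φ) (O : Set Total) (hO : IsOpen O)
    (hne : O.Nonempty) (hsub : O ⊆ Φ.source) : (O ∩ genericSet Φ).Nonempty := by
  have hc : ContinuousOn Φ Φ.source := Φ.continuousOn
  have image_step : ∀ (O : Set Total) (k : Fin 4), IsOpen O → O.Nonempty → O ⊆ Φ.source →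
      IsOpen (O ∩ Φ ⁻¹' {p | p.2 k ≠ 0}) ∧ (O ∩ Φ ⁻¹' {p | p.2 k ≠ 0}).Nonempty := by
    intro O k hO hne hsub
    obtain ⟨ho, q, ⟨p, hp, rfl⟩, hq⟩ := nonempty_inter_fibre_ne_zero
      (Φ.isOpen_image_of_subset_source hO hsub) (hne.image Φ) k
    exact ⟨(hc.mono hsub).isOpen_inter_preimage hO
      (isOpen_ne_fun (by fun_prop) continuous_const), p, hp, hq⟩
  obtain ⟨o1, n1⟩ := nonempty_inter_fibre_ne_zero hO hne 0
  obtain ⟨o2, n2⟩ := nonempty_inter_fibre_ne_zero o1 n1 1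
  obtain ⟨o3, n3⟩ := nonempty_inter_fibre_ne_zero o2 n2 2
  have s3 : O ∩ {p | p.2 0 ≠ 0} ∩ {p | p.2 1 ≠ 0} ∩ {p | p.2 2 ≠ 0} ⊆ Φ.source :=
    fun _ hp => hsub hp.1.1.1
  obtain ⟨o4, n4⟩ := image_step _ 0 o3 n3 s3
  obtain ⟨o5, n5⟩ := image_step _ 2 o4 n4 (Set.inter_subset_left.trans s3)
  obtain ⟨p, hp, W, hW, hdet⟩ := hΦ.exists_det_ne_zero o5 n5
    (Set.inter_subset_left.trans (Set.inter_subset_left.trans s3))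
  obtain ⟨θ, rfl⟩ := hW.exists_eq_jetParam
  obtain ⟨⟨⟨⟨⟨h0, h1⟩, h2⟩, h3⟩, h4⟩, h5⟩ := hp
  exact ⟨p, h0, h1, h2, h3, h4, h5, θ, hdet⟩

theorem eq_zero_of_generic (hΦ : IsLocalPointSymmetry Φ) {f : Total → ℝ}
    (hf : ContinuousOn f Φ.source) (h : ∀ p ∈ Φ.source, p ∈ genericSet Φ → f p = 0) :
    ∀ p ∈ Φ.source, f p = 0 :=
  eq_zero_of_dense (genericSet_dense hΦ) Φ.open_source hf h

theorem dd_dep_indepPart (hΦ : IsLocalPointSymmetry Φ) (i : Fin 3) (k : Fin 4) (hk : k ≠ 3) :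
    ∀ p ∈ Φ.source, dd (depVec k) (indepPart Φ i) p = 0 := by
  refine eq_zero_of_generic hΦ
    (contDiffOn_dd Φ.open_source (contDiffOn_indepPart hΦ i) _).continuousOn ?_
  rintro p hp ⟨h0, h1, h2, h3, h4, hθ⟩
  have h := ((preservesJets_fderiv hΦ hp).dichotomy h2 h4 h0 h3 hθ).1 i
  rw [dd_indepPart hΦ hp]
  fin_cases k
  · exact h.1
  · exact h.2.1
  · exact h.2.2
  · exact absurd rfl hk

/-- The direction of the transport of the fluid. -/
def transportVec (y : Dep) : Total := indepVec 0 + y 0 • indepVec 1 + y 1 • indepVec 2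

theorem dd_transportVec (f : Total → ℝ) (y : Dep) (p : Total) : dd (transportVec y) f p =
    dd (indepVec 0) f p + y 0 * dd (indepVec 1) f p + y 1 * dd (indepVec 2) f p := by
  simp [dd, transportVec]

/-- The time direction and the transport direction are not interchanged. -/
theorem sum_sq_eq_zero (hΦ : IsLocalPointSymmetry Φ) : ∀ p ∈ Φ.source,
    dd (indepVec 0) (indepPart Φ 1) p ^ 2 + dd (indepVec 0) (indepPart Φ 2) p ^ 2 +
    (dd (depVec 3) (indepPart Φ 1) p - depPart Φ 0 p * dd (depVec 3) (indepPart Φ 0) p) ^ 2 +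
    (dd (depVec 3) (indepPart Φ 2) p - depPart Φ 1 p * dd (depVec 3) (indepPart Φ 0) p) ^ 2 +
    (dd (indepVec 0) (indepPart Φ 1) p + p.2 0 * dd (indepVec 1) (indepPart Φ 1) p +
      p.2 1 * dd (indepVec 2) (indepPart Φ 1) p -
      depPart Φ 0 p * (dd (indepVec 0) (indepPart Φ 0) p +
        p.2 0 * dd (indepVec 1) (indepPart Φ 0) p +
        p.2 1 * dd (indepVec 2) (indepPart Φ 0) p)) ^ 2 +
    (dd (indepVec 0) (indepPart Φ 2) p + p.2 0 * dd (indepVec 1) (indepPart Φ 2) p +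
      p.2 1 * dd (indepVec 2) (indepPart Φ 2) p -
      depPart Φ 1 p * (dd (indepVec 0) (indepPart Φ 0) p +
        p.2 0 * dd (indepVec 1) (indepPart Φ 0) p +
        p.2 1 * dd (indepVec 2) (indepPart Φ 0) p)) ^ 2 = 0 := by
  -- `s` vanishes exactly when both directions are kept, and `r` vanishes wherever they are
  -- interchanged. So `s * r` is zero at generic points and hence everywhere, and on the open set
  -- where `s` is nonzero `r` must vanish.
  set s : Total → ℝ := fun p =>
    dd (indepVec 0) (indepPart Φ 1) p ^ 2 + dd (indepVec 0) (indepPart Φ 2) p ^ 2 +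
    (dd (depVec 3) (indepPart Φ 1) p - depPart Φ 0 p * dd (depVec 3) (indepPart Φ 0) p) ^ 2 +
    (dd (depVec 3) (indepPart Φ 2) p - depPart Φ 1 p * dd (depVec 3) (indepPart Φ 0) p) ^ 2 +
    (dd (indepVec 0) (indepPart Φ 1) p + p.2 0 * dd (indepVec 1) (indepPart Φ 1) p +
      p.2 1 * dd (indepVec 2) (indepPart Φ 1) p -
      depPart Φ 0 p * (dd (indepVec 0) (indepPart Φ 0) p +
        p.2 0 * dd (indepVec 1) (indepPart Φ 0) p +
        p.2 1 * dd (indepVec 2) (indepPart Φ 0) p)) ^ 2 +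
    (dd (indepVec 0) (indepPart Φ 2) p + p.2 0 * dd (indepVec 1) (indepPart Φ 2) p +
      p.2 1 * dd (indepVec 2) (indepPart Φ 2) p -
      depPart Φ 1 p * (dd (indepVec 0) (indepPart Φ 0) p +
        p.2 0 * dd (indepVec 1) (indepPart Φ 0) p +
        p.2 1 * dd (indepVec 2) (indepPart Φ 0) p)) ^ 2 with hs
  set r : Total → ℝ := fun p => dd (depVec 3) (indepPart Φ 1) p ^ 2 +
    (dd (indepVec 0) (indepPart Φ 1) p + p.2 0 * dd (indepVec 1) (indepPart Φ 1) p +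
      p.2 1 * dd (indepVec 2) (indepPart Φ 1) p) ^ 2 with hr
  have hcd : ∀ e i, ContinuousOn (dd e (indepPart Φ i)) Φ.source := fun e i =>
    (contDiffOn_dd Φ.open_source (contDiffOn_indepPart hΦ i) e).continuousOn
  have hcp : ∀ k, ContinuousOn (depPart Φ k) Φ.source := fun k =>
    (contDiffOn_depPart hΦ k).continuousOn
  have hcs : ContinuousOn s Φ.source := by
    rw [hs]
    fun_prop
  have hcr : ContinuousOn r Φ.source := by
    rw [hr]
    fun_prop
  have hsr : ∀ p ∈ Φ.source, s p * r p = 0 := by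
    refine eq_zero_of_generic hΦ (hcs.mul hcr) ?_
    rintro p hp ⟨h0, h1, h2, h3, h4, hθ⟩
    have h := ((preservesJets_fderiv hΦ hp).dichotomy h2 h4 h0 h3 hθ).2
    have hdd := dd_indepPart hΦ hp
    simp only [← hdd] at h
    have ht : ∀ i, dd (indepVec 0 + p.2 0 • indepVec 1 + p.2 1 • indepVec 2) (indepPart Φ i) p =
        _ := fun i => dd_transportVec (indepPart Φ i) p.2 p
    simp only [ht] at h
    rcases h with ⟨a1, a2, a3, a4, a5, a6⟩ | ⟨a1, a2⟩
    · have : s p = 0 := by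
        simp only [hs]
        rw [a5, a6, a3, a4, a1, a2]
        simp [depPart]
      rw [this, zero_mul]
    · have : r p = 0 := by
        simp only [hr]
        rw [a1, a2]
        simp
      rw [this, mul_zero]
  intro p hp
  by_contra hne
  have hV : IsOpen (Φ.source ∩ s ⁻¹' {0}ᶜ) :=
    hcs.isOpen_inter_preimage Φ.open_source isOpen_compl_singleton
  set V := Φ.source ∩ s ⁻¹' {0}ᶜ with hVdef
  have hpV : p ∈ V := ⟨hp, hne⟩
  have hVs : V ⊆ Φ.source := Set.inter_subset_left
  have hrV : ∀ q ∈ V, r q = 0 := fun q hq =>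
    (mul_eq_zero.1 (hsr q hq.1)).resolve_left hq.2
  have r1 : ∀ q ∈ V, dd (depVec 3) (indepPart Φ 1) q = 0 := by
    intro q hq
    have := hrV q hq
    simp only [hr] at this
    nlinarith
  have r2 : ∀ q ∈ V, dd (indepVec 0) (indepPart Φ 1) q + q.2 0 * dd (indepVec 1) (indepPart Φ 1) q +
      q.2 1 * dd (indepVec 2) (indepPart Φ 1) q = 0 := by
    intro q hq
    have := hrV q hq
    simp only [hr] at this
    nlinarith
  have hX := contDiffOn_indepPart hΦ 1
  have hdX : ∀ j, HasFDerivAt (dd (indepVec j) (indepPart Φ 1)) _ p := fun j =>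
    hasFDerivAt_of_contDiffOn Φ.open_source (contDiffOn_dd Φ.open_source hX (indepVec j)) hp
  have hz : ∀ j k, k ≠ 3 → fderiv ℝ (dd (indepVec j) (indepPart Φ 1)) p (depVec k) = 0 :=
    fun j k hk => dd_dd_eq_zero Φ.open_source hX (dd_dep_indepPart hΦ 1 k hk) _ p hp
  -- The new x is constant along the transport direction and independent of u and v. Differentiating
  -- in u and v kills its x- and y-derivatives, then its t-derivative, so its whole differential is
  -- zero. This contradicts the invertibility of dΦ.
  have key := fderiv_apply_eq_zero hV (((hdX 0).add ((hasFDerivAt_fibre 0 p).mul (hdX 1))).add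
    ((hasFDerivAt_fibre 1 p).mul (hdX 2))) hpV (fun q hq => r2 q hq)
  have x1 : dd (indepVec 1) (indepPart Φ 1) p = 0 := by
    have := key (depVec 0)
    simpa [hz] using this
  have x2 : dd (indepVec 2) (indepPart Φ 1) p = 0 := by
    have := key (depVec 1)
    simpa [hz] using this
  have x0 : dd (indepVec 0) (indepPart Φ 1) p = 0 := by
    have := r2 p hpV
    rw [x1, x2] at this
    simpa using this
  have hfz : fderiv ℝ (indepPart Φ 1) p = 0 := by
    refine clm_eq_zero ?_ ?_
    · intro j
      fin_cases j <;> assumption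
    · intro k
      by_cases hk : k = 3
      · rw [hk]; exact r1 p hpV
      · exact dd_dep_indepPart hΦ 1 k hk p hp
  obtain ⟨v, hv⟩ := fderiv_surjective hΦ hp (indepVec 1)
  have h1 := dd_indepPart hΦ hp 1 v
  rw [hv] at h1
  simp [dd, hfz, indepVec] at h1

end Symmetry

/-! ### Projectability and the transformed equations -/

section Symmetry

variable {Φ : OpenPartialHomeomorph Total Total}

theorem indepPart_relations (hΦ : IsLocalPointSymmetry Φ) {p : Total} (hp : p ∈ Φ.source) :
    dd (indepVec 0) (indepPart Φ 1) p = 0 ∧ dd (indepVec 0) (indepPart Φ 2) p = 0 ∧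
    dd (depVec 3) (indepPart Φ 1) p = depPart Φ 0 p * dd (depVec 3) (indepPart Φ 0) p ∧
    dd (depVec 3) (indepPart Φ 2) p = depPart Φ 1 p * dd (depVec 3) (indepPart Φ 0) p ∧
    p.2 0 * dd (indepVec 1) (indepPart Φ 1) p + p.2 1 * dd (indepVec 2) (indepPart Φ 1) p =
      depPart Φ 0 p * (dd (indepVec 0) (indepPart Φ 0) p +
        p.2 0 * dd (indepVec 1) (indepPart Φ 0) p + p.2 1 * dd (indepVec 2) (indepPart Φ 0) p) ∧
    p.2 0 * dd (indepVec 1) (indepPart Φ 2) p + p.2 1 * dd (indepVec 2) (indepPart Φ 2) p =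
      depPart Φ 1 p * (dd (indepVec 0) (indepPart Φ 0) p +
        p.2 0 * dd (indepVec 1) (indepPart Φ 0) p + p.2 1 * dd (indepVec 2) (indepPart Φ 0) p) := by
  have h := sum_sq_eq_zero hΦ p hp
  have aux : ∀ {a b c d e f : ℝ}, a ^ 2 + b ^ 2 + c ^ 2 + d ^ 2 + e ^ 2 + f ^ 2 = 0 →
      a = 0 ∧ b = 0 ∧ c = 0 ∧ d = 0 ∧ e = 0 ∧ f = 0 := by
    intro a b c d e f h
    have := sq_nonneg a
    have := sq_nonneg b
    have := sq_nonneg c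
    have := sq_nonneg d
    have := sq_nonneg e
    have := sq_nonneg f
    refine ⟨?_, ?_, ?_, ?_, ?_, ?_⟩ <;> refine pow_eq_zero_iff two_ne_zero |>.1 ?_ <;> linarith
  obtain ⟨h1, h2, h3, h4, h5, h6⟩ := aux h
  rw [h1] at h5
  rw [h2] at h6
  exact ⟨h1, h2, sub_eq_zero.1 h3, sub_eq_zero.1 h4, by linarith, by linarith⟩

theorem fderiv_eq_zero_of_dd (hΦ : IsLocalPointSymmetry Φ) {p : Total} (hp : p ∈ Φ.source)
    {e : Total} (h1 : ∀ i, dd e (indepPart Φ i) p = 0) (h2 : ∀ k, dd e (depPart Φ k) p = 0) :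
    e = 0 := by
  apply fderiv_injective hΦ hp
  rw [map_zero]
  refine Prod.ext ?_ ?_
  · ext i
    rw [← dd_indepPart hΦ hp, h1]
    rfl
  · ext k
    rw [← dd_depPart hΦ hp, h2]
    rfl

/-- The transformed independent variables do not depend on the dependent variables. -/
theorem dd_depVec_indepPart (hΦ : IsLocalPointSymmetry Φ) (i : Fin 3) (k : Fin 4) :
    ∀ p ∈ Φ.source, dd (depVec k) (indepPart Φ i) p = 0 := by
  intro p hp
  by_cases hk : k ≠ 3
  · exact dd_dep_indepPart hΦ i k hk p hp
  rw [not_not] at hk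
  subst hk
  have hT : dd (depVec 3) (indepPart Φ 0) p = 0 := by
    by_contra hne
    have hz : ∀ i k, k ≠ 3 → fderiv ℝ (dd (depVec 3) (indepPart Φ i)) p (depVec k) = 0 :=
      fun i k hk => dd_dd_eq_zero Φ.open_source (contDiffOn_indepPart hΦ i)
        (dd_dep_indepPart hΦ i k hk) _ p hp
    have hd : ∀ i, HasFDerivAt (dd (depVec 3) (indepPart Φ i)) _ p := fun i =>
      hasFDerivAt_of_contDiffOn Φ.open_source
        (contDiffOn_dd Φ.open_source (contDiffOn_indepPart hΦ i) _) hp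
    have hd' : ∀ k, HasFDerivAt (depPart Φ k) _ p := fun k =>
      hasFDerivAt_of_contDiffOn Φ.open_source (contDiffOn_depPart hΦ k) hp
    -- If the new time depended on b, then X_b = U T_b and Y_b = V T_b would express the new
    -- velocity through functions independent of u, v, h.
    have u0 : ∀ k, k ≠ 3 → dd (depVec k) (depPart Φ 0) p = 0 := by
      intro k hk
      have := fderiv_apply_eq_zero Φ.open_source ((hd 1).sub ((hd' 0).mul (hd 0))) hp
        (fun q hq => sub_eq_zero.2 (indepPart_relations hΦ hq).2.2.1) (depVec k)
      simp [hz _ k hk, hne] at this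
      exact this
    have u1 : ∀ k, k ≠ 3 → dd (depVec k) (depPart Φ 1) p = 0 := by
      intro k hk
      have := fderiv_apply_eq_zero Φ.open_source ((hd 2).sub ((hd' 1).mul (hd 0))) hp
        (fun q hq => sub_eq_zero.2 (indepPart_relations hΦ hq).2.2.2.1) (depVec k)
      simp [hz _ k hk, hne] at this
      exact this
    -- The three directions ∂_u, ∂_v, ∂_h then affect only the new h and b. The zero row pads a 2 ×
    -- 3 matrix to a square one, to produce a kernel vector against injectivity.
    set M : Matrix (Fin 3) (Fin 3) ℝ := Matrix.of
      ![fun k => dd (depVec k.castSucc) (depPart Φ 2) p,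
        fun k => dd (depVec k.castSucc) (depPart Φ 3) p, 0] with hM
    have hdet : M.det = 0 := Matrix.det_eq_zero_of_row_eq_zero 2 (by simp [hM])
    obtain ⟨s, hs, hMs⟩ := Matrix.exists_mulVec_eq_zero_iff.2 hdet
    have e2 := congrFun hMs 0
    have e3 := congrFun hMs 1
    simp [hM, Matrix.mulVec, dotProduct] at e2 e3
    have hlin : ∀ f : Total → ℝ, dd (∑ j : Fin 3, s j • depVec j.castSucc) f p =
        ∑ j : Fin 3, dd (depVec j.castSucc) f p * s j := by
      intro f
      simp [dd, map_sum, mul_comm]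
    have h0 : ∀ j : Fin 3, j.castSucc ≠ (3 : Fin 4) := by decide
    have := fderiv_eq_zero_of_dd hΦ hp (e := ∑ j : Fin 3, s j • depVec j.castSucc)
      (fun i => by
        rw [hlin]
        exact Finset.sum_eq_zero fun j _ => by rw [dd_dep_indepPart hΦ i _ (h0 j) p hp, zero_mul])
      (fun k => by
        rw [hlin]
        fin_cases k
        · exact Finset.sum_eq_zero fun j _ => by
            simp only [Fin.zero_eta]; rw [u0 _ (h0 j), zero_mul]
        · exact Finset.sum_eq_zero fun j _ => by
            simp only [Fin.mk_one]; rw [u1 _ (h0 j), zero_mul]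
        · exact e2
        · exact e3)
    apply hs
    have h2 := congrArg Prod.snd this
    ext j
    have := congrFun h2 j.castSucc
    simpa [Prod.snd_sum, Finset.sum_apply] using this
  obtain ⟨-, -, h1, h2, -⟩ := indepPart_relations hΦ hp
  rw [hT, mul_zero] at h1 h2
  fin_cases i <;> assumption

/-- The total derivative of the transformed dependent variables along a graph. -/
noncomputable def totalDeriv (Φ : OpenPartialHomeomorph Total Total) (p : Total)
    (W : Matrix (Fin 4) (Fin 3) ℝ) (k : Fin 4) (j : Fin 3) : ℝ :=
  dd (indepVec j) (depPart Φ k) p + (W 0 j * dd (depVec 0) (depPart Φ k) p +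
    W 1 j * dd (depVec 1) (depPart Φ k) p + W 2 j * dd (depVec 2) (depPart Φ k) p +
    W 3 j * dd (depVec 3) (depPart Φ k) p)

theorem fderiv_tangent_snd (hΦ : IsLocalPointSymmetry Φ) {p : Total} (hp : p ∈ Φ.source)
    (W : Matrix (Fin 4) (Fin 3) ℝ) (k : Fin 4) (j : Fin 3) :
    (fderiv ℝ Φ p (tangent W j)).2 k = totalDeriv Φ p W k j := by
  rw [map_tangent, totalDeriv]
  simp [dd_depPart hΦ hp]

theorem baseMatrix_eq (hΦ : IsLocalPointSymmetry Φ) {p : Total} (hp : p ∈ Φ.source)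
    (W : Matrix (Fin 4) (Fin 3) ℝ) :
    baseMatrix (fderiv ℝ Φ p) W = fun i j => dd (indepVec j) (indepPart Φ i) p := by
  have h : ∀ i k, (fderiv ℝ Φ p (depVec k)).1 i = 0 := fun i k => by
    rw [← dd_indepPart hΦ hp]; exact dd_depVec_indepPart hΦ i k p hp
  ext i j
  rw [baseMatrix_apply, dd_indepPart hΦ hp]
  simp [h]

/-- The new derivatives V are eliminated through Vn = Z. As n(1, u, v) is a multiple of the new
transport direction, transport derivatives in V become transport derivatives in Z. The gradients are
handled by contracting the momentum equations with the spatial columns of n, the divergence by the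
cofactors of the spatial block. -/
theorem jet_consequences {V Z : Matrix (Fin 4) (Fin 3) ℝ} {n : Matrix (Fin 3) (Fin 3) ℝ}
    {y' : Dep} {u v : ℝ} (hV : JetEqs y' V) (h10 : n 1 0 = 0) (h20 : n 2 0 = 0)
    (hZ : ∀ i j, ∑ k, V i k * n k j = Z i j)
    (t1 : u * n 1 1 + v * n 1 2 = y' 0 * (n 0 0 + u * n 0 1 + v * n 0 2))
    (t2 : u * n 2 1 + v * n 2 2 = y' 1 * (n 0 0 + u * n 0 1 + v * n 0 2)) :
    Z 3 0 = 0 ∧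
    n 0 0 * (n 1 1 * (Z 0 0 + u * Z 0 1 + v * Z 0 2) + n 2 1 * (Z 1 0 + u * Z 1 1 + v * Z 1 2)) +
      (n 0 0 + u * n 0 1 + v * n 0 2) * (n 0 0 * Z 2 1 - n 0 1 * Z 2 0 - n 0 0 * Z 3 1) = 0 ∧
    n 0 0 * (n 1 2 * (Z 0 0 + u * Z 0 1 + v * Z 0 2) + n 2 2 * (Z 1 0 + u * Z 1 1 + v * Z 1 2)) +
      (n 0 0 + u * n 0 1 + v * n 0 2) * (n 0 0 * Z 2 2 - n 0 2 * Z 2 0 - n 0 0 * Z 3 2) = 0 ∧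
    (n 0 1 = 0 → n 0 2 = 0 → (n 1 1 * n 2 2 - n 1 2 * n 2 1) * (Z 2 0 + u * Z 2 1 + v * Z 2 2) +
      n 0 0 * y' 2 * (n 2 2 * Z 0 1 - n 2 1 * Z 0 2 + n 1 1 * Z 1 2 - n 1 2 * Z 1 1) = 0) := by
  obtain ⟨e0, e1, e2, e3⟩ := hV
  simp only [Fin.sum_univ_three] at hZ
  simp only [← hZ, h10, h20, e3]
  set δ := n 0 0 + u * n 0 1 + v * n 0 2 with hδ
  refine ⟨by ring, ?_, ?_, ?_⟩
  · linear_combination n 0 0 * n 1 1 * (V 0 1 * t1 + V 0 2 * t2 + δ * e0) +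
      n 0 0 * n 2 1 * (V 1 1 * t1 + V 1 2 * t2 + δ * e1)
  · linear_combination n 0 0 * n 1 2 * (V 0 1 * t1 + V 0 2 * t2 + δ * e0) +
      n 0 0 * n 2 2 * (V 1 1 * t1 + V 1 2 * t2 + δ * e1)
  · intro h1 h2
    rw [hδ, h1, h2] at t1 t2
    rw [h1, h2]
    linear_combination (n 1 1 * n 2 2 - n 1 2 * n 2 1) * (V 2 1 * t1 + V 2 2 * t2 + n 0 0 * e2)

/-- The transformed equations for all first derivatives at a generic point. -/
theorem transformed_equations (hΦ : IsLocalPointSymmetry Φ) {p : Total} (hp : p ∈ Φ.source)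
    (hg : p ∈ genericSet Φ) :
    let n : Matrix (Fin 3) (Fin 3) ℝ := fun i j => dd (indepVec j) (indepPart Φ i) p
    n.det ≠ 0 ∧ ∀ θ, let Z := totalDeriv Φ p (jetParam p.2 θ)
    Z 3 0 = 0 ∧
    n 0 0 * (n 1 1 * (Z 0 0 + p.2 0 * Z 0 1 + p.2 1 * Z 0 2) +
      n 2 1 * (Z 1 0 + p.2 0 * Z 1 1 + p.2 1 * Z 1 2)) +
      (n 0 0 + p.2 0 * n 0 1 + p.2 1 * n 0 2) *
      (n 0 0 * Z 2 1 - n 0 1 * Z 2 0 - n 0 0 * Z 3 1) = 0 ∧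
    n 0 0 * (n 1 2 * (Z 0 0 + p.2 0 * Z 0 1 + p.2 1 * Z 0 2) +
      n 2 2 * (Z 1 0 + p.2 0 * Z 1 1 + p.2 1 * Z 1 2)) +
      (n 0 0 + p.2 0 * n 0 1 + p.2 1 * n 0 2) *
      (n 0 0 * Z 2 2 - n 0 2 * Z 2 0 - n 0 0 * Z 3 2) = 0 ∧
    (n 0 1 = 0 → n 0 2 = 0 → (n 1 1 * n 2 2 - n 1 2 * n 2 1) *
      (Z 2 0 + p.2 0 * Z 2 1 + p.2 1 * Z 2 2) +
      n 0 0 * depPart Φ 2 p *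
        (n 2 2 * Z 0 1 - n 2 1 * Z 0 2 + n 1 1 * Z 1 2 - n 1 2 * Z 1 1) = 0) := by
  intro n
  obtain ⟨-, -, -, -, -, θ₀, hθ₀⟩ := hg
  rw [baseMatrix_eq hΦ hp] at hθ₀
  refine ⟨hθ₀, fun θ => ?_⟩
  obtain ⟨V, hV, hVZ⟩ := (preservesJets_fderiv hΦ hp).exists_jetEqs _ (jetEqs_jetParam p.2 θ)
    (by rw [baseMatrix_eq hΦ hp]; exact hθ₀)
  obtain ⟨h1, h2, -, -, h3, h4⟩ := indepPart_relations hΦ hp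
  refine jet_consequences hV h1 h2 (fun i j => ?_) h3 h4
  rw [← fderiv_tangent_snd hΦ hp, ← hVZ]
  refine Finset.sum_congr rfl fun k _ => ?_
  exact congrArg (V i k * ·) (congrFun (congrFun (baseMatrix_eq hΦ hp (jetParam p.2 θ)) k) j).symm

/-- The new equation b_t = 0 says that the total t-derivative of the new b vanishes for all allowed
u_t, v_t, h_t, which are arbitrary where h ≠ 0. -/
theorem dd_depPart_three (hΦ : IsLocalPointSymmetry Φ) :
    ∀ p ∈ Φ.source, dd (indepVec 0) (depPart Φ 3) p = 0 ∧ dd (depVec 0) (depPart Φ 3) p = 0 ∧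
      dd (depVec 1) (depPart Φ 3) p = 0 ∧ dd (depVec 2) (depPart Φ 3) p = 0 := by
  have hc : ∀ e, ContinuousOn (dd e (depPart Φ 3)) Φ.source := fun e =>
    (contDiffOn_dd Φ.open_source (contDiffOn_depPart hΦ 3) e).continuousOn
  have h : ∀ p ∈ Φ.source, p ∈ genericSet Φ → _ := fun p hp hg =>
    forms_of_forall_time hg.2.2.1 fun θ => ((transformed_equations hΦ hp hg).2 θ).1
  intro p hp
  exact ⟨eq_zero_of_generic hΦ (hc _) (fun p hp hg => (h p hp hg).1) p hp,
    eq_zero_of_generic hΦ (hc _) (fun p hp hg => (h p hp hg).2.1) p hp,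
    eq_zero_of_generic hΦ (hc _) (fun p hp hg => (h p hp hg).2.2.1) p hp,
    eq_zero_of_generic hΦ (hc _) (fun p hp hg => (h p hp hg).2.2.2) p hp⟩

/-- Each quantity divides the nonzero base determinant, the last one after multiplication by u. -/
theorem transport_factor_ne_zero (hΦ : IsLocalPointSymmetry Φ) {p : Total} (hp : p ∈ Φ.source)
    (hg : p ∈ genericSet Φ) : dd (indepVec 0) (indepPart Φ 0) p ≠ 0 ∧
    dd (indepVec 1) (indepPart Φ 1) p * dd (indepVec 2) (indepPart Φ 2) p -
      dd (indepVec 2) (indepPart Φ 1) p * dd (indepVec 1) (indepPart Φ 2) p ≠ 0 ∧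
    dd (indepVec 0) (indepPart Φ 0) p + p.2 0 * dd (indepVec 1) (indepPart Φ 0) p +
      p.2 1 * dd (indepVec 2) (indepPart Φ 0) p ≠ 0 := by
  have e := Matrix.det_fin_three
    (fun i j => dd (indepVec j) (indepPart Φ i) p : Matrix (Fin 3) (Fin 3) ℝ)
  have hdet := fun h => (transformed_equations hΦ hp hg).1 (e.trans h)
  obtain ⟨h1, h2, -, -, h3, h4⟩ := indepPart_relations hΦ hp
  simp only [h1, h2] at hdet
  refine ⟨fun h => hdet (by rw [h]; ring), fun h => hdet ?_, fun h => hdet ?_⟩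
  · linear_combination dd (indepVec 0) (indepPart Φ 0) p * h
  · rw [h, mul_zero] at h3 h4
    apply mul_left_cancel₀ hg.1
    linear_combination dd (indepVec 0) (indepPart Φ 0) p *
      (dd (indepVec 2) (indepPart Φ 2) p * h3 - dd (indepVec 2) (indepPart Φ 1) p * h4)

theorem hasFDerivAt_dd_indepPart (hΦ : IsLocalPointSymmetry Φ) {p : Total} (hp : p ∈ Φ.source)
    (e : Total) (i : Fin 3) :
    HasFDerivAt (dd e (indepPart Φ i)) (fderiv ℝ (dd e (indepPart Φ i)) p) p :=
  hasFDerivAt_of_contDiffOn Φ.open_source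
    (contDiffOn_dd Φ.open_source (contDiffOn_indepPart hΦ i) e) hp

theorem hasFDerivAt_dd_depPart (hΦ : IsLocalPointSymmetry Φ) {p : Total} (hp : p ∈ Φ.source)
    (e : Total) (i : Fin 4) :
    HasFDerivAt (dd e (depPart Φ i)) (fderiv ℝ (dd e (depPart Φ i)) p) p :=
  hasFDerivAt_of_contDiffOn Φ.open_source
    (contDiffOn_dd Φ.open_source (contDiffOn_depPart hΦ i) e) hp

theorem hasFDerivAt_depPart (hΦ : IsLocalPointSymmetry Φ) {p : Total} (hp : p ∈ Φ.source)
    (i : Fin 4) : HasFDerivAt (depPart Φ i) (fderiv ℝ (depPart Φ i) p) p :=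
  hasFDerivAt_of_contDiffOn Φ.open_source (contDiffOn_depPart hΦ i) hp

theorem fderiv_dd_indepPart_depVec (hΦ : IsLocalPointSymmetry Φ) {p : Total} (hp : p ∈ Φ.source)
    (e : Total) (i : Fin 3) (k : Fin 4) :
    fderiv ℝ (dd e (indepPart Φ i)) p (depVec k) = 0 :=
  dd_dd_eq_zero Φ.open_source (contDiffOn_indepPart hΦ i) (dd_depVec_indepPart hΦ i k) e p hp

theorem fderiv_dd_indepPart_time (hΦ : IsLocalPointSymmetry Φ) {p : Total} (hp : p ∈ Φ.source)
    (e : Total) : fderiv ℝ (dd e (indepPart Φ 1)) p (indepVec 0) = 0 ∧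
      fderiv ℝ (dd e (indepPart Φ 2)) p (indepVec 0) = 0 :=
  ⟨dd_dd_eq_zero Φ.open_source (contDiffOn_indepPart hΦ 1)
    (fun _ hq => (indepPart_relations hΦ hq).1) e p hp,
   dd_dd_eq_zero Φ.open_source (contDiffOn_indepPart hΦ 2)
    (fun _ hq => (indepPart_relations hΦ hq).2.1) e p hp⟩

/-- The transformed velocity does not depend on `h` and `b`. -/
theorem dd_velocity (hΦ : IsLocalPointSymmetry Φ) (k : Fin 4) (hk : k = 2 ∨ k = 3) :
    ∀ p ∈ Φ.source, dd (depVec k) (depPart Φ 0) p = 0 ∧ dd (depVec k) (depPart Φ 1) p = 0 := by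
  have h0 : ∀ q ∈ Φ.source, _ := fun q hq =>
    sub_eq_zero.2 (indepPart_relations hΦ hq).2.2.2.2.1
  have h1 : ∀ q ∈ Φ.source, _ := fun q hq =>
    sub_eq_zero.2 (indepPart_relations hΦ hq).2.2.2.2.2
  have hc : ∀ i, ContinuousOn (dd (depVec k) (depPart Φ i)) Φ.source := fun i =>
    (contDiffOn_dd Φ.open_source (contDiffOn_depPart hΦ i) _).continuousOn
  have key : ∀ p ∈ Φ.source, p ∈ genericSet Φ →
      dd (depVec k) (depPart Φ 0) p = 0 ∧ dd (depVec k) (depPart Φ 1) p = 0 := by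
    intro p hp hg
    have hne := (transport_factor_ne_zero hΦ hp hg).2.2
    have hx := fun j i => hasFDerivAt_dd_indepPart hΦ hp (indepVec j) i
    have hy := fun k => hasFDerivAt_depPart hΦ hp k
    have hz := fun e i => fderiv_dd_indepPart_depVec hΦ hp e i k
    -- In the formula (u X_x + v X_y) = U δ, with δ the transport derivative of the new time, only U
    -- can depend on h or b. Differentiation leaves δ times the derivative of U.
    have a := fderiv_apply_eq_zero Φ.open_source
      ((((hasFDerivAt_fibre 0 p).mul (hx 1 1)).add ((hasFDerivAt_fibre 1 p).mul (hx 2 1))).sub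
      ((hy 0).mul (((hx 0 0).add ((hasFDerivAt_fibre 0 p).mul (hx 1 0))).add
        ((hasFDerivAt_fibre 1 p).mul (hx 2 0))))) hp h0 (depVec k)
    have b := fderiv_apply_eq_zero Φ.open_source
      ((((hasFDerivAt_fibre 0 p).mul (hx 1 2)).add ((hasFDerivAt_fibre 1 p).mul (hx 2 2))).sub
      ((hy 1).mul (((hx 0 0).add ((hasFDerivAt_fibre 0 p).mul (hx 1 0))).add
        ((hasFDerivAt_fibre 1 p).mul (hx 2 0))))) hp h1 (depVec k)
    have hk0 : (0 : Fin 4) ≠ k := by rcases hk with rfl | rfl <;> decide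
    have hk1 : (1 : Fin 4) ≠ k := by rcases hk with rfl | rfl <;> decide
    simp [hz, hk0, hk1] at a b
    exact ⟨a.resolve_left hne, b.resolve_left hne⟩
  intro p hp
  exact ⟨eq_zero_of_generic hΦ (hc 0) (fun p hp hg => (key p hp hg).1) p hp,
    eq_zero_of_generic hΦ (hc 1) (fun p hp hg => (key p hp hg).2) p hp⟩

end Symmetry

/-- Here `R` and `S` hold the derivatives of the new dependent variables in the old independent and
dependent ones. The coefficients of u_x, u_y, v_x, v_y in the transformed momentum equations are
isolated by subtracting the case θ = 0. -/
theorem momentum_first {R : Fin 4 → Fin 3 → ℝ} {S : Fin 4 → Fin 4 → ℝ} {y : Dep}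
    {T₀ T₁ T₂ X₁ X₂ Y₁ Y₂ : ℝ}
    (hu : y 0 ≠ 0) (hv : y 1 ≠ 0) (hh : y 2 ≠ 0) (hT : T₀ ≠ 0)
    (hδ : T₀ + y 0 * T₁ + y 1 * T₂ ≠ 0) (h02 : S 0 2 = 0) (h12 : S 1 2 = 0)
    (h30 : S 3 0 = 0) (h31 : S 3 1 = 0) (h32 : S 3 2 = 0) (h22 : S 2 2 ≠ 0)
    (h : ∀ θ, let W := jetParam y θ
      let Z : Fin 4 → Fin 3 → ℝ := fun k j => R k j + (W 0 j * S k 0 + W 1 j * S k 1 +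
        W 2 j * S k 2 + W 3 j * S k 3)
      T₀ * (X₁ * (Z 0 0 + y 0 * Z 0 1 + y 1 * Z 0 2) + Y₁ * (Z 1 0 + y 0 * Z 1 1 + y 1 * Z 1 2)) +
        (T₀ + y 0 * T₁ + y 1 * T₂) * (T₀ * Z 2 1 - T₁ * Z 2 0 - T₀ * Z 3 1) = 0 ∧
      T₀ * (X₂ * (Z 0 0 + y 0 * Z 0 1 + y 1 * Z 0 2) + Y₂ * (Z 1 0 + y 0 * Z 1 1 + y 1 * Z 1 2)) +
        (T₀ + y 0 * T₁ + y 1 * T₂) * (T₀ * Z 2 2 - T₂ * Z 2 0 - T₀ * Z 3 2) = 0) :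
    S 2 0 = 0 ∧ S 2 1 = 0 ∧ T₁ = 0 ∧ T₂ = 0 := by
  obtain ⟨z1, z2⟩ := h 0
  obtain ⟨a1, a2⟩ := h (Pi.single 0 1)
  obtain ⟨b1, b2⟩ := h (Pi.single 1 1)
  obtain ⟨c1, c2⟩ := h (Pi.single 2 1)
  obtain ⟨d1, d2⟩ := h (Pi.single 3 1)
  simp [jetParam, h02, h12, h30, h31, h32] at z1 z2 a1 a2 b1 b2 c1 c2 d1 d2
  set δ := T₀ + y 0 * T₁ + y 1 * T₂
  have A1 : T₀ * S 2 0 + T₁ * (y 0 * S 2 0 + y 2 * S 2 2) = 0 := by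
    apply mul_left_cancel₀ hδ
    linear_combination a1 - z1
  have B1 : T₁ * S 2 0 = 0 := by
    apply mul_left_cancel₀ hδ
    apply mul_left_cancel₀ hv
    linear_combination b1 - z1
  have C2 : T₂ * S 2 1 = 0 := by
    apply mul_left_cancel₀ hδ
    apply mul_left_cancel₀ hu
    linear_combination c2 - z2
  have D2 : T₀ * S 2 1 + T₂ * (y 1 * S 2 1 + y 2 * S 2 2) = 0 := by
    apply mul_left_cancel₀ hδ
    linear_combination d2 - z2
  have s20 : S 2 0 = 0 := by
    by_contra hne
    have t1 := (mul_eq_zero.1 B1).resolve_right hne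
    rw [t1, zero_mul, add_zero] at A1
    exact (mul_ne_zero hT hne) A1
  have s21 : S 2 1 = 0 := by
    by_contra hne
    have t2 := (mul_eq_zero.1 C2).resolve_right hne
    rw [t2, zero_mul, add_zero] at D2
    exact (mul_ne_zero hT hne) D2
  rw [s20] at A1
  rw [s21] at D2
  refine ⟨s20, s21, ?_, ?_⟩
  · have : T₁ * (y 2 * S 2 2) = 0 := by linear_combination A1
    exact (mul_eq_zero.1 this).resolve_right (mul_ne_zero hh h22)
  · have : T₂ * (y 2 * S 2 2) = 0 := by linear_combination D2
    exact (mul_eq_zero.1 this).resolve_right (mul_ne_zero hh h22)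

/-- The coefficients of h_x, h_y and b_x in the momentum equations give conformality and the equal
scaling of h and b. Those of u_x and b_x in the continuity equation give H = h H_h and H_b = 0. The
case θ = 0 leaves two relations free of first derivatives. -/
theorem momentum_second {R : Fin 4 → Fin 3 → ℝ} {S : Fin 4 → Fin 4 → ℝ} {y : Dep}
    {T₀ X₁ X₂ Y₁ Y₂ H : ℝ}
    (hu : y 0 ≠ 0) (hT : T₀ ≠ 0) (hdet : X₁ * Y₂ - X₂ * Y₁ ≠ 0)
    (h00 : S 0 0 * T₀ = X₁) (h01 : S 0 1 * T₀ = X₂) (h10 : S 1 0 * T₀ = Y₁)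
    (h11 : S 1 1 * T₀ = Y₂) (h02 : S 0 2 = 0) (h12 : S 1 2 = 0) (h03 : S 0 3 = 0) (h13 : S 1 3 = 0)
    (h20 : S 2 0 = 0) (h21 : S 2 1 = 0)
    (h30 : S 3 0 = 0) (h31 : S 3 1 = 0) (h32 : S 3 2 = 0)
    (h : ∀ θ, let W := jetParam y θ
      let Z : Fin 4 → Fin 3 → ℝ := fun k j => R k j + (W 0 j * S k 0 + W 1 j * S k 1 +
        W 2 j * S k 2 + W 3 j * S k 3)
      T₀ * (X₁ * (Z 0 0 + y 0 * Z 0 1 + y 1 * Z 0 2) + Y₁ * (Z 1 0 + y 0 * Z 1 1 + y 1 * Z 1 2)) +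
        T₀ * (T₀ * Z 2 1 - T₀ * Z 3 1) = 0 ∧
      T₀ * (X₂ * (Z 0 0 + y 0 * Z 0 1 + y 1 * Z 0 2) + Y₂ * (Z 1 0 + y 0 * Z 1 1 + y 1 * Z 1 2)) +
        T₀ * (T₀ * Z 2 2 - T₀ * Z 3 2) = 0 ∧
      (X₁ * Y₂ - X₂ * Y₁) * (Z 2 0 + y 0 * Z 2 1 + y 1 * Z 2 2) +
        T₀ * H * (Y₂ * Z 0 1 - Y₁ * Z 0 2 + X₁ * Z 1 2 - X₂ * Z 1 1) = 0) :
    X₁ ^ 2 + Y₁ ^ 2 = T₀ ^ 2 * S 2 2 ∧ X₁ * X₂ + Y₁ * Y₂ = 0 ∧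
    X₂ ^ 2 + Y₂ ^ 2 = T₀ ^ 2 * S 2 2 ∧ S 2 3 = 0 ∧ S 3 3 = S 2 2 ∧ H = y 2 * S 2 2 ∧
    X₁ * (R 0 0 + y 0 * R 0 1 + y 1 * R 0 2) + Y₁ * (R 1 0 + y 0 * R 1 1 + y 1 * R 1 2) +
      T₀ * (R 2 1 - R 3 1) = 0 ∧
    X₂ * (R 0 0 + y 0 * R 0 1 + y 1 * R 0 2) + Y₂ * (R 1 0 + y 0 * R 1 1 + y 1 * R 1 2) +
      T₀ * (R 2 2 - R 3 2) = 0 := by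
  obtain ⟨z1, z2, z3⟩ := h 0
  obtain ⟨-, -, a3⟩ := h (Pi.single 0 1)
  obtain ⟨e1, e2, e3⟩ := h (Pi.single 4 1)
  obtain ⟨f1, f2, f3⟩ := h (Pi.single 5 1)
  obtain ⟨g1, g2, g3⟩ := h (Pi.single 6 1)
  simp [jetParam, h02, h12, h30, h31, h32, h03, h13, h20, h21] at z1 z2 z3 a3 e1 e2 e3 f1 f2 f3 g1 g2 g3
  have s23 : S 2 3 = 0 := by
    have : (X₁ * Y₂ - X₂ * Y₁) * (y 0 * S 2 3) = 0 := by linear_combination g3 - z3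
    exact (mul_eq_zero.1 ((mul_eq_zero.1 this).resolve_left hdet)).resolve_left hu
  rw [s23] at g1
  have E1 : X₁ ^ 2 + Y₁ ^ 2 = T₀ ^ 2 * S 2 2 := by
    linear_combination -(e1 - z1) - X₁ * h00 - Y₁ * h10
  have G1 : X₁ ^ 2 + Y₁ ^ 2 = T₀ ^ 2 * S 3 3 := by
    linear_combination (g1 - z1) - X₁ * h00 - Y₁ * h10
  refine ⟨E1, ?_, ?_, s23, ?_, ?_, ?_, ?_⟩
  · linear_combination -(f1 - z1) - X₁ * h01 - Y₁ * h11
  · linear_combination -(f2 - z2) - X₂ * h01 - Y₂ * h11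
  · apply mul_left_cancel₀ (pow_ne_zero 2 hT)
    linear_combination E1 - G1
  · apply mul_left_cancel₀ hdet
    linear_combination (a3 - z3) - H * Y₂ * h00 + H * X₂ * h10
  · apply mul_left_cancel₀ hT
    linear_combination z1
  · apply mul_left_cancel₀ hT
    linear_combination z2

/-! ### First-order relations for a symmetry -/

section Symmetry

variable {Φ : OpenPartialHomeomorph Total Total}

/-- No other new coordinate depends on h, so otherwise dΦ would annihilate ∂_h. -/
theorem dd_height_ne_zero (hΦ : IsLocalPointSymmetry Φ) {p : Total} (hp : p ∈ Φ.source) :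
    dd (depVec 2) (depPart Φ 2) p ≠ 0 := by
  intro h
  have := fderiv_eq_zero_of_dd hΦ hp (e := depVec 2) (fun i => dd_depVec_indepPart hΦ i 2 p hp)
    (fun k => by
      fin_cases k
      · exact (dd_velocity hΦ 2 (Or.inl rfl) p hp).1
      · exact (dd_velocity hΦ 2 (Or.inl rfl) p hp).2
      · exact h
      · exact (dd_depPart_three hΦ p hp).2.2.2)
  have h2 := congrFun (congrArg Prod.snd this) 2
  simp at h2

/-- The transformed time depends only on time, the transformed height does not depend on the
velocity. -/
theorem dd_time_height (hΦ : IsLocalPointSymmetry Φ) : ∀ p ∈ Φ.source,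
    dd (depVec 0) (depPart Φ 2) p = 0 ∧ dd (depVec 1) (depPart Φ 2) p = 0 ∧
    dd (indepVec 1) (indepPart Φ 0) p = 0 ∧ dd (indepVec 2) (indepPart Φ 0) p = 0 := by
  have key : ∀ p ∈ Φ.source, p ∈ genericSet Φ →
      dd (depVec 0) (depPart Φ 2) p = 0 ∧ dd (depVec 1) (depPart Φ 2) p = 0 ∧
      dd (indepVec 1) (indepPart Φ 0) p = 0 ∧ dd (indepVec 2) (indepPart Φ 0) p = 0 := by
    intro p hp hg
    obtain ⟨hT, -, hδ⟩ := transport_factor_ne_zero hΦ hp hg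
    obtain ⟨b1, b2, b3, b4⟩ := dd_depPart_three hΦ p hp
    obtain ⟨v1, v2⟩ := dd_velocity hΦ 2 (Or.inl rfl) p hp
    exact momentum_first (R := fun k j => dd (indepVec j) (depPart Φ k) p)
      (S := fun k m => dd (depVec m) (depPart Φ k) p) hg.1 hg.2.1 hg.2.2.1 hT hδ v1 v2 b2 b3 b4
      (dd_height_ne_zero hΦ hp)
      fun θ => ⟨((transformed_equations hΦ hp hg).2 θ).2.1,
        ((transformed_equations hΦ hp hg).2 θ).2.2.1⟩
  have c1 : ∀ e i, ContinuousOn (dd e (depPart Φ i)) Φ.source := fun e i =>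
    (contDiffOn_dd Φ.open_source (contDiffOn_depPart hΦ i) _).continuousOn
  have c2 : ∀ e i, ContinuousOn (dd e (indepPart Φ i)) Φ.source := fun e i =>
    (contDiffOn_dd Φ.open_source (contDiffOn_indepPart hΦ i) _).continuousOn
  intro p hp
  exact ⟨eq_zero_of_generic hΦ (c1 _ _) (fun p hp hg => (key p hp hg).1) p hp,
    eq_zero_of_generic hΦ (c1 _ _) (fun p hp hg => (key p hp hg).2.1) p hp,
    eq_zero_of_generic hΦ (c2 _ _) (fun p hp hg => (key p hp hg).2.2.1) p hp,
    eq_zero_of_generic hΦ (c2 _ _) (fun p hp hg => (key p hp hg).2.2.2) p hp⟩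

theorem velocity_mul (hΦ : IsLocalPointSymmetry Φ) : ∀ p ∈ Φ.source,
    p.2 0 * dd (indepVec 1) (indepPart Φ 1) p + p.2 1 * dd (indepVec 2) (indepPart Φ 1) p -
      depPart Φ 0 p * dd (indepVec 0) (indepPart Φ 0) p = 0 ∧
    p.2 0 * dd (indepVec 1) (indepPart Φ 2) p + p.2 1 * dd (indepVec 2) (indepPart Φ 2) p -
      depPart Φ 1 p * dd (indepVec 0) (indepPart Φ 0) p = 0 := by
  intro p hp
  obtain ⟨-, -, -, -, h1, h2⟩ := indepPart_relations hΦ hp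
  obtain ⟨-, -, h3, h4⟩ := dd_time_height hΦ p hp
  rw [h3, h4] at h1 h2
  constructor
  · linear_combination h1
  · linear_combination h2

/-- The derivative of the formula for the transformed velocity. -/
theorem dd_velocity_mul (hΦ : IsLocalPointSymmetry Φ) {p : Total} (hp : p ∈ Φ.source)
    (e : Total) :
    e.2 0 * dd (indepVec 1) (indepPart Φ 1) p + p.2 0 * dd e (dd (indepVec 1) (indepPart Φ 1)) p +
      (e.2 1 * dd (indepVec 2) (indepPart Φ 1) p +
        p.2 1 * dd e (dd (indepVec 2) (indepPart Φ 1)) p) =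
      dd e (depPart Φ 0) p * dd (indepVec 0) (indepPart Φ 0) p +
        depPart Φ 0 p * dd e (dd (indepVec 0) (indepPart Φ 0)) p ∧
    e.2 0 * dd (indepVec 1) (indepPart Φ 2) p + p.2 0 * dd e (dd (indepVec 1) (indepPart Φ 2)) p +
      (e.2 1 * dd (indepVec 2) (indepPart Φ 2) p +
        p.2 1 * dd e (dd (indepVec 2) (indepPart Φ 2)) p) =
      dd e (depPart Φ 1) p * dd (indepVec 0) (indepPart Φ 0) p +
        depPart Φ 1 p * dd e (dd (indepVec 0) (indepPart Φ 0)) p := by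
  have hx := fun j i => hasFDerivAt_dd_indepPart hΦ hp (indepVec j) i
  have hy := fun k => hasFDerivAt_depPart hΦ hp k
  have a := fderiv_apply_eq_zero Φ.open_source
    ((((hasFDerivAt_fibre 0 p).mul (hx 1 1)).add ((hasFDerivAt_fibre 1 p).mul (hx 2 1))).sub
      ((hy 0).mul (hx 0 0))) hp (fun q hq => (velocity_mul hΦ q hq).1) e
  have b := fderiv_apply_eq_zero Φ.open_source
    ((((hasFDerivAt_fibre 0 p).mul (hx 1 2)).add ((hasFDerivAt_fibre 1 p).mul (hx 2 2))).sub
      ((hy 1).mul (hx 0 0))) hp (fun q hq => (velocity_mul hΦ q hq).2) e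
  simp at a b
  constructor
  · simp only [dd] at a ⊢
    linear_combination a
  · simp only [dd] at b ⊢
    linear_combination b

/-- The relations between the first derivatives of a symmetry. -/
def DerivativeRelations (Φ : OpenPartialHomeomorph Total Total) (p : Total) : Prop :=
    dd (indepVec 1) (indepPart Φ 1) p ^ 2 + dd (indepVec 1) (indepPart Φ 2) p ^ 2 =
      dd (indepVec 0) (indepPart Φ 0) p ^ 2 * dd (depVec 2) (depPart Φ 2) p ∧
    dd (indepVec 1) (indepPart Φ 1) p * dd (indepVec 2) (indepPart Φ 1) p +
      dd (indepVec 1) (indepPart Φ 2) p * dd (indepVec 2) (indepPart Φ 2) p = 0 ∧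
    dd (indepVec 2) (indepPart Φ 1) p ^ 2 + dd (indepVec 2) (indepPart Φ 2) p ^ 2 =
      dd (indepVec 0) (indepPart Φ 0) p ^ 2 * dd (depVec 2) (depPart Φ 2) p ∧
    dd (depVec 3) (depPart Φ 2) p = 0 ∧
    dd (depVec 3) (depPart Φ 3) p = dd (depVec 2) (depPart Φ 2) p ∧
    depPart Φ 2 p = p.2 2 * dd (depVec 2) (depPart Φ 2) p ∧
    dd (indepVec 1) (indepPart Φ 1) p * (dd (indepVec 0) (depPart Φ 0) p +
      p.2 0 * dd (indepVec 1) (depPart Φ 0) p + p.2 1 * dd (indepVec 2) (depPart Φ 0) p) +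
      dd (indepVec 1) (indepPart Φ 2) p * (dd (indepVec 0) (depPart Φ 1) p +
      p.2 0 * dd (indepVec 1) (depPart Φ 1) p + p.2 1 * dd (indepVec 2) (depPart Φ 1) p) +
      dd (indepVec 0) (indepPart Φ 0) p *
        (dd (indepVec 1) (depPart Φ 2) p - dd (indepVec 1) (depPart Φ 3) p) = 0 ∧
    dd (indepVec 2) (indepPart Φ 1) p * (dd (indepVec 0) (depPart Φ 0) p +
      p.2 0 * dd (indepVec 1) (depPart Φ 0) p + p.2 1 * dd (indepVec 2) (depPart Φ 0) p) +
      dd (indepVec 2) (indepPart Φ 2) p * (dd (indepVec 0) (depPart Φ 1) p +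
      p.2 0 * dd (indepVec 1) (depPart Φ 1) p + p.2 1 * dd (indepVec 2) (depPart Φ 1) p) +
      dd (indepVec 0) (indepPart Φ 0) p *
        (dd (indepVec 2) (depPart Φ 2) p - dd (indepVec 2) (depPart Φ 3) p) = 0

theorem derivativeRelations (hΦ : IsLocalPointSymmetry Φ) {p : Total} (hp : p ∈ Φ.source) :
    DerivativeRelations Φ p := by
  have c1 : ∀ e i, ContinuousOn (dd e (depPart Φ i)) Φ.source := fun e i =>
    (contDiffOn_dd Φ.open_source (contDiffOn_depPart hΦ i) _).continuousOn
  have c2 : ∀ e i, ContinuousOn (dd e (indepPart Φ i)) Φ.source := fun e i =>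
    (contDiffOn_dd Φ.open_source (contDiffOn_indepPart hΦ i) _).continuousOn
  have c3 : ∀ i, ContinuousOn (depPart Φ i) Φ.source := fun i =>
    (contDiffOn_depPart hΦ i).continuousOn
  have key : ∀ p ∈ Φ.source, p ∈ genericSet Φ → DerivativeRelations Φ p := by
    intro p hp hg
    obtain ⟨hT, hdet, -⟩ := transport_factor_ne_zero hΦ hp hg
    obtain ⟨b1, b2, b3, b4⟩ := dd_depPart_three hΦ p hp
    obtain ⟨v1, v2⟩ := dd_velocity hΦ 2 (Or.inl rfl) p hp
    obtain ⟨v3, v4⟩ := dd_velocity hΦ 3 (Or.inr rfl) p hp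
    obtain ⟨w1, w2, w3, w4⟩ := dd_time_height hΦ p hp
    have hz : ∀ e i k, dd (depVec k) (dd e (indepPart Φ i)) p = 0 := fun e i k =>
      fderiv_dd_indepPart_depVec hΦ hp e i k
    have m0 := dd_velocity_mul hΦ hp (depVec 0)
    have m1 := dd_velocity_mul hΦ hp (depVec 1)
    simp [hz] at m0 m1
    exact momentum_second (R := fun k j => dd (indepVec j) (depPart Φ k) p)
      (S := fun k m => dd (depVec m) (depPart Φ k) p) (H := depPart Φ 2 p)
      (Y₂ := dd (indepVec 2) (indepPart Φ 2) p)
      hg.1 hT hdet m0.1.symm m1.1.symm m0.2.symm m1.2.symm v1 v2 v3 v4 w1 w2 b2 b3 b4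
      fun θ => by
        have h := (transformed_equations hΦ hp hg).2 θ
        simp only [w3, w4, mul_zero, add_zero, zero_mul, sub_zero, forall_const] at h
        exact h.2
  refine ⟨?_, ?_, ?_, ?_, ?_, ?_, ?_, ?_⟩
  · exact sub_eq_zero.1 (eq_zero_of_generic hΦ (by fun_prop)
      (fun p hp hg => sub_eq_zero.2 (key p hp hg).1) p hp)
  · exact eq_zero_of_generic hΦ (by fun_prop) (fun p hp hg => (key p hp hg).2.1) p hp
  · exact sub_eq_zero.1 (eq_zero_of_generic hΦ (by fun_prop)
      (fun p hp hg => sub_eq_zero.2 (key p hp hg).2.2.1) p hp)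
  · exact eq_zero_of_generic hΦ (by fun_prop) (fun p hp hg => (key p hp hg).2.2.2.1) p hp
  · exact sub_eq_zero.1 (eq_zero_of_generic hΦ (by fun_prop)
      (fun p hp hg => sub_eq_zero.2 (key p hp hg).2.2.2.2.1) p hp)
  · exact sub_eq_zero.1 (eq_zero_of_generic hΦ (by fun_prop)
      (fun p hp hg => sub_eq_zero.2 (key p hp hg).2.2.2.2.2.1) p hp)
  · exact eq_zero_of_generic hΦ (by fun_prop) (fun p hp hg => (key p hp hg).2.2.2.2.2.2.1) p hp
  · exact eq_zero_of_generic hΦ (by fun_prop) (fun p hp hg => (key p hp hg).2.2.2.2.2.2.2) p hp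

end Symmetry

/-! ### Vanishing of second derivatives and the explicit form -/

/-- A smooth function that is invariant under the translations along `e`. -/
structure IsInvariant (U : Set Total) (e : Total) (f : Total → ℝ) : Prop where
  contDiffOn : ContDiffOn ℝ ∞ f U
  dd_eq_zero : ∀ p ∈ U, dd e f p = 0

namespace IsInvariant

variable {U : Set Total} {e : Total} {f g : Total → ℝ}

theorem add (hU : IsOpen U) (hf : IsInvariant U e f) (hg : IsInvariant U e g) :
    IsInvariant U e (fun p => f p + g p) := by
  refine ⟨hf.1.add hg.1, fun p hp => ?_⟩
  have h := (hasFDerivAt_of_contDiffOn hU hf.1 hp).add (hasFDerivAt_of_contDiffOn hU hg.1 hp)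
  have h' : HasFDerivAt (fun p => f p + g p) _ p := h
  have h1 := hf.2 p hp
  have h2 := hg.2 p hp
  unfold dd at h1 h2 ⊢
  rw [h'.fderiv]
  simp [h1, h2]

theorem sub (hU : IsOpen U) (hf : IsInvariant U e f) (hg : IsInvariant U e g) :
    IsInvariant U e (fun p => f p - g p) := by
  refine ⟨hf.1.sub hg.1, fun p hp => ?_⟩
  have h := (hasFDerivAt_of_contDiffOn hU hf.1 hp).sub (hasFDerivAt_of_contDiffOn hU hg.1 hp)
  have h' : HasFDerivAt (fun p => f p - g p) _ p := h
  have h1 := hf.2 p hp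
  have h2 := hg.2 p hp
  unfold dd at h1 h2 ⊢
  rw [h'.fderiv]
  simp [h1, h2]

theorem mul (hU : IsOpen U) (hf : IsInvariant U e f) (hg : IsInvariant U e g) :
    IsInvariant U e (fun p => f p * g p) := by
  refine ⟨hf.1.mul hg.1, fun p hp => ?_⟩
  have h := (hasFDerivAt_of_contDiffOn hU hf.1 hp).mul (hasFDerivAt_of_contDiffOn hU hg.1 hp)
  have h' : HasFDerivAt (fun p => f p * g p) _ p := h
  have h1 := hf.2 p hp
  have h2 := hg.2 p hp
  unfold dd at h1 h2 ⊢
  rw [h'.fderiv]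
  simp [h1, h2]

theorem dd (hU : IsOpen U) (hf : IsInvariant U e f) (e' : Total) :
    IsInvariant U e (ShallowWater.dd e' f) :=
  ⟨contDiffOn_dd hU hf.1 e', dd_dd_eq_zero hU hf.1 hf.2 e'⟩

end IsInvariant

/-- A polynomial in the velocity with coefficients not depending on the velocity. -/
theorem quadratic_coeffs_eq_zero {U : Set Total} (hU : IsOpen U) {q₁ q₂ q₃ c : Total → ℝ}
    (h₁ : IsInvariant U (depVec 0) q₁) (h₂ : IsInvariant U (depVec 0) q₂)
    (h₃ : IsInvariant U (depVec 0) q₃) (h₄ : IsInvariant U (depVec 0) c)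
    (k₁ : IsInvariant U (depVec 1) q₁) (k₂ : IsInvariant U (depVec 1) q₂)
    (k₃ : IsInvariant U (depVec 1) q₃) (k₄ : IsInvariant U (depVec 1) c)
    (h : ∀ p ∈ U, p.2 0 * (p.2 0 * q₁ p + p.2 1 * q₂ p) +
      p.2 1 * (p.2 0 * q₂ p + p.2 1 * q₃ p) + c p = 0) :
    ∀ p ∈ U, q₁ p = 0 ∧ q₂ p = 0 ∧ q₃ p = 0 ∧ c p = 0 := by
  have hd : ∀ {f : Total → ℝ} {e : Total}, IsInvariant U e f → ∀ p ∈ U,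
      HasFDerivAt f (fderiv ℝ f p) p ∧ fderiv ℝ f p e = 0 := fun hf p hp =>
    ⟨hasFDerivAt_of_contDiffOn hU hf.1 hp, hf.2 p hp⟩
  have x := fun p => hasFDerivAt_fibre 0 p
  have y := fun p => hasFDerivAt_fibre 1 p
  have e0 : ∀ p ∈ U, p.2 0 * q₁ p + p.2 1 * q₂ p = 0 := by
    intro p hp
    have := fderiv_apply_eq_zero hU ((((x p).mul (((x p).mul (hd h₁ p hp).1).add
      ((y p).mul (hd h₂ p hp).1))).add ((y p).mul (((x p).mul (hd h₂ p hp).1).add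
      ((y p).mul (hd h₃ p hp).1)))).add (hd h₄ p hp).1) hp h (depVec 0)
    simp [(hd h₁ p hp).2, (hd h₂ p hp).2, (hd h₃ p hp).2, (hd h₄ p hp).2] at this
    linarith
  have e1 : ∀ p ∈ U, p.2 0 * q₂ p + p.2 1 * q₃ p = 0 := by
    intro p hp
    have := fderiv_apply_eq_zero hU ((((x p).mul (((x p).mul (hd k₁ p hp).1).add
      ((y p).mul (hd k₂ p hp).1))).add ((y p).mul (((x p).mul (hd k₂ p hp).1).add
      ((y p).mul (hd k₃ p hp).1)))).add (hd k₄ p hp).1) hp h (depVec 1)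
    simp [(hd k₁ p hp).2, (hd k₂ p hp).2, (hd k₃ p hp).2, (hd k₄ p hp).2] at this
    linarith
  intro p hp
  have f0 : q₁ p = 0 := by
    have := fderiv_apply_eq_zero hU (((x p).mul (hd h₁ p hp).1).add
      ((y p).mul (hd h₂ p hp).1)) hp e0 (depVec 0)
    simpa [(hd h₁ p hp).2, (hd h₂ p hp).2] using this
  have f1 : q₂ p = 0 := by
    have := fderiv_apply_eq_zero hU (((x p).mul (hd k₁ p hp).1).add
      ((y p).mul (hd k₂ p hp).1)) hp e0 (depVec 1)
    simpa [(hd k₁ p hp).2, (hd k₂ p hp).2] using this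
  have f2 : q₃ p = 0 := by
    have := fderiv_apply_eq_zero hU (((x p).mul (hd k₂ p hp).1).add
      ((y p).mul (hd k₃ p hp).1)) hp e1 (depVec 1)
    simpa [(hd k₂ p hp).2, (hd k₃ p hp).2] using this
  refine ⟨f0, f1, f2, ?_⟩
  have := h p hp
  rw [f0, f1, f2] at this
  linarith

section Symmetry

variable {Φ : OpenPartialHomeomorph Total Total}

theorem isInvariant_indepPart (hΦ : IsLocalPointSymmetry Φ) (i : Fin 3) (k : Fin 4) :
    IsInvariant Φ.source (depVec k) (indepPart Φ i) :=
  ⟨contDiffOn_indepPart hΦ i, dd_depVec_indepPart hΦ i k⟩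

/-- The transformation of time is affine. -/
theorem fderiv_time_eq_zero (hΦ : IsLocalPointSymmetry Φ) :
    ∀ p ∈ Φ.source, fderiv ℝ (dd (indepVec 0) (indepPart Φ 0)) p = 0 := by
  have hT : ∀ p ∈ Φ.source, dd (indepVec 0) (dd (indepVec 0) (indepPart Φ 0)) p = 0 := by
    refine eq_zero_of_generic hΦ (contDiffOn_dd Φ.open_source (contDiffOn_dd Φ.open_source
      (contDiffOn_indepPart hΦ 0) _) _).continuousOn fun p hp hg => ?_
    have hx := fun j i => hasFDerivAt_dd_indepPart hΦ hp (indepVec j) i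
    have hb := hasFDerivAt_dd_depPart hΦ hp (depVec 3) 3
    have hbt : fderiv ℝ (dd (depVec 3) (depPart Φ 3)) p (indepVec 0) = 0 :=
      dd_dd_eq_zero Φ.open_source (contDiffOn_depPart hΦ 3)
        (fun q hq => (dd_depPart_three hΦ q hq).1) _ p hp
    have ht := fun e => fderiv_dd_indepPart_time hΦ hp e
    have hne := dd_height_ne_zero hΦ hp
    obtain ⟨-, -, -, -, h5, -⟩ := derivativeRelations hΦ hp
    -- Differentiate X_x² + Y_x² = T_t² B_b in t, where B is the new b. Neither the left side nor
    -- B_b depends on t, so 2 T_t T_tt B_b = 0. Replacing H_h by B_b is what makes the t-dependence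
    -- visible.
    have key := fderiv_apply_eq_zero Φ.open_source
      ((((hx 1 1).mul (hx 1 1)).add ((hx 1 2).mul (hx 1 2))).sub
        (((hx 0 0).mul (hx 0 0)).mul hb)) hp (fun q hq => by
          obtain ⟨h1, -, -, -, h5, -⟩ := derivativeRelations hΦ hq
          have : dd (indepVec 1) (indepPart Φ 1) q * dd (indepVec 1) (indepPart Φ 1) q +
            dd (indepVec 1) (indepPart Φ 2) q * dd (indepVec 1) (indepPart Φ 2) q -
            dd (indepVec 0) (indepPart Φ 0) q * dd (indepVec 0) (indepPart Φ 0) q *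
              dd (depVec 3) (depPart Φ 3) q = 0 := by
            rw [h5]
            linear_combination h1
          exact this) (indepVec 0)
    simp [(ht _).1, (ht _).2, hbt, h5, hne] at key
    exact key.resolve_left (transport_factor_ne_zero hΦ hp hg).1
  intro p hp
  refine clm_eq_zero (fun j => ?_) fun k => fderiv_dd_indepPart_depVec hΦ hp _ 0 k
  fin_cases j
  · exact hT p hp
  · exact dd_dd_eq_zero Φ.open_source (contDiffOn_indepPart hΦ 0)
      (fun q hq => (dd_time_height hΦ q hq).2.2.1) _ p hp
  · exact dd_dd_eq_zero Φ.open_source (contDiffOn_indepPart hΦ 0)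
      (fun q hq => (dd_time_height hΦ q hq).2.2.2) _ p hp

/-- The derivatives of the momentum equations with respect to the velocity. -/
theorem second_derivative_relations (hΦ : IsLocalPointSymmetry Φ) (j : Fin 3)
    (hj : j = 1 ∨ j = 2) : ∀ p ∈ Φ.source,
    dd (indepVec j) (indepPart Φ 1) p * dd (indepVec 1) (dd (indepVec 1) (indepPart Φ 1)) p +
      dd (indepVec j) (indepPart Φ 2) p * dd (indepVec 1) (dd (indepVec 1) (indepPart Φ 2)) p = 0 ∧
    dd (indepVec j) (indepPart Φ 1) p * dd (indepVec 1) (dd (indepVec 2) (indepPart Φ 1)) p +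
      dd (indepVec j) (indepPart Φ 2) p * dd (indepVec 1) (dd (indepVec 2) (indepPart Φ 2)) p = 0 ∧
    dd (indepVec j) (indepPart Φ 1) p * dd (indepVec 2) (dd (indepVec 2) (indepPart Φ 1)) p +
      dd (indepVec j) (indepPart Φ 2) p * dd (indepVec 2) (dd (indepVec 2) (indepPart Φ 2)) p = 0 ∧
    dd (indepVec 0) (indepPart Φ 0) p * dd (indepVec 0) (indepPart Φ 0) p *
      (dd (indepVec j) (depPart Φ 2) p - dd (indepVec j) (depPart Φ 3) p) = 0 := by
  have ho := Φ.open_source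
  have hi := fun i k => isInvariant_indepPart hΦ i k
  have hq : ∀ k a b, IsInvariant Φ.source (depVec k) fun p =>
      dd (indepVec j) (indepPart Φ 1) p * dd (indepVec a) (dd (indepVec b) (indepPart Φ 1)) p +
      dd (indepVec j) (indepPart Φ 2) p * dd (indepVec a) (dd (indepVec b) (indepPart Φ 2)) p :=
    fun k a b => (((hi 1 k).dd ho _).mul ho (((hi 1 k).dd ho _).dd ho _)).add ho
      (((hi 2 k).dd ho _).mul ho (((hi 2 k).dd ho _).dd ho _))
  have hH0 : IsInvariant Φ.source (depVec 0) (depPart Φ 2) :=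
    ⟨contDiffOn_depPart hΦ 2, fun p hp => (dd_time_height hΦ p hp).1⟩
  have hH1 : IsInvariant Φ.source (depVec 1) (depPart Φ 2) :=
    ⟨contDiffOn_depPart hΦ 2, fun p hp => (dd_time_height hΦ p hp).2.1⟩
  have hB0 : IsInvariant Φ.source (depVec 0) (depPart Φ 3) :=
    ⟨contDiffOn_depPart hΦ 3, fun p hp => (dd_depPart_three hΦ p hp).2.1⟩
  have hB1 : IsInvariant Φ.source (depVec 1) (depPart Φ 3) :=
    ⟨contDiffOn_depPart hΦ 3, fun p hp => (dd_depPart_three hΦ p hp).2.2.1⟩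
  refine quadratic_coeffs_eq_zero ho (hq 0 1 1) (hq 0 1 2) (hq 0 2 2)
    ((((hi 0 0).dd ho _).mul ho ((hi 0 0).dd ho _)).mul ho ((hH0.dd ho _).sub ho (hB0.dd ho _)))
    (hq 1 1 1) (hq 1 1 2) (hq 1 2 2)
    ((((hi 0 1).dd ho _).mul ho ((hi 0 1).dd ho _)).mul ho ((hH1.dd ho _).sub ho (hB1.dd ho _))) ?_
  intro p hp
  have hT : ∀ e, dd e (dd (indepVec 0) (indepPart Φ 0)) p = 0 := fun e => by
    have := fderiv_time_eq_zero hΦ p hp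
    simp [dd] at this ⊢
    rw [this]
    rfl
  have m0 := dd_velocity_mul hΦ hp (indepVec 0)
  have m1 := dd_velocity_mul hΦ hp (indepVec 1)
  have m2 := dd_velocity_mul hΦ hp (indepVec 2)
  have ht : ∀ e, dd (indepVec 0) (dd e (indepPart Φ 1)) p = 0 ∧
    dd (indepVec 0) (dd e (indepPart Φ 2)) p = 0 := fun e => fderiv_dd_indepPart_time hΦ hp e
  have hc : ∀ i, dd (indepVec 2) (dd (indepVec 1) (indepPart Φ i)) p =
      dd (indepVec 1) (dd (indepVec 2) (indepPart Φ i)) p := fun i =>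
    dd_comm ho (contDiffOn_indepPart hΦ i) hp _ _
  simp only [indepVec_snd, Pi.zero_apply, zero_mul, zero_add, hT, (ht _).1, (ht _).2, mul_zero,
    add_zero, hc] at m0 m1 m2
  obtain ⟨-, -, -, -, -, -, h7, h8⟩ := derivativeRelations hΦ hp
  -- The relation free of first derivatives is multiplied by T_t, and the differentiated velocity
  -- formula replaces T_t U_x and the like by second derivatives of X and Y. The outcome is a
  -- quadratic polynomial in (u, v).
  rcases hj with rfl | rfl
  · linear_combination dd (indepVec 0) (indepPart Φ 0) p * h7 +
      dd (indepVec 1) (indepPart Φ 1) p * (m0.1 + p.2 0 * m1.1 + p.2 1 * m2.1) +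
      dd (indepVec 1) (indepPart Φ 2) p * (m0.2 + p.2 0 * m1.2 + p.2 1 * m2.2)
  · linear_combination dd (indepVec 0) (indepPart Φ 0) p * h8 +
      dd (indepVec 2) (indepPart Φ 1) p * (m0.1 + p.2 0 * m1.1 + p.2 1 * m2.1) +
      dd (indepVec 2) (indepPart Φ 2) p * (m0.2 + p.2 0 * m1.2 + p.2 1 * m2.2)

/-- The transformation of the spatial coordinates is affine. -/
theorem fderiv_space_eq_zero (hΦ : IsLocalPointSymmetry Φ) (j : Fin 3) (hj : j = 1 ∨ j = 2)
    (i : Fin 3) (hi : i = 1 ∨ i = 2) :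
    ∀ p ∈ Φ.source, fderiv ℝ (dd (indepVec j) (indepPart Φ i)) p = 0 := by
  have key : ∀ a b, (a = 1 ∧ b = 1) ∨ (a = 1 ∧ b = 2) ∨ (a = 2 ∧ b = 2) → ∀ p ∈ Φ.source,
      dd (indepVec a) (dd (indepVec b) (indepPart Φ i)) p = 0 := by
    intro a b hab
    refine eq_zero_of_generic hΦ (contDiffOn_dd Φ.open_source (contDiffOn_dd Φ.open_source
      (contDiffOn_indepPart hΦ i) _) _).continuousOn fun p hp hg => ?_
    have hdet := (transport_factor_ne_zero hΦ hp hg).2.1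
    have s1 := second_derivative_relations hΦ 1 (Or.inl rfl) p hp
    have s2 := second_derivative_relations hΦ 2 (Or.inr rfl) p hp
    have e1 : dd (indepVec 1) (indepPart Φ 1) p * dd (indepVec a) (dd (indepVec b) (indepPart Φ 1)) p +
      dd (indepVec 1) (indepPart Φ 2) p * dd (indepVec a) (dd (indepVec b) (indepPart Φ 2)) p = 0 := by
      rcases hab with ⟨rfl, rfl⟩ | ⟨rfl, rfl⟩ | ⟨rfl, rfl⟩
      exacts [s1.1, s1.2.1, s1.2.2.1]
    have e2 : dd (indepVec 2) (indepPart Φ 1) p * dd (indepVec a) (dd (indepVec b) (indepPart Φ 1)) p +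
      dd (indepVec 2) (indepPart Φ 2) p * dd (indepVec a) (dd (indepVec b) (indepPart Φ 2)) p = 0 := by
      rcases hab with ⟨rfl, rfl⟩ | ⟨rfl, rfl⟩ | ⟨rfl, rfl⟩
      exacts [s2.1, s2.2.1, s2.2.2.1]
    -- For fixed a and b, the second derivatives of X and Y solve a homogeneous 2 × 2 linear system
    -- whose determinant is the nonzero Jacobian of the planar map.
    apply mul_left_cancel₀ hdet
    rcases hi with rfl | rfl
    · linear_combination dd (indepVec 2) (indepPart Φ 2) p * e1 -
        dd (indepVec 1) (indepPart Φ 2) p * e2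
    · linear_combination dd (indepVec 1) (indepPart Φ 1) p * e2 -
        dd (indepVec 2) (indepPart Φ 1) p * e1
  intro p hp
  refine clm_eq_zero (fun a => ?_) fun k => fderiv_dd_indepPart_depVec hΦ hp _ i k
  have hc : dd (indepVec 2) (dd (indepVec 1) (indepPart Φ i)) p = 0 := by
    rw [dd_comm Φ.open_source (contDiffOn_indepPart hΦ i) hp]
    exact key 1 2 (by simp) p hp
  have ht : fderiv ℝ (dd (indepVec j) (indepPart Φ i)) p (indepVec 0) = 0 := by
    rcases hi with rfl | rfl
    · exact (fderiv_dd_indepPart_time hΦ hp _).1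
    · exact (fderiv_dd_indepPart_time hΦ hp _).2
  fin_cases a
  · exact ht
  · rcases hj with rfl | rfl
    · exact key 1 1 (by simp) p hp
    · exact key 1 2 (by simp) p hp
  · rcases hj with rfl | rfl
    · exact hc
    · exact key 2 2 (by simp) p hp

theorem exists_eq_const {U : Set Total} (hU : IsOpen U) (hconn : IsPreconnected U)
    {f : Total → ℝ} (hf : ContDiffOn ℝ ∞ f U) (h : ∀ p ∈ U, fderiv ℝ f p = 0) :
    ∃ c, ∀ p ∈ U, f p = c :=
  hU.exists_is_const_of_fderiv_eq_zero hconn (hf.differentiableOn (by simp)) h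

/-- A function with constant partial derivatives is affine. -/
theorem exists_eq_affine {U : Set Total} (hU : IsOpen U) (hconn : IsPreconnected U)
    {f : Total → ℝ} (hf : ContDiffOn ℝ ∞ f U) {r : Fin 3 → ℝ} {s : Fin 4 → ℝ}
    (hr : ∀ p ∈ U, ∀ j, dd (indepVec j) f p = r j) (hs : ∀ p ∈ U, ∀ k, dd (depVec k) f p = s k) :
    ∃ c, ∀ p ∈ U, f p = ∑ j, r j * p.1 j + ∑ k, s k * p.2 k + c := by
  set ℓ : Total →L[ℝ] ℝ :=
    (∑ j, r j • (ContinuousLinearMap.proj (R := ℝ) (φ := fun _ : Fin 3 => ℝ) j)).comp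
      (ContinuousLinearMap.fst ℝ Indep Dep) +
    (∑ k, s k • (ContinuousLinearMap.proj (R := ℝ) (φ := fun _ : Fin 4 => ℝ) k)).comp
      (ContinuousLinearMap.snd ℝ Indep Dep) with hℓ
  have hℓa : ∀ p, ℓ p = ∑ j, r j * p.1 j + ∑ k, s k * p.2 k := fun p => by
    simp [hℓ]
  have hd : ∀ p ∈ U, HasFDerivAt (fun q => f q - ℓ q) (fderiv ℝ f p - ℓ) p := fun p hp =>
    (hasFDerivAt_of_contDiffOn hU hf hp).sub ℓ.hasFDerivAt
  obtain ⟨c, hc⟩ := hU.exists_is_const_of_fderiv_eq_zero hconn (f := fun q => f q - ℓ q)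
    (fun p hp => (hd p hp).differentiableAt.differentiableWithinAt) (fun p hp => by
      rw [(hd p hp).fderiv]
      refine clm_eq_zero (fun j => ?_) fun k => ?_
      · have := hr p hp j
        unfold dd at this
        simp [this, hℓa]
      · have := hs p hp k
        unfold dd at this
        simp [this, hℓa])
  refine ⟨c, fun p hp => ?_⟩
  have := hc p hp
  simp only [hℓa] at this
  linarith

/-- The point symmetries with connected domain. -/
theorem exists_eq_model (hΦ : IsLocalPointSymmetry Φ) (hconn : IsConnected Φ.source) :
    ∃ (τ x₁ x₂ y₁ y₂ κ : ℝ) (c : Fin 4 → ℝ), τ ≠ 0 ∧ κ ≠ 0 ∧ x₁ ^ 2 + y₁ ^ 2 = τ ^ 2 * κ ∧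
      x₂ ^ 2 + y₂ ^ 2 = τ ^ 2 * κ ∧ x₁ * x₂ + y₁ * y₂ = 0 ∧
      ∀ p ∈ Φ.source, Φ p = (![τ * p.1 0 + c 0, x₁ * p.1 1 + x₂ * p.1 2 + c 1,
        y₁ * p.1 1 + y₂ * p.1 2 + c 2], ![(x₁ * p.2 0 + x₂ * p.2 1) / τ,
        (y₁ * p.2 0 + y₂ * p.2 1) / τ, κ * p.2 2, κ * p.2 3 + c 3]) := by
  have ho := Φ.open_source
  have hpc := hconn.isPreconnected
  have hsm : ∀ e i, ContDiffOn ℝ ∞ (dd e (indepPart Φ i)) Φ.source := fun e i =>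
    contDiffOn_dd ho (contDiffOn_indepPart hΦ i) e
  obtain ⟨τ, hτ⟩ := exists_eq_const ho hpc (hsm _ _) (fderiv_time_eq_zero hΦ)
  obtain ⟨x₁, hx₁⟩ := exists_eq_const ho hpc (hsm _ _)
    (fderiv_space_eq_zero hΦ 1 (Or.inl rfl) 1 (Or.inl rfl))
  obtain ⟨x₂, hx₂⟩ := exists_eq_const ho hpc (hsm _ _)
    (fderiv_space_eq_zero hΦ 2 (Or.inr rfl) 1 (Or.inl rfl))
  obtain ⟨y₁, hy₁⟩ := exists_eq_const ho hpc (hsm _ _)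
    (fderiv_space_eq_zero hΦ 1 (Or.inl rfl) 2 (Or.inr rfl))
  obtain ⟨y₂, hy₂⟩ := exists_eq_const ho hpc (hsm _ _)
    (fderiv_space_eq_zero hΦ 2 (Or.inr rfl) 2 (Or.inr rfl))
  obtain ⟨p₀, hp₀, hg₀⟩ := genericSet_dense hΦ Φ.source ho hconn.nonempty le_rfl
  have hτ0 : τ ≠ 0 := by rw [← hτ p₀ hp₀]; exact (transport_factor_ne_zero hΦ hp₀ hg₀).1
  have hrel := fun p (hp : p ∈ Φ.source) => derivativeRelations hΦ hp
  simp only [DerivativeRelations] at hrel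
  set κ := (x₁ ^ 2 + y₁ ^ 2) / τ ^ 2 with hκ
  have hκp : ∀ p ∈ Φ.source, dd (depVec 2) (depPart Φ 2) p = κ := by
    intro p hp
    have := (hrel p hp).1
    rw [hx₁ p hp, hy₁ p hp, hτ p hp] at this
    rw [hκ, this]
    field_simp
  have hκ0 : κ ≠ 0 := by rw [← hκp p₀ hp₀]; exact dd_height_ne_zero hΦ hp₀
  have hH : ∀ p ∈ Φ.source, depPart Φ 2 p = κ * p.2 2 := by
    intro p hp
    rw [(hrel p hp).2.2.2.2.2.1, hκp p hp]
    ring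
  -- H = κh excludes translations of h. With the equality of the spatial gradients of the new h and
  -- b, this leaves only a constant to be added to b.
  have hHx : ∀ p ∈ Φ.source, ∀ j, dd (indepVec j) (depPart Φ 2) p = 0 := by
    intro p hp j
    have := fderiv_apply_eq_zero ho ((hasFDerivAt_depPart hΦ hp 2).sub
      ((hasFDerivAt_fibre 2 p).const_mul κ)) hp (fun q hq => sub_eq_zero.2 (hH q hq)) (indepVec j)
    simp at this
    exact this
  have hBx : ∀ p ∈ Φ.source, ∀ j, dd (indepVec j) (depPart Φ 3) p = 0 := by
    intro p hp j
    have aux : j = 1 ∨ j = 2 → dd (indepVec j) (depPart Φ 3) p = 0 := by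
      intro hj
      have := (second_derivative_relations hΦ j hj p hp).2.2.2
      rw [hτ p hp, hHx p hp] at this
      simpa [hτ0] using this
    fin_cases j
    · exact (dd_depPart_three hΦ p hp).1
    · exact aux (Or.inl rfl)
    · exact aux (Or.inr rfl)
  obtain ⟨c₀, hc₀⟩ := exists_eq_affine ho hpc (contDiffOn_indepPart hΦ 0) (r := ![τ, 0, 0]) (s := 0)
    (fun p hp j => by
      fin_cases j
      · exact hτ p hp
      · exact (dd_time_height hΦ p hp).2.2.1
      · exact (dd_time_height hΦ p hp).2.2.2) (fun p hp k => dd_depVec_indepPart hΦ 0 k p hp)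
  obtain ⟨c₁, hc₁⟩ := exists_eq_affine ho hpc (contDiffOn_indepPart hΦ 1) (r := ![0, x₁, x₂])
    (s := 0)
    (fun p hp j => by
      fin_cases j
      · exact (indepPart_relations hΦ hp).1
      · exact hx₁ p hp
      · exact hx₂ p hp) (fun p hp k => dd_depVec_indepPart hΦ 1 k p hp)
  obtain ⟨c₂, hc₂⟩ := exists_eq_affine ho hpc (contDiffOn_indepPart hΦ 2) (r := ![0, y₁, y₂])
    (s := 0)
    (fun p hp j => by
      fin_cases j
      · exact (indepPart_relations hΦ hp).2.1
      · exact hy₁ p hp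
      · exact hy₂ p hp) (fun p hp k => dd_depVec_indepPart hΦ 2 k p hp)
  obtain ⟨c₃, hc₃⟩ := exists_eq_affine ho hpc (contDiffOn_depPart hΦ 3) (r := 0)
    (s := ![0, 0, 0, κ]) hBx (fun p hp k => by
      obtain ⟨-, b1, b2, b3⟩ := dd_depPart_three hΦ p hp
      fin_cases k
      · exact b1
      · exact b2
      · exact b3
      · exact (hrel p hp).2.2.2.2.1.trans (hκp p hp))
  have hr0 := hrel p₀ hp₀
  rw [hx₁ p₀ hp₀, hx₂ p₀ hp₀, hy₁ p₀ hp₀, hy₂ p₀ hp₀, hτ p₀ hp₀, hκp p₀ hp₀] at hr0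
  refine ⟨τ, x₁, x₂, y₁, y₂, κ, ![c₀, c₁, c₂, c₃], hτ0, hκ0, hr0.1, hr0.2.2.1, hr0.2.1, ?_⟩
  intro p hp
  have hv := velocity_mul hΦ p hp
  rw [hx₁ p hp, hx₂ p hp, hy₁ p hp, hy₂ p hp, hτ p hp] at hv
  refine Prod.ext ?_ ?_
  · ext i
    fin_cases i
    · exact (hc₀ p hp).trans (by simp [Fin.sum_univ_three])
    · exact (hc₁ p hp).trans (by simp [Fin.sum_univ_three])
    · exact (hc₂ p hp).trans (by simp [Fin.sum_univ_three])
  · ext k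
    fin_cases k
    · show depPart Φ 0 p = _
      simp only [Fin.zero_eta, Matrix.cons_val]
      rw [eq_div_iff hτ0]
      linear_combination -hv.1
    · show depPart Φ 1 p = _
      simp only [Fin.mk_one, Matrix.cons_val]
      rw [eq_div_iff hτ0]
      linear_combination -hv.2
    · exact hH p hp
    · exact (hc₃ p hp).trans (by simp [Fin.sum_univ_four])

end Symmetry

/-! ### The explicit family and its symmetry property -/

/-- The parameters of a point symmetry: the scaling `α` of time, a similarity of the plane with
the first column `(a, b)` and the orientation `ε`, and translations. -/
structure SymmParam where
  α : ℝ
  a : ℝ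
  b : ℝ
  ε : ℝ
  c : Fin 4 → ℝ
  hα : α ≠ 0
  hab : a ^ 2 + b ^ 2 ≠ 0
  hε : ε = 1 ∨ ε = -1

/-- The transformation with the given parameters. -/
noncomputable def modelFun (α a b ε : ℝ) (c : Fin 4 → ℝ) (p : Total) : Total :=
  (![α * p.1 0 + c 0, a * p.1 1 - ε * b * p.1 2 + c 1, b * p.1 1 + ε * a * p.1 2 + c 2],
    ![(a * p.2 0 - ε * b * p.2 1) / α, (b * p.2 0 + ε * a * p.2 1) / α,
      (a ^ 2 + b ^ 2) / α ^ 2 * p.2 2, (a ^ 2 + b ^ 2) / α ^ 2 * p.2 3 + c 3])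

theorem total_ext {p q : Total} (h0 : p.1 0 = q.1 0) (h1 : p.1 1 = q.1 1) (h2 : p.1 2 = q.1 2)
    (k0 : p.2 0 = q.2 0) (k1 : p.2 1 = q.2 1) (k2 : p.2 2 = q.2 2) (k3 : p.2 3 = q.2 3) :
    p = q := by
  refine Prod.ext ?_ ?_
  · ext i
    fin_cases i <;> assumption
  · ext i
    fin_cases i <;> assumption

namespace SymmParam

/-- The transformation with the given parameters. -/
noncomputable def toFun (q : SymmParam) : Total → Total := modelFun q.α q.a q.b q.ε q.c

/-- The parameters of the inverse transformation. -/
noncomputable def inv (q : SymmParam) : SymmParam where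
  α := q.α⁻¹
  a := q.a / (q.a ^ 2 + q.b ^ 2)
  b := -q.ε * q.b / (q.a ^ 2 + q.b ^ 2)
  ε := q.ε
  c := ![-q.c 0 / q.α, -(q.a * q.c 1 + q.b * q.c 2) / (q.a ^ 2 + q.b ^ 2),
    -(-q.ε * q.b * q.c 1 + q.ε * q.a * q.c 2) / (q.a ^ 2 + q.b ^ 2),
    -q.c 3 * q.α ^ 2 / (q.a ^ 2 + q.b ^ 2)]
  hα := inv_ne_zero q.hα
  hab := by
    have h := q.hab
    have : (q.a / (q.a ^ 2 + q.b ^ 2)) ^ 2 + (-q.ε * q.b / (q.a ^ 2 + q.b ^ 2)) ^ 2 =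
        (q.a ^ 2 + q.b ^ 2)⁻¹ := by
      rcases q.hε with h1 | h1 <;> rw [h1] <;> field_simp
    rw [this]
    exact inv_ne_zero h
  hε := q.hε

/-- The parameters of a composition. -/
noncomputable def mul (q r : SymmParam) : SymmParam where
  α := q.α * r.α
  a := q.a * r.a - q.ε * q.b * r.b
  b := q.b * r.a + q.ε * q.a * r.b
  ε := q.ε * r.ε
  c := ![q.α * r.c 0 + q.c 0, q.a * r.c 1 - q.ε * q.b * r.c 2 + q.c 1,
    q.b * r.c 1 + q.ε * q.a * r.c 2 + q.c 2, (q.a ^ 2 + q.b ^ 2) / q.α ^ 2 * r.c 3 + q.c 3]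
  hα := mul_ne_zero q.hα r.hα
  hab := by
    have : (q.a * r.a - q.ε * q.b * r.b) ^ 2 + (q.b * r.a + q.ε * q.a * r.b) ^ 2 =
        (q.a ^ 2 + q.b ^ 2) * (r.a ^ 2 + r.b ^ 2) := by
      rcases q.hε with h1 | h1 <;> rw [h1] <;> ring
    rw [this]
    exact mul_ne_zero q.hab r.hab
  hε := by
    rcases q.hε with h1 | h1 <;> rcases r.hε with h2 | h2 <;> rw [h1, h2] <;> simp

/-- The parameters of the identity. -/
noncomputable def one : SymmParam where
  α := 1
  a := 1
  b := 0
  ε := 1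
  c := 0
  hα := one_ne_zero
  hab := by norm_num
  hε := Or.inl rfl

theorem inv_toFun_toFun (q : SymmParam) (p : Total) : q.inv.toFun (q.toFun p) = p := by
  have h1 := q.hα
  have h2 := q.hab
  have h3 := q.hε
  obtain ⟨α, a, b, ε, c, _, _, _⟩ := q
  simp only at h1 h2 h3
  rcases h3 with rfl | rfl <;>
  refine total_ext ?_ ?_ ?_ ?_ ?_ ?_ ?_ <;>
    simp only [inv, toFun, modelFun, Matrix.cons_val, Matrix.cons_val_zero, Matrix.cons_val_one] <;>
    field_simp <;> ring

theorem toFun_inv_toFun (q : SymmParam) (p : Total) : q.toFun (q.inv.toFun p) = p := by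
  have h1 := q.hα
  have h2 := q.hab
  have h3 := q.hε
  obtain ⟨α, a, b, ε, c, _, _, _⟩ := q
  simp only at h1 h2 h3
  rcases h3 with rfl | rfl <;>
  refine total_ext ?_ ?_ ?_ ?_ ?_ ?_ ?_ <;>
    simp only [inv, toFun, modelFun, Matrix.cons_val, Matrix.cons_val_zero, Matrix.cons_val_one] <;>
    field_simp <;> ring

theorem mul_toFun (q r : SymmParam) (p : Total) :
    (q.mul r).toFun p = q.toFun (r.toFun p) := by
  have h1 := q.hα
  have h2 := r.hα
  have h3 := q.hε
  have h4 := r.hε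
  obtain ⟨α, a, b, ε, c, _, _, _⟩ := q
  obtain ⟨α', a', b', ε', c', _, _, _⟩ := r
  simp only at h1 h2 h3 h4
  rcases h3 with rfl | rfl <;>
  refine total_ext ?_ ?_ ?_ ?_ ?_ ?_ ?_ <;>
    simp only [mul, toFun, modelFun, Matrix.cons_val, Matrix.cons_val_zero, Matrix.cons_val_one] <;>
    field_simp <;> ring

theorem one_toFun (p : Total) : one.toFun p = p := by
  refine total_ext ?_ ?_ ?_ ?_ ?_ ?_ ?_ <;> simp [one, toFun, modelFun]

theorem contDiff_toFun (q : SymmParam) : ContDiff ℝ ω q.toFun := by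
  refine ContDiff.prodMk ?_ ?_
  · rw [contDiff_pi]
    intro i
    fin_cases i <;> simp <;> fun_prop
  · rw [contDiff_pi]
    intro i
    fin_cases i <;> simp [div_eq_mul_inv] <;> fun_prop

/-- The transformation with the given parameters as a homeomorphism. -/
noncomputable def toHomeomorph (q : SymmParam) : Total ≃ₜ Total where
  toFun := q.toFun
  invFun := q.inv.toFun
  left_inv := q.inv_toFun_toFun
  right_inv := q.toFun_inv_toFun
  continuous_toFun := q.contDiff_toFun.continuous
  continuous_invFun := q.inv.contDiff_toFun.continuous

/-- The linear part of the transformation. -/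
noncomputable def linearPart (q : SymmParam) : Total →L[ℝ] Total :=
  LinearMap.toContinuousLinearMap
    { toFun := modelFun q.α q.a q.b q.ε 0
      map_add' := fun x y => by
        refine total_ext ?_ ?_ ?_ ?_ ?_ ?_ ?_ <;> simp [modelFun] <;> ring
      map_smul' := fun r y => by
        refine total_ext ?_ ?_ ?_ ?_ ?_ ?_ ?_ <;> simp [modelFun] <;> ring }

theorem linearPart_apply (q : SymmParam) (p : Total) :
    q.linearPart p = modelFun q.α q.a q.b q.ε 0 p := rfl

theorem fderiv_toFun (q : SymmParam) (p : Total) : fderiv ℝ q.toFun p = q.linearPart := by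
  have h : q.toFun = fun p => q.linearPart p +
      ((![q.c 0, q.c 1, q.c 2], ![0, 0, 0, q.c 3]) : Total) := by
    ext1 p
    rw [linearPart_apply]
    refine total_ext ?_ ?_ ?_ ?_ ?_ ?_ ?_ <;> simp [toFun, modelFun]
  rw [h]
  exact (q.linearPart.hasFDerivAt.add_const _).fderiv

/-- The pair of momentum residuals is multiplied by the planar similarity over α², and the other two
residuals by (a² + b²)/α³. Both factors are invertible. -/
theorem jetEqs_iff (q : SymmParam) {y y' : Dep} {W V : Matrix (Fin 4) (Fin 3) ℝ}
    (hy0 : y' 0 = (q.a * y 0 - q.ε * q.b * y 1) / q.α)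
    (hy1 : y' 1 = (q.b * y 0 + q.ε * q.a * y 1) / q.α)
    (hy2 : y' 2 = (q.a ^ 2 + q.b ^ 2) / q.α ^ 2 * y 2)
    (hV : ∀ i j, ∑ k, V i k * (q.linearPart (tangent W j)).1 k =
      (q.linearPart (tangent W j)).2 i) : JetEqs y W ↔ JetEqs y' V := by
  simp only [linearPart_apply] at hV
  have h1 := q.hα
  have h2 := q.hab
  have h3 := q.hε
  obtain ⟨α, a, b, ε, c, _, _, _⟩ := q
  simp only at h1 h2 h3 hy0 hy1 hy2 hV
  have hε : ε * ε = 1 := by rcases h3 with rfl | rfl <;> norm_num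
  have v0 : ∀ i, V i 0 = (modelFun α a b ε 0 (tangent W 0)).2 i / α := by
    intro i
    have := hV i 0
    rw [eq_div_iff h1, ← this]
    simp [modelFun, tangent, Fin.sum_univ_three]
  have e1 : ∀ i, V i 1 * a + V i 2 * b = (modelFun α a b ε 0 (tangent W 1)).2 i := by
    intro i
    rw [← hV i 1]
    simp [modelFun, tangent, Fin.sum_univ_three]
  have e2 : ∀ i, -(V i 1 * (ε * b)) + V i 2 * (ε * a) =
      (modelFun α a b ε 0 (tangent W 2)).2 i := by
    intro i
    rw [← hV i 2]
    simp [modelFun, tangent, Fin.sum_univ_three]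
  have v1 : ∀ i, V i 1 = (a * (modelFun α a b ε 0 (tangent W 1)).2 i -
      ε * b * (modelFun α a b ε 0 (tangent W 2)).2 i) / (a ^ 2 + b ^ 2) := by
    intro i
    rw [eq_div_iff h2, ← e1, ← e2]
    linear_combination (V i 2 * a * b - V i 1 * b * b) * hε
  have v2 : ∀ i, V i 2 = (b * (modelFun α a b ε 0 (tangent W 1)).2 i +
      ε * a * (modelFun α a b ε 0 (tangent W 2)).2 i) / (a ^ 2 + b ^ 2) := by
    intro i
    rw [eq_div_iff h2, ← e1, ← e2]
    linear_combination (V i 1 * a * b - V i 2 * a * a) * hε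
  simp only [modelFun, tangent, Pi.zero_apply, add_zero] at v0 v1 v2
  have i0 : V 0 0 + y' 0 * V 0 1 + y' 1 * V 0 2 + V 2 1 - V 3 1 =
      (a * (W 0 0 + y 0 * W 0 1 + y 1 * W 0 2 + W 2 1 - W 3 1) -
        ε * b * (W 1 0 + y 0 * W 1 1 + y 1 * W 1 2 + W 2 2 - W 3 2)) / α ^ 2 := by
    rw [v0, v1, v2, v1, v1, hy0, hy1]
    simp only [Matrix.cons_val, Matrix.cons_val_zero]
    rcases h3 with rfl | rfl <;> field_simp <;> ring
  have i1 : V 1 0 + y' 0 * V 1 1 + y' 1 * V 1 2 + V 2 2 - V 3 2 =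
      (b * (W 0 0 + y 0 * W 0 1 + y 1 * W 0 2 + W 2 1 - W 3 1) +
        ε * a * (W 1 0 + y 0 * W 1 1 + y 1 * W 1 2 + W 2 2 - W 3 2)) / α ^ 2 := by
    rw [v0, v1, v2, v2, v2, hy0, hy1]
    simp only [Matrix.cons_val, Matrix.cons_val_zero, Matrix.cons_val_one]
    rcases h3 with rfl | rfl <;> field_simp <;> ring
  have i2 : V 2 0 + y' 0 * V 2 1 + y' 1 * V 2 2 + y' 2 * (V 0 1 + V 1 2) =
      (W 2 0 + y 0 * W 2 1 + y 1 * W 2 2 + y 2 * (W 0 1 + W 1 2)) *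
        ((a ^ 2 + b ^ 2) / α ^ 3) := by
    rw [v0, v1, v2, v1, v2, hy0, hy1, hy2]
    simp only [Matrix.cons_val, Matrix.cons_val_zero, Matrix.cons_val_one]
    rcases h3 with rfl | rfl <;> field_simp <;> ring
  have i3 : V 3 0 = W 3 0 * ((a ^ 2 + b ^ 2) / α ^ 3) := by
    rw [v0]
    simp only [Matrix.cons_val]
    field_simp
  have hn : (a ^ 2 + b ^ 2) / α ^ 3 ≠ 0 := div_ne_zero h2 (pow_ne_zero 3 h1)
  have hα2 : α ^ 2 ≠ 0 := pow_ne_zero 2 h1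
  set A := W 0 0 + y 0 * W 0 1 + y 1 * W 0 2 + W 2 1 - W 3 1 with hA
  set B := W 1 0 + y 0 * W 1 1 + y 1 * W 1 2 + W 2 2 - W 3 2 with hB
  have hfirst : (A = 0 ∧ B = 0) ↔ (a * A - ε * b * B = 0 ∧ b * A + ε * a * B = 0) := by
    constructor
    · rintro ⟨h, h'⟩
      rw [h, h']
      simp
    · rintro ⟨h, h'⟩
      constructor
      · apply mul_left_cancel₀ h2
        linear_combination a * h + b * h'
      · apply mul_left_cancel₀ h2
        linear_combination ε * a * h' - ε * b * h - (a ^ 2 + b ^ 2) * B * hε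
  unfold JetEqs
  rw [i2, i3, ← sub_eq_zero (b := W 3 1), ← sub_eq_zero (b := W 3 2), ← sub_eq_zero (b := V 3 1),
    ← sub_eq_zero (b := V 3 2), i0, i1, ← hA, ← hB, ← and_assoc, hfirst, ← and_assoc]
  simp [hn, h1, and_assoc]

theorem mapsGraph_isSolution_iff (q : SymmParam) {w w' : Indep → Dep} {Ω Ω' : Set Indep}
    (h : MapsGraph q.toHomeomorph.toOpenPartialHomeomorph w Ω w' Ω') :
    IsSolution w Ω ↔ IsSolution w' Ω' := by
  have hs : ContDiffOn ℝ ∞ q.toHomeomorph.toOpenPartialHomeomorph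
      q.toHomeomorph.toOpenPartialHomeomorph.source :=
    (q.contDiff_toFun.of_le (by simp)).contDiffOn
  have key : ∀ z ∈ Ω, JetEqs (w z) (jet w z) ↔ JetEqs (w' (q.toFun (z, w z)).1)
      (jet w' (q.toFun (z, w z)).1) := by
    intro z hz
    have h1 := (h.apply hz).2
    have h2 := h.jet_eq hs hz
    have h3 : fderiv ℝ q.toHomeomorph.toOpenPartialHomeomorph (z, w z) = q.linearPart :=
      q.fderiv_toFun _
    rw [h3] at h2
    have h1' : w' (q.toFun (z, w z)).1 = (q.toFun (z, w z)).2 := h1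
    refine q.jetEqs_iff ?_ ?_ ?_ h2 <;> rw [h1'] <;> simp [toFun, modelFun]
  rw [isSolution_iff, isSolution_iff]
  constructor
  · rintro ⟨-, hsol⟩
    refine ⟨h.right, fun z' hz' => ?_⟩
    have hmem : (z', w' z') ∈ Ω'.graphOn w' := ⟨z', hz', rfl⟩
    rw [← h.image_eq] at hmem
    obtain ⟨_, ⟨z, hz, rfl⟩, he⟩ := hmem
    have hz1 : (q.toFun (z, w z)).1 = z' := congrArg Prod.fst he
    rw [← hz1]
    exact (key z hz).1 (hsol z hz)
  · rintro ⟨-, hsol⟩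
    exact ⟨h.left, fun z hz => (key z hz).2 (hsol _ (h.apply hz).1)⟩

theorem isPointSymmetry (q : SymmParam) : IsPointSymmetry q.toHomeomorph where
  smooth := (q.contDiff_toFun.of_le (by simp)).contDiffOn
  smooth_symm := (q.inv.contDiff_toFun.of_le (by simp)).contDiffOn
  solution_iff := fun _ _ _ _ h => q.mapsGraph_isSolution_iff h
  acts := by
    rintro O hO ⟨p, hp⟩ -
    have hO1 : IsOpen {z : Indep | (z, p.2) ∈ O} := hO.preimage (by fun_prop)
    have hO2 : IsOpen {z : Indep | ((q.inv.toFun (z, (q.toFun p).2)).1, p.2) ∈ O} := by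
      have := q.inv.contDiff_toFun.continuous
      exact hO.preimage (by fun_prop)
    have hsnd : ∀ z, (q.toFun (z, p.2)).2 = (q.toFun p).2 := fun z => rfl
    have hsnd' : ∀ z, (q.inv.toFun (z, (q.toFun p).2)).2 = p.2 := fun z => by
      have : (q.inv.toFun (z, (q.toFun p).2)).2 = (q.inv.toFun (q.toFun p)).2 := rfl
      rw [this, inv_toFun_toFun]
    have hjet : ∀ z, jet (fun _ => p.2) z = 0 := fun z => by
      ext i j
      simp [jet]
    -- Constant sections are solutions, and they are mapped to constant sections because the new
    -- dependent variables do not involve t, x, y.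
    refine ⟨fun _ => p.2, {z | (z, p.2) ∈ O}, fun _ => (q.toFun p).2,
      {z | ((q.inv.toFun (z, (q.toFun p).2)).1, p.2) ∈ O}, ⟨p.1, hp⟩, ?_, ?_, ?_, ?_, ?_, ?_⟩
    · rintro _ ⟨z, hz, rfl⟩
      exact hz
    · refine isSolution_iff.2 ⟨⟨hO1, contDiffOn_const⟩, fun z _ => ?_⟩
      simp [hjet, JetEqs]
    · exact ⟨hO1, contDiffOn_const⟩
    · exact ⟨hO2, contDiffOn_const⟩
    · exact Set.subset_univ _
    · ext r
      constructor
      · rintro ⟨_, ⟨z, hz, rfl⟩, rfl⟩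
        refine ⟨(q.toFun (z, p.2)).1, ?_, rfl⟩
        show ((q.inv.toFun ((q.toFun (z, p.2)).1, (q.toFun p).2)).1, p.2) ∈ O
        rw [← hsnd z, Prod.mk.eta, inv_toFun_toFun]
        exact hz
      · rintro ⟨z', hz', rfl⟩
        refine ⟨((q.inv.toFun (z', (q.toFun p).2)).1, p.2), ⟨_, hz', rfl⟩, ?_⟩
        show q.toFun ((q.inv.toFun (z', (q.toFun p).2)).1, p.2) = _
        rw [← hsnd' z', Prod.mk.eta, toFun_inv_toFun]

end SymmParam

theorem exists_symmParam {Φ : OpenPartialHomeomorph Total Total} (hΦ : IsLocalPointSymmetry Φ)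
    (hconn : IsConnected Φ.source) : ∃ q : SymmParam, Set.EqOn Φ q.toFun Φ.source := by
  obtain ⟨τ, x₁, x₂, y₁, y₂, κ, c, hτ, hκ, h1, h2, h3, hΦp⟩ := exists_eq_model hΦ hconn
  have hn : x₁ ^ 2 + y₁ ^ 2 ≠ 0 := by
    rw [h1]
    exact mul_ne_zero (pow_ne_zero 2 hτ) hκ
  set d := x₁ * y₂ - y₁ * x₂ with hd
  -- Lagrange's identity for two orthogonal columns of equal length; the sign of the determinant
  -- becomes the orientation ε.
  have hdd : (d - (x₁ ^ 2 + y₁ ^ 2)) * (d + (x₁ ^ 2 + y₁ ^ 2)) = 0 := by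
    rw [hd]
    linear_combination (x₁ ^ 2 + y₁ ^ 2) * (h2 - h1) - (x₁ * x₂ + y₁ * y₂) * h3
  have hε : d / (x₁ ^ 2 + y₁ ^ 2) = 1 ∨ d / (x₁ ^ 2 + y₁ ^ 2) = -1 := by
    rcases mul_eq_zero.1 hdd with h | h
    · left
      rw [div_eq_one_iff_eq hn]
      linarith
    · right
      rw [div_eq_iff hn]
      linarith
  have hx2 : x₂ = -(d / (x₁ ^ 2 + y₁ ^ 2) * y₁) := by
    field_simp
    rw [hd]
    linear_combination x₁ * h3
  have hy2 : y₂ = d / (x₁ ^ 2 + y₁ ^ 2) * x₁ := by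
    field_simp
    rw [hd]
    linear_combination y₁ * h3
  have hκ' : κ = (x₁ ^ 2 + y₁ ^ 2) / τ ^ 2 := by
    rw [h1]
    field_simp
  refine ⟨⟨τ, x₁, y₁, d / (x₁ ^ 2 + y₁ ^ 2), c, hτ, hn, hε⟩, fun p hp => ?_⟩
  rw [hΦp p hp]
  refine total_ext ?_ ?_ ?_ ?_ ?_ ?_ ?_ <;>
    simp only [SymmParam.toFun, modelFun, Matrix.cons_val, Matrix.cons_val_zero,
      Matrix.cons_val_one]
  · linear_combination p.1 2 * hx2
  · linear_combination p.1 2 * hy2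
  · linear_combination p.2 1 / τ * hx2
  · linear_combination p.2 1 / τ * hy2
  · linear_combination p.2 2 * hκ'
  · linear_combination p.2 3 * hκ'

/-! ### The symmetry group and the extension of local symmetries -/

namespace SymmParam

theorem toHomeomorph_mul (q r : SymmParam) :
    q.toHomeomorph * r.toHomeomorph = (q.mul r).toHomeomorph :=
  Homeomorph.ext fun p => (q.mul_toFun r p).symm

theorem toHomeomorph_one : one.toHomeomorph = 1 :=
  Homeomorph.ext one_toFun

theorem toHomeomorph_inv (q : SymmParam) : q.toHomeomorph⁻¹ = q.inv.toHomeomorph :=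
  Homeomorph.ext fun _ => rfl

/-- The transformations are analytic, so the identity theorem applies; this gives the uniqueness of
the extension. -/
theorem eq_of_eqOn {q r : SymmParam} {U : Set Total} (hU : IsOpen U) (hne : U.Nonempty)
    (h : Set.EqOn q.toFun r.toFun U) : q.toHomeomorph = r.toHomeomorph := by
  obtain ⟨p, hp⟩ := hne
  have hq := contDiff_omega_iff_analyticOnNhd.1 q.contDiff_toFun
  have hr := contDiff_omega_iff_analyticOnNhd.1 r.contDiff_toFun
  have := hq.eqOn_of_preconnected_of_eventuallyEq hr isPreconnected_univ (Set.mem_univ p)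
    (Filter.eventuallyEq_of_mem (hU.mem_nhds hp) h)
  exact Homeomorph.ext fun x => this (Set.mem_univ x)

end SymmParam

theorem isPointSymmetry_iff {g : Total ≃ₜ Total} :
    IsPointSymmetry g ↔ ∃ q : SymmParam, g = q.toHomeomorph := by
  constructor
  · intro h
    obtain ⟨q, hq⟩ := exists_symmParam h isConnected_univ
    exact ⟨q, Homeomorph.ext fun p => hq (Set.mem_univ p)⟩
  · rintro ⟨q, rfl⟩
    exact q.isPointSymmetry

/-- The complete point symmetry group of the extended shallow water system. -/
def pointSymmetryGroup : Subgroup (Total ≃ₜ Total) where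
  carrier := {g | IsPointSymmetry g}
  mul_mem' := by
    intro g h hg hh
    obtain ⟨q, rfl⟩ := isPointSymmetry_iff.1 hg
    obtain ⟨r, rfl⟩ := isPointSymmetry_iff.1 hh
    exact isPointSymmetry_iff.2 ⟨_, q.toHomeomorph_mul r⟩
  one_mem' := isPointSymmetry_iff.2 ⟨_, SymmParam.toHomeomorph_one.symm⟩
  inv_mem' := by
    intro g hg
    obtain ⟨q, rfl⟩ := isPointSymmetry_iff.1 hg
    exact isPointSymmetry_iff.2 ⟨_, q.toHomeomorph_inv⟩

/-- The point symmetry with the given parameters. -/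
noncomputable def SymmParam.toSymmetry (q : SymmParam) : pointSymmetryGroup :=
  ⟨q.toHomeomorph, q.isPointSymmetry⟩

theorem exists_eq_toSymmetry (g : pointSymmetryGroup) : ∃ q : SymmParam, g = q.toSymmetry := by
  obtain ⟨q, hq⟩ := isPointSymmetry_iff.1 g.2
  exact ⟨q, Subtype.ext hq⟩

theorem existsUnique_extension {Φ : OpenPartialHomeomorph Total Total}
    (hΦ : IsLocalPointSymmetry Φ) (hconn : IsConnected Φ.source) :
    ∃! g : pointSymmetryGroup, Set.EqOn Φ (g : Total ≃ₜ Total) Φ.source := by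
  obtain ⟨q, hq⟩ := exists_symmParam hΦ hconn
  refine ⟨q.toSymmetry, hq, fun g hg => ?_⟩
  obtain ⟨r, rfl⟩ := exists_eq_toSymmetry g
  exact Subtype.ext (SymmParam.eq_of_eqOn Φ.open_source hconn.nonempty (hg.symm.trans hq))

/-! ### Signs and the identity component -/

/-- The increment of the `i`-th independent variable of `g p` along the `j`-th coordinate vector. -/
noncomputable def increment (i j : Fin 3) (g : Total ≃ₜ Total) : ℝ :=
  (g (Pi.single j 1, 0)).1 i - (g 0).1 i

theorem continuous_eval (p : Total) : Continuous fun g : Total ≃ₜ Total => g p :=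
  (continuous_eval_const (F := C(Total, Total)) p).comp (continuous_fst.comp continuous_toMap_pair)

theorem continuous_increment (i j : Fin 3) : Continuous (increment i j) := by
  have h1 := continuous_eval (Pi.single j 1, 0)
  have h2 := continuous_eval 0
  exact (((continuous_apply i).comp continuous_fst).comp h1).sub
    (((continuous_apply i).comp continuous_fst).comp h2)

/-- The scaling of time. -/
noncomputable def timeScale (g : pointSymmetryGroup) : ℝ := increment 0 0 g

/-- The scaling of the oriented area in the plane of the space variables. -/
noncomputable def areaScale (g : pointSymmetryGroup) : ℝ :=
  increment 1 1 g * increment 2 2 g - increment 1 2 g * increment 2 1 g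

theorem timeScale_toSymmetry (q : SymmParam) : timeScale q.toSymmetry = q.α := by
  change (q.toFun _).1 0 - (q.toFun _).1 0 = _
  simp [SymmParam.toFun, modelFun]

theorem areaScale_toSymmetry (q : SymmParam) :
    areaScale q.toSymmetry = q.ε * (q.a ^ 2 + q.b ^ 2) := by
  change ((q.toFun _).1 1 - (q.toFun _).1 1) * ((q.toFun _).1 2 - (q.toFun _).1 2) -
    ((q.toFun _).1 1 - (q.toFun _).1 1) * ((q.toFun _).1 2 - (q.toFun _).1 2) = _
  simp [SymmParam.toFun, modelFun]
  ring

theorem continuous_timeScale : Continuous timeScale :=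
  (continuous_increment 0 0).comp continuous_subtype_val

theorem continuous_areaScale : Continuous areaScale := by
  have h := fun i j => (continuous_increment i j).comp
    (continuous_subtype_val (p := (· ∈ pointSymmetryGroup)))
  exact ((h 1 1).mul (h 2 2)).sub ((h 1 2).mul (h 2 1))

theorem SymmParam.ε_ne_zero (q : SymmParam) : q.ε ≠ 0 := by
  rcases q.hε with h | h <;> rw [h] <;> norm_num

theorem timeScale_ne_zero (g : pointSymmetryGroup) : timeScale g ≠ 0 := by
  obtain ⟨q, rfl⟩ := exists_eq_toSymmetry g
  rw [timeScale_toSymmetry]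
  exact q.hα

theorem areaScale_ne_zero (g : pointSymmetryGroup) : areaScale g ≠ 0 := by
  obtain ⟨q, rfl⟩ := exists_eq_toSymmetry g
  rw [areaScale_toSymmetry]
  exact mul_ne_zero q.ε_ne_zero q.hab

theorem toSymmetry_mul (q r : SymmParam) :
    q.toSymmetry * r.toSymmetry = (q.mul r).toSymmetry :=
  Subtype.ext (q.toHomeomorph_mul r)

theorem timeScale_mul (g h : pointSymmetryGroup) :
    timeScale (g * h) = timeScale g * timeScale h := by
  obtain ⟨q, rfl⟩ := exists_eq_toSymmetry g
  obtain ⟨r, rfl⟩ := exists_eq_toSymmetry h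
  simp only [toSymmetry_mul, timeScale_toSymmetry, SymmParam.mul]

theorem areaScale_mul (g h : pointSymmetryGroup) :
    areaScale (g * h) = areaScale g * areaScale h := by
  obtain ⟨q, rfl⟩ := exists_eq_toSymmetry g
  obtain ⟨r, rfl⟩ := exists_eq_toSymmetry h
  simp only [toSymmetry_mul, areaScale_toSymmetry, SymmParam.mul]
  rcases q.hε with h | h <;> rw [h] <;> ring

/-- The sign of a nonzero real number as an element of `ZMod 2`. -/
noncomputable def signBit (x : ℝ) : ZMod 2 := if 0 < x then 0 else 1

theorem signBit_eq_zero {x : ℝ} : signBit x = 0 ↔ 0 < x := by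
  unfold signBit
  split_ifs with h <;> simp [h]

theorem signBit_mul {x y : ℝ} (hx : x ≠ 0) (hy : y ≠ 0) :
    signBit (x * y) = signBit x + signBit y := by
  unfold signBit
  rcases lt_or_gt_of_ne hx with h1 | h1 <;> rcases lt_or_gt_of_ne hy with h2 | h2
  · rw [if_pos (mul_pos_of_neg_of_neg h1 h2), if_neg h1.not_gt, if_neg h2.not_gt]
    rfl
  · rw [if_neg (mul_neg_of_neg_of_pos h1 h2).not_gt, if_neg h1.not_gt, if_pos h2, add_zero]
  · rw [if_neg (mul_neg_of_pos_of_neg h1 h2).not_gt, if_pos h1, if_neg h2.not_gt, zero_add]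
  · rw [if_pos (mul_pos h1 h2), if_pos h1, if_pos h2, add_zero]

/-- The signs of the scalings of time and of the oriented area. -/
noncomputable def signs : pointSymmetryGroup →* Multiplicative (ZMod 2 × ZMod 2) :=
  MonoidHom.mk' (fun g => Multiplicative.ofAdd (signBit (timeScale g), signBit (areaScale g)))
    fun g h => by
      rw [timeScale_mul, areaScale_mul,
        signBit_mul (timeScale_ne_zero g) (timeScale_ne_zero h),
        signBit_mul (areaScale_ne_zero g) (areaScale_ne_zero h)]
      rfl

theorem mem_ker_signs {g : pointSymmetryGroup} :
    g ∈ signs.ker ↔ 0 < timeScale g ∧ 0 < areaScale g := by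
  rw [MonoidHom.mem_ker, ← signBit_eq_zero, ← signBit_eq_zero]
  exact Prod.mk_inj

theorem signs_surjective : Function.Surjective signs := by
  intro s
  obtain ⟨α, hα, hα'⟩ : ∃ α : ℝ, α ≠ 0 ∧ signBit α = (Multiplicative.toAdd s).1 := by
    generalize (Multiplicative.toAdd s).1 = k
    fin_cases k
    · exact ⟨1, one_ne_zero, if_pos one_pos⟩
    · exact ⟨-1, by norm_num, if_neg (by norm_num)⟩
  obtain ⟨ε, hε, hε'⟩ : ∃ ε : ℝ, (ε = 1 ∨ ε = -1) ∧ signBit ε = (Multiplicative.toAdd s).2 := by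
    generalize (Multiplicative.toAdd s).2 = k
    fin_cases k
    · exact ⟨1, by norm_num, if_pos one_pos⟩
    · exact ⟨-1, by norm_num, if_neg (by norm_num)⟩
  refine ⟨SymmParam.toSymmetry ⟨α, 1, 0, ε, 0, hα, by norm_num, hε⟩, ?_⟩
  change Multiplicative.ofAdd (signBit (timeScale _), signBit (areaScale _)) = s
  rw [timeScale_toSymmetry, areaScale_toSymmetry]
  simp [hα', hε']

theorem pos_of_mem_connectedComponent {X : Type*} [TopologicalSpace X] {f : X → ℝ}
    (hf : Continuous f) (h0 : ∀ x, f x ≠ 0) {x y : X} (hx : 0 < f x)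
    (hy : y ∈ connectedComponent x) : 0 < f y := by
  by_contra h
  have hpre := isPreconnected_connectedComponent (x := x)
  obtain ⟨z, -, hz⟩ := hpre.intermediate_value hy mem_connectedComponent hf.continuousOn
    (⟨not_lt.1 h, hx.le⟩ : (0 : ℝ) ∈ Set.Icc (f y) (f x))
  exact h0 z hz

/-- A parametrization of the orientation-preserving symmetries by a vector space. -/
noncomputable def expParam (s : ℝ × ℂ × (Fin 4 → ℝ)) : SymmParam where
  α := Real.exp s.1
  a := (Complex.exp s.2.1).re
  b := (Complex.exp s.2.1).im
  ε := 1
  c := s.2.2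
  hα := (Real.exp_pos _).ne'
  hab := by
    rw [sq, sq, ← Complex.normSq_apply]
    exact (Complex.normSq_pos.2 (Complex.exp_ne_zero _)).ne'
  hε := Or.inl rfl

theorem continuous_modelFun {X : Type*} [TopologicalSpace X] {α a b ε : X → ℝ}
    {c : X → Fin 4 → ℝ} {p : X → Total} (hα : Continuous α) (ha : Continuous a)
    (hb : Continuous b) (hε : Continuous ε) (hc : Continuous c) (hp : Continuous p)
    (h0 : ∀ x, α x ≠ 0) :
    Continuous fun x => modelFun (α x) (a x) (b x) (ε x) (c x) (p x) := by
  have h1 : ∀ i, Continuous fun x => (p x).1 i := fun i => by fun_prop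
  have h2 : ∀ i, Continuous fun x => (p x).2 i := fun i => by fun_prop
  have h3 : ∀ i, Continuous fun x => c x i := fun i => by fun_prop
  have h4 : ∀ x, α x ^ 2 ≠ 0 := fun x => pow_ne_zero 2 (h0 x)
  refine Continuous.prodMk ?_ ?_
  · refine continuous_pi fun i => ?_
    fin_cases i <;> simp <;> fun_prop
  · refine continuous_pi fun i => ?_
    fin_cases i <;> simp <;> fun_prop (disch := assumption)

theorem continuous_expParam : Continuous fun s => (expParam s).toSymmetry := by
  have h0 : ∀ s, (expParam s).a ^ 2 + (expParam s).b ^ 2 ≠ 0 := fun s => (expParam s).hab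
  have hα0 : ∀ s, (expParam s).α ≠ 0 := fun s => (expParam s).hα
  have hα : Continuous fun s => (expParam s).α := Real.continuous_exp.comp continuous_fst
  have ha : Continuous fun s => (expParam s).a :=
    Complex.continuous_re.comp (Complex.continuous_exp.comp (by fun_prop))
  have hb : Continuous fun s => (expParam s).b :=
    Complex.continuous_im.comp (Complex.continuous_exp.comp (by fun_prop))
  have hε : Continuous fun s => (expParam s).ε := continuous_const
  have hc : Continuous fun s => (expParam s).c := by
    change Continuous fun s : ℝ × ℂ × (Fin 4 → ℝ) => s.2.2
    fun_prop
  have hci : ∀ i, Continuous fun s => (expParam s).c i := fun i => by fun_prop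
  refine continuous_induced_rng.2 (continuous_induced_rng.2 (Continuous.prodMk ?_ ?_))
  · refine ContinuousMap.continuous_of_continuous_uncurry _ ?_
    exact continuous_modelFun (hα.comp continuous_fst) (ha.comp continuous_fst)
      (hb.comp continuous_fst) (hε.comp continuous_fst) (hc.comp continuous_fst) continuous_snd
      fun x => hα0 x.1
  · refine ContinuousMap.continuous_of_continuous_uncurry _ ?_
    have hα' : Continuous fun s => (expParam s).inv.α := hα.inv₀ hα0
    have ha' : Continuous fun s => (expParam s).inv.a := ha.div (by fun_prop) h0
    have hb' : Continuous fun s => (expParam s).inv.b := (hε.neg.mul hb).div (by fun_prop) h0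
    have hc' : Continuous fun s => (expParam s).inv.c := by
      refine continuous_pi fun i => ?_
      fin_cases i <;> simp [SymmParam.inv] <;> fun_prop (disch := assumption)
    exact continuous_modelFun (hα'.comp continuous_fst) (ha'.comp continuous_fst)
      (hb'.comp continuous_fst) (hε.comp continuous_fst) (hc'.comp continuous_fst) continuous_snd
      fun x => (expParam x.1).inv.hα

/-- A positive α has a real logarithm, and an orientation preserving similarity is multiplication by
the nonzero complex number a + ib, which has a complex logarithm. -/
theorem mem_range_expParam {g : pointSymmetryGroup} (hg : g ∈ signs.ker) :
    ∃ s, (expParam s).toSymmetry = g := by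
  obtain ⟨h1, h2⟩ := mem_ker_signs.1 hg
  obtain ⟨⟨α, a, b, ε, c, hα, hab, hε⟩, rfl⟩ := exists_eq_toSymmetry g
  rw [timeScale_toSymmetry] at h1
  rw [areaScale_toSymmetry] at h2
  have hε1 : ε = 1 := by
    rcases hε with h | rfl
    · exact h
    · nlinarith [sq_nonneg a, sq_nonneg b]
  have hz : (⟨a, b⟩ : ℂ) ≠ 0 := by
    intro h
    apply hab
    rw [show a = 0 from congrArg Complex.re h, show b = 0 from congrArg Complex.im h]
    norm_num
  refine ⟨(Real.log α, Complex.log ⟨a, b⟩, c), ?_⟩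
  congr 1
  simp only [expParam, Real.exp_log h1, Complex.exp_log hz, hε1]

/-- One inclusion holds because the kernel lies in the range of a continuous map from a vector
space, a connected set containing the identity. The other is the intermediate value theorem for the
two nonvanishing scalings. -/
theorem ker_signs : signs.ker = Subgroup.connectedComponentOfOne pointSymmetryGroup := by
  have hone : (1 : pointSymmetryGroup) ∈ signs.ker := one_mem _
  ext g
  constructor
  · intro hg
    obtain ⟨s, rfl⟩ := mem_range_expParam hg
    obtain ⟨s₁, hs₁⟩ := mem_range_expParam hone
    exact (isPreconnected_range continuous_expParam).subset_connectedComponent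
      ⟨s₁, hs₁⟩ ⟨s, rfl⟩
  · intro hg
    obtain ⟨h1, h2⟩ := mem_ker_signs.1 hone
    exact mem_ker_signs.2 ⟨pos_of_mem_connectedComponent continuous_timeScale timeScale_ne_zero
      h1 hg, pos_of_mem_connectedComponent continuous_areaScale areaScale_ne_zero h2 hg⟩

end ShallowWater

theorem mainTheorem4 :
    ∃ G : Subgroup (ShallowWater.Total ≃ₜ ShallowWater.Total),
      (∀ g : ShallowWater.Total ≃ₜ ShallowWater.Total,
        g ∈ G ↔ ShallowWater.IsPointSymmetry g) ∧
      (∀ Φ : OpenPartialHomeomorph ShallowWater.Total ShallowWater.Total,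
        ShallowWater.IsLocalPointSymmetry Φ → IsConnected Φ.source →
          ∃! g : G, Set.EqOn Φ (g : ShallowWater.Total ≃ₜ ShallowWater.Total) Φ.source) ∧
      Nonempty ((G ⧸ Subgroup.connectedComponentOfOne G) ≃*
        Multiplicative (ZMod 2 × ZMod 2)) := by
  refine ⟨ShallowWater.pointSymmetryGroup, fun _ => Iff.rfl,
    fun _ => ShallowWater.existsUnique_extension, ⟨?_⟩⟩
  exact (QuotientGroup.quotientMulEquivOfEq ShallowWater.ker_signs.symm).trans
    (QuotientGroup.quotientKerEquivOfSurjective _ ShallowWater.signs_surjective)
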